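/- Let $2\le n\le 6$. \emph{Oriented swap process.} Each pair of adjacent positions $k,k+1$ of $\{1,\dots,n\}$ ($1\le k\le n-1$) carries a Poisson clock of rate $1$, and the $n-1$ clocks are independent. At time $0$ the particle labelled $j$ is in position $j$, for $j=1,\dots,n$. Whenever the clock of the pair $k,k+1$ rings, the particles with labels $i$ and $j$ that occupy the positions $k$ and $k+1$, respectively, swap if $i<j$; otherwise nothing happens. Let $U_n(k)$ be the last time at which a swap occurs between positions $k$ and $k+1$, and let $\boldsymbol U_n=(U_n(1),\dots,U_n(n-1))$. \emph{Last passage percolation.} Let $(X_{i,j})_{i,j\ge1}$ be independent exponential random variables of rate $1$, and let $$L(1,1;i,j)=\max_{\pi}\sum_{(a,b)\in\pi}X_{a,b},$$ where the maximum is over all lattice paths $\pi$ from $(1,1)$ to $(i,j)$ with $i+j-2$ unit steps. Let $\boldsymbol V_n=(L(1,1;n-1,1),L(1,1;n-2,2),\dots,L(1,1;1,n-1))$. Then the random vectors $\boldsymbol U_n$ and $\boldsymbol V_n$ have the same distribution. -/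

import Mathlib

open MeasureTheory ProbabilityTheory

noncomputable section

namespace OrientedSwap

/-- A family of independent real random variables, each exponentially distributed with rate `1`. -/
structure IsIIDExp {ι Ω : Type*} [MeasurableSpace Ω] (X : ι → Ω → ℝ) (μ : Measure Ω) : Prop where
  measurable : ∀ i, Measurable (X i)
  indep : iIndepFun X μ
  law : ∀ i, μ.map (X i) = expMeasure 1

/-! ### Poisson clocks -/

/-- The waiting times of a sequence of ring times: `T 0, T 1 - T 0, T 2 - T 1, …`. -/
def waiting (T : ℕ → ℝ) : ℕ → ℝ
  | 0 => T 0
  | m + 1 => T (m + 1) - T m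

/-- `T k m` is the time of the `m`-th ring (`m = 0, 1, …`) of clock `k`, and the clocks are
independent Poisson processes of rate `1`: all the waiting times, of all the clocks, are independent
exponential random variables of rate `1`. -/
def IsPoissonClocks {κ Ω : Type*} [MeasurableSpace Ω] (T : κ → ℕ → Ω → ℝ) (μ : Measure Ω) : Prop :=
  IsIIDExp (fun (p : κ × ℕ) ω => waiting (fun m => T p.1 m ω) p.2) μ

/-! ### The oriented swap process

Positions and labels are the elements of `Fin n`, counted from `0`. The pair of adjacent positions
`k, k + 1` is indexed by `k : Fin (n - 1)`. A configuration `η : Equiv.Perm (Fin n)` sends a position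
to the label of the particle that occupies it. In the next definitions `T : Fin (n - 1) → ℕ → ℝ` is
one realization of the ring times. -/

variable {n : ℕ}

/-- The left position of the `k`-th adjacent pair. -/
def leftPos (k : Fin (n - 1)) : Fin n := ⟨k, by omega⟩

/-- The right position of the `k`-th adjacent pair. -/
def rightPos (k : Fin (n - 1)) : Fin n := ⟨k + 1, by omega⟩

/-- A swap at the `k`-th pair is allowed if it increases the number of inversions. -/
def CanSwap (η : Equiv.Perm (Fin n)) (k : Fin (n - 1)) : Prop :=
  η (leftPos k) < η (rightPos k)

open Classical in
/-- The configuration after an attempt to swap the particles of the `k`-th pair. -/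
def attempt (η : Equiv.Perm (Fin n)) (k : Fin (n - 1)) : Equiv.Perm (Fin n) :=
  if CanSwap η k then η * Equiv.swap (leftPos k) (rightPos k) else η

/-- Clock `k` rings at time `t`. -/
def RingsAt (T : Fin (n - 1) → ℕ → ℝ) (k : Fin (n - 1)) (t : ℝ) : Prop := ∃ m, T k m = t

/-- `jumpTime T r` is the time of the `r`-th ring among all the rings of all the clocks
(`r = 1, 2, …`), and `jumpTime T 0 = 0`: each is the first ring after the preceding one. -/
def jumpTime (T : Fin (n - 1) → ℕ → ℝ) : ℕ → ℝ
  | 0 => 0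
  | r + 1 => sInf {s | jumpTime T r < s ∧ ∃ k, RingsAt T k s}

open Classical in
/-- The configuration after the first `r` rings, starting from the identity. At each ring, the
ringing clock attempts a swap. (Almost surely no two clocks ring at the same time; if they do, they
are served in increasing order.) -/
def config (T : Fin (n - 1) → ℕ → ℝ) : ℕ → Equiv.Perm (Fin n)
  | 0 => 1
  | r + 1 => ((List.finRange (n - 1)).filter
      (fun k => RingsAt T k (jumpTime T (r + 1)))).foldl attempt (config T r)

/-- The times at which a swap occurs at the `k`-th pair of positions. -/
def swapTimes (T : Fin (n - 1) → ℕ → ℝ) (k : Fin (n - 1)) : Set ℝ :=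
  {t | ∃ r, t = jumpTime T (r + 1) ∧ RingsAt T k t ∧ CanSwap (config T r) k}

/-- The vector of last swap times. -/
def lastSwap (T : Fin (n - 1) → ℕ → ℝ) (k : Fin (n - 1)) : ℝ := sSup (swapTimes T k)

/-! ### Last passage percolation -/

/-- The `ℓ¹` distance on `ℕ × ℕ`. -/
def gridDist (p q : ℕ × ℕ) : ℕ := Nat.dist p.1 q.1 + Nat.dist p.2 q.2

/-- `γ 0, …, γ m` with `m = gridDist p q` is a directed lattice path from `p` to `q`; only these
values of `γ` matter. -/
def IsDirectedPath (p q : ℕ × ℕ) (γ : ℕ → ℕ × ℕ) : Prop :=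
  γ 0 = p ∧ γ (gridDist p q) = q ∧ ∀ k < gridDist p q, gridDist (γ k) (γ (k + 1)) = 1

/-- The last passage time from `p` to `q` in the environment `x`: the maximal weight of a directed
lattice path (the supremum is over a finite nonempty set of values). -/
def lpp (x : ℕ × ℕ → ℝ) (p q : ℕ × ℕ) : ℝ :=
  sSup {s | ∃ γ, IsDirectedPath p q γ ∧ s = ∑ k ∈ Finset.range (gridDist p q + 1), x (γ k)}

/-- The vector `(L(1,1; n-1,1), L(1,1; n-2,2), …, L(1,1; 1,n-1))`. -/
def lppVector (n : ℕ) (x : ℕ × ℕ → ℝ) (k : Fin (n - 1)) : ℝ :=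
  lpp x (1, 1) (n - (k + 1), k + 1)

end OrientedSwap

end

/-!
Both random vectors are compared through their characteristic functions, and both characteristic
functions are embedded in a finite family that satisfies a linear system.

For the swap process the family is indexed by the initial configuration `η` (`charLastSwap θ η`).
The first ring among all the clocks and its time are independent of what remains of the waiting
times (`integral_isFirst`), and the last swap times of the unsettled pairs are shifted by this time.
This gives `charLastSwap_firstStep`, where the generator of the process appears on the left, and on
the right `-i` times the sum of the `θ k` over the pairs at which swaps are still to come. The last
swap times are limits of functions of the first `N` rings, because all is almost surely settled after
finitely many rings (`ae_eventually_settled`). For last passage percolation the family is indexed by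
the partitions in the staircase (`charPassage θ r`): the boxes of the partition `r` are emptied, and
the first-step equation `charPassage_firstStep` is obtained by waiting for the first corner of `r` to
be filled.

The two systems are intertwined. A function on configurations is a combination of the indicator
functions of the upper sets `{η | v ≤ η}` of the Bruhat order. For each partition `r` let `Λ r` be
the linear functional whose value at this indicator function is the signed number of increasing
tableaux with shape inside `r` and with Demazure product `v`. By the lifting property of the Bruhat
order (`bruhatLE_attempt`), and since the settled configurations form a principal upper set
(`bruhatLE_join`), the functionals intertwine the generator of the swap process with that of the
growth of partitions, and restriction to configurations settled at `k` with restriction to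
partitions that contain a rectangle (`exists_dual_functionals`). These properties amount to
identities between signed sums of shapes, which `checkAll` evaluates for all permutations of at most
six letters. Hence `r ↦ Λ r (charLastSwap θ)` solves the system of `charPassage θ`, whose solution is
unique by downward induction on `r`, and the empty partition gives the equality of the
characteristic functions (`eq_of_firstStep`).
-/

namespace OrientedSwap

/-! ### The finite check

The definitions are written with recursors, so that the kernel evaluates them quickly. In the
recursor of `Bool` the case of `false` comes first. -/

/-- The word with its letters in positions `i` and `i + 1` exchanged. -/
def swapAt (i : ℕ) : List ℕ → List ℕ :=
  Nat.rec
    (fun w => List.rec [] (fun a l _ => List.rec [a] (fun b m _ => b :: a :: m) l) w)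
    (fun _ ih w => List.rec [] (fun a l _ => a :: ih l) w) i

/-- Whether the letters in positions `i` and `i + 1` are in increasing order. -/
def ascentAt (i : ℕ) : List ℕ → Bool :=
  Nat.rec
    (fun w => List.rec false (fun a l _ => List.rec false (fun b _ _ => Nat.blt a b) l) w)
    (fun _ ih w => List.rec false (fun _ l _ => ih l) w) i

/-- The strictly increasing words with letters in `1, …, n - 1` that are larger than `q` and that are
possible as a row of an increasing tableau below the row `p`: the word is no longer than `p`, and each
letter is larger than the letter of `p` above it. -/
def rowsBelow (n : ℕ) : List ℕ → ℕ → List (List ℕ)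
  | [], _ => [[]]
  | p :: ps, q => [] :: ((List.range n).filter fun x => Nat.blt p x && Nat.blt q x).flatMap
      fun x => (rowsBelow n ps x).map (x :: ·)

/-- The fillings with `m` rows, some of which may be empty, whose rows and columns increase strictly,
and that can be placed below the row `p`. -/
def tableauxBelow (n : ℕ) : ℕ → List ℕ → List (List (List ℕ))
  | 0, _ => [[]]
  | m + 1, p => (rowsBelow n p 0).flatMap fun r => (tableauxBelow n m r).map (r :: ·)

/-- The increasing tableaux with letters in `1, …, n - 1`. The list of rows is completed to length
`n - 1` by empty rows. -/
def tableaux (n : ℕ) : List (List (List ℕ)) :=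
  tableauxBelow n (n - 1) (List.replicate (n - 1) 0)

/-- The right action of the generator with index `x` of the `0`-Hecke algebra on signed words: an
ascent in positions `x - 1, x` is exchanged, and the sign changes if there is none. -/
def heckeMul (p : List ℕ × ℤ) (x : ℕ) : List ℕ × ℤ :=
  Bool.rec (p.1, -p.2) (swapAt (x - 1) p.1, p.2) (ascentAt (x - 1) p.1)

/-- Formal integer combinations of shapes. A shape is the list of its `n - 1` row lengths. -/
abbrev ShapeSum := List (List ℕ × ℤ)

/-- The contribution of the tableau `t`: the permutation obtained by letting the letters of `t` act,
the rows being read from the last one to the first one and each from left to right, together with the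
shape of `t` and the sign. -/
def tableauTerm (n : ℕ) (t : List (List ℕ)) : List ℕ × (List ℕ × ℤ) :=
  let p := t.reverse.flatten.foldl heckeMul (List.range n, 1)
  (p.1, (t.map List.length, p.2))

/-- A dictionary of formal sums of shapes whose keys are words of length `d`. -/
def Trie : ℕ → Type
  | 0 => ShapeSum
  | d + 1 => List (Trie d)

/-- The entries of `l` whose word starts with `a`, with this letter removed. -/
def startingWith (a : ℕ) (l : List (List ℕ × (List ℕ × ℤ))) : List (List ℕ × (List ℕ × ℤ)) :=
  List.rec [] (fun e _ r => List.rec r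
    (fun b w _ => Bool.rec r ((w, e.2) :: r) (Nat.beq a b)) e.1) l

/-- The dictionary that collects the terms of a list by their words with letters below `n`. -/
def Trie.build (n d : ℕ) : List (List ℕ × (List ℕ × ℤ)) → Trie d :=
  Nat.rec (fun l => l.map Prod.snd)
    (fun d ih l => ((List.range n).map fun a => ih (startingWith a l) : List (Trie d))) d

/-- The entry of a list with a given index, and `d` beyond the end of the list. -/
def entryAt {α : Type} (d : α) (l : List α) : ℕ → α :=
  List.rec (fun _ => d) (fun a _ ih i => Nat.rec a (fun j _ => ih j) i) l

/-- The empty dictionary. -/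
def Trie.empty : (d : ℕ) → Trie d
  | 0 => []
  | _ + 1 => []

/-- The formal sum stored with the given word. -/
def Trie.lookup : (d : ℕ) → Trie d → List ℕ → ShapeSum
  | 0, t, _ => t
  | _ + 1, _, [] => []
  | d + 1, t, a :: w => Trie.lookup d (entryAt (Trie.empty d) (show List (Trie d) from t) a) w

/-- Equality of lists of numbers. -/
def eqList (l : List ℕ) : List ℕ → Bool :=
  List.rec (fun m => List.rec true (fun _ _ _ => false) m)
    (fun a _ ih m => List.rec false (fun b m _ => Bool.rec false (ih m) (Nat.beq a b)) m) l

/-- The coefficient of the shape `s`. -/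
def coeffOf (s : List ℕ) (l : ShapeSum) : ℤ :=
  List.rec 0 (fun q _ r => Bool.rec r (q.2 + r) (eqList s q.1)) l

/-- The formal sum without the terms with shape `s`. -/
def removeShape (s : List ℕ) (l : ShapeSum) : ShapeSum :=
  List.rec [] (fun q _ r => Bool.rec (q :: r) r (eqList s q.1)) l

/-- Whether an integer vanishes. -/
def isZero : ℤ → Bool
  | .ofNat m => Nat.beq m 0
  | .negSucc _ => false

/-- Whether all the coefficients of a formal sum with at most `m` terms vanish. -/
def zeroSum : ℕ → ShapeSum → Bool
  | _, [] => true
  | 0, _ :: _ => false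
  | m + 1, p :: l => isZero (p.2 + coeffOf p.1 l) && zeroSum m (removeShape p.1 l)

/-- The opposite of a formal sum. -/
def negSum (l : ShapeSum) : ShapeSum := l.map fun p => (p.1, -p.2)

/-- The length of row `i` of a shape. -/
def part (s : List ℕ) (i : ℕ) : ℕ := entryAt 0 s i

/-- Whether the last box of row `i` can be removed from the shape. -/
def isCorner (s : List ℕ) (i : ℕ) : Bool := Nat.blt (part s (i + 1)) (part s i)

/-- The shape without the last box of row `i`. -/
def removeBox (n : ℕ) (s : List ℕ) (i : ℕ) : List ℕ :=
  (List.range (n - 1)).map fun j => Bool.rec (part s j) (part s j - 1) (Nat.beq j i)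

/-- The maximum of two numbers. -/
def bmax (a b : ℕ) : ℕ := Bool.rec a b (Nat.ble a b)

/-- The union of a shape and the rectangle with `n - k` rows of length `k`. -/
def addRect (n k : ℕ) (s : List ℕ) : List ℕ :=
  (List.range (n - 1)).map fun j => Bool.rec (part s j) (bmax (part s j) k) (Nat.blt j (n - k))

/-- Whether `s` is a partition contained in the staircase with rows `n - 1, …, 1`. -/
def validShape (n : ℕ) (s : List ℕ) : Bool :=
  Nat.beq s.length (n - 1) &&
  (List.range (n - 1)).all fun i =>
    Nat.ble (part s (i + 1)) (part s i) && Nat.ble (part s i + i + 1) n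

/-- Adds one to each of the first `m` entries. -/
def bump (m : ℕ) : List ℕ → List ℕ :=
  Nat.rec (fun l => l) (fun _ ih l => List.rec [] (fun x l _ => (x + 1) :: ih l) l) m

/-- The partial sums of the indicator functions of `{0, …, a}`, for `a` in `w`, added to `acc`. -/
def rankRows (w : List ℕ) : List ℕ → List (List ℕ) :=
  List.rec (fun _ => []) (fun a _ ih acc => bump (a + 1) acc :: ih (bump (a + 1) acc)) w

/-- The rank matrix of the word `w`: its row `i` and column `t`, counted from `0`, hold the number of
letters at least `t` among the first `i + 1` letters. -/
def rankTable (n : ℕ) (w : List ℕ) : List (List ℕ) := rankRows w (List.replicate n 0)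

/-- The entrywise maximum of two lists. -/
def zipMax (l : List ℕ) : List ℕ → List ℕ :=
  List.rec (fun _ => []) (fun a _ ih m => List.rec [] (fun b m _ => bmax a b :: ih m) m) l

/-- The minimum of two numbers. -/
def bmin (a b : ℕ) : ℕ := Bool.rec b a (Nat.ble a b)

/-- The row for the first `i` positions of the least rank matrix of the permutations whose `k` largest
labels are in the first `k` positions. -/
def rectRow (n k i : ℕ) : List ℕ := (List.range n).map fun t => bmin i k + bmin (n - t) k - k

/-- The entrywise maximum of a rank matrix, whose first row is numbered by `i + 1`, and the matrix
with the rows `rectRow`. -/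
def joinTable (n k : ℕ) (R : List (List ℕ)) : ℕ → List (List ℕ) :=
  List.rec (fun _ => []) (fun r _ ih i => zipMax r (rectRow n k (i + 1)) :: ih (i + 1)) R

/-- The word with rank matrix `M`, where `s` is the sum of the preceding row of the matrix: each letter
`a` increases the row sum by `a + 1`. -/
def lettersOf (M : List (List ℕ)) : ℕ → List ℕ :=
  List.rec (fun _ => []) (fun r _ ih s => (r.sum - s - 1) :: ih r.sum) M

/-- Equality of tables of numbers. -/
def eqTable (l : List (List ℕ)) : List (List ℕ) → Bool :=
  List.rec (fun m => List.rec true (fun _ _ _ => false) m)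
    (fun a _ ih m => List.rec false (fun b m _ => Bool.rec false (ih m) (eqList a b)) m) l

/-- Whether `w` is a rearrangement of `0, …, n - 1`. -/
def isWord (n : ℕ) (w : List ℕ) : Bool :=
  Nat.beq w.length n && (List.range n).all fun a => w.any (Nat.beq a)

/-- Whether `c w` consists of the empty shape, if `w` is the identity, and of nonempty shapes only,
otherwise. -/
def checkInit (n : ℕ) (c : List ℕ → ShapeSum) (w : List ℕ) : Bool :=
  Bool.rec ((c w).all fun p => Nat.blt 0 (part p.1 0))
    (let l := (List.replicate (n - 1) 0, -1) :: c w; zeroSum l.length l) (eqList w (List.range n))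

/-- Whether the sum of `c (w s_i) - c w` over the descents `i` of `w` equals the sum of
`[s without b] - [s]` over the corners `b` of the shapes `s` in `c w`, with the coefficients of
`c w`. -/
def checkGen (n : ℕ) (c : List ℕ → ShapeSum) (w : List ℕ) : Bool :=
  let l := ((List.range (n - 1)).flatMap fun i =>
      Bool.rec (c (swapAt i w) ++ negSum (c w)) [] (ascentAt i w)) ++
    (c w).flatMap fun p => (List.range (n - 1)).flatMap fun i =>
      Bool.rec [] [(removeBox n p.1 i, -p.2), p] (isCorner p.1 i)
  zeroSum l.length l

/-- Whether the formal sum of the join of `w` with the least permutation whose `k` largest labels are in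
the first `k` positions arises from that of `w` by taking the union of each shape with a rectangle. -/
def checkProj (n : ℕ) (c : List ℕ → ShapeSum) (w : List ℕ) (k : ℕ) : Bool :=
  let M := joinTable n k (rankTable n w) 0
  let j := lettersOf M 0
  let l := c j ++ (c w).map fun p => (addRect n k p.1, -p.2)
  isWord n j && eqTable (rankTable n j) M && zeroSum l.length l

/-- The conditions on the formal sum of the word `w`. -/
def checkWord (n : ℕ) (c : List ℕ → ShapeSum) (w : List ℕ) : Bool :=
  ((c w).all fun p => validShape n p.1) && checkInit n c w && checkGen n c w &&
    (List.range (n - 1)).all fun k => checkProj n c w (k + 1)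

/-- The signed sums of the shapes of the increasing tableaux, for each permutation. -/
def tableauTrie (n : ℕ) : Trie n := Trie.build n n ((tableaux n).map (tableauTerm n))

/-- The conditions for all the permutations of `0, …, n - 1`. -/
def checkAll (n : ℕ) : Bool :=
  (List.range n).permutations'.all (checkWord n (Trie.lookup n (tableauTrie n)))

/-! ### Reading off the finite check -/

section SwapAt

theorem swapAt_zero (a b : ℕ) (l : List ℕ) : swapAt 0 (a :: b :: l) = b :: a :: l := rfl
theorem swapAt_succ (i a : ℕ) (l : List ℕ) : swapAt (i + 1) (a :: l) = a :: swapAt i l := rfl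
theorem ascentAt_zero (a b : ℕ) (l : List ℕ) : ascentAt 0 (a :: b :: l) = Nat.blt a b := rfl
theorem ascentAt_succ (i a : ℕ) (l : List ℕ) : ascentAt (i + 1) (a :: l) = ascentAt i l := rfl

theorem entryAt_eq {α : Type} (d : α) (l : List α) (i : ℕ) : entryAt d l i = l.getD i d := by
  induction l generalizing i with
  | nil => rfl
  | cons a l ih => cases i with
    | zero => rfl
    | succ i => exact (ih i).trans (by simp)

theorem ascentAt_eq (i : ℕ) (w : List ℕ) (h : i + 1 < w.length) :
    ascentAt i w = decide (w.getD i 0 < w.getD (i + 1) 0) := by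
  induction i generalizing w with
  | zero =>
    match w, h with
    | a :: b :: l, _ => rw [ascentAt_zero, Bool.eq_iff_iff]; simp
  | succ i ih =>
    match w, h with
    | a :: l, h => simpa [ascentAt_succ] using ih l (by simpa using h)

theorem length_swapAt (i : ℕ) (w : List ℕ) : (swapAt i w).length = w.length := by
  induction i generalizing w with
  | zero =>
    match w with
    | [] => rfl
    | [a] => rfl
    | a :: b :: l => rfl
  | succ i ih =>
    match w with
    | [] => rfl
    | a :: l => simp [swapAt_succ, ih l]

theorem getD_swapAt (i : ℕ) (w : List ℕ) (h : i + 1 < w.length) (p : ℕ) :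
    (swapAt i w).getD p 0 =
      if p = i then w.getD (i + 1) 0 else if p = i + 1 then w.getD i 0 else w.getD p 0 := by
  induction i generalizing w p with
  | zero =>
    match w, h with
    | a :: b :: l, _ =>
      match p with
      | 0 => simp [swapAt_zero]
      | 1 => simp [swapAt_zero]
      | p + 2 => simp [swapAt_zero]
  | succ i ih =>
    match w, h with
    | a :: l, h =>
      match p with
      | 0 => simp [swapAt_succ]
      | p + 1 => simpa [swapAt_succ] using ih l (by simpa using h) p

end SwapAt

theorem eqList_iff (l m : List ℕ) : eqList l m = true ↔ l = m := by
  induction l generalizing m with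
  | nil => cases m <;> simp [eqList]
  | cons a l ih =>
    cases m with
    | nil => simp [eqList]
    | cons b m =>
      have : eqList (a :: l) (b :: m) = Bool.rec false (eqList l m) (Nat.beq a b) := rfl
      rw [this]
      cases h : Nat.beq a b
      · have : a ≠ b := fun e => by simp [e] at h
        simp [this]
      · have := Nat.eq_of_beq_eq_true h
        simp [this, ih]

theorem eqTable_iff (l m : List (List ℕ)) : eqTable l m = true ↔ l = m := by
  induction l generalizing m with
  | nil => cases m <;> simp [eqTable]
  | cons a l ih =>
    cases m with
    | nil => simp [eqTable]
    | cons b m =>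
      have : eqTable (a :: l) (b :: m) = Bool.rec false (eqTable l m) (eqList a b) := rfl
      rw [this]
      cases h : eqList a b
      · have : a ≠ b := fun e => by simp [(eqList_iff a b).2 e] at h
        simp [this]
      · have := (eqList_iff a b).1 h
        simp [this, ih]

/-- The value at a formal sum of shapes of the linear extension of `f`. -/
def evalSum (f : List ℕ → ℤ) (l : ShapeSum) : ℤ := (l.map fun p => p.2 * f p.1).sum

theorem evalSum_append (f : List ℕ → ℤ) (l m : ShapeSum) :
    evalSum f (l ++ m) = evalSum f l + evalSum f m := by simp [evalSum]

theorem evalSum_cons (f : List ℕ → ℤ) (p : List ℕ × ℤ) (l : ShapeSum) :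
    evalSum f (p :: l) = p.2 * f p.1 + evalSum f l := by simp [evalSum]

theorem evalSum_negSum (f : List ℕ → ℤ) (l : ShapeSum) : evalSum f (negSum l) = -evalSum f l := by
  induction l with
  | nil => rfl
  | cons p l ih =>
    have : negSum (p :: l) = (p.1, -p.2) :: negSum l := rfl
    rw [this, evalSum_cons, evalSum_cons, ih]; ring

theorem evalSum_flatMap {α : Type} (f : List ℕ → ℤ) (l : List α) (g : α → ShapeSum) :
    evalSum f (l.flatMap g) = (l.map fun a => evalSum f (g a)).sum := by
  induction l with
  | nil => rfl
  | cons a l ih => simp [List.flatMap_cons, evalSum_append, ih]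

theorem evalSum_eq_of_coeffOf (f : List ℕ → ℤ) (s : List ℕ) (l : ShapeSum) :
    evalSum f l = coeffOf s l * f s + evalSum f (removeShape s l) := by
  induction l with
  | nil => simp [evalSum, coeffOf, removeShape]
  | cons q l ih =>
    have h1 : coeffOf s (q :: l) = Bool.rec (coeffOf s l) (q.2 + coeffOf s l) (eqList s q.1) := rfl
    have h2 : removeShape s (q :: l) =
      Bool.rec (q :: removeShape s l) (removeShape s l) (eqList s q.1) := rfl
    rw [h1, h2, evalSum_cons, ih]
    cases h : eqList s q.1
    · simp only [evalSum_cons]; ring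
    · have := (eqList_iff _ _).1 h
      simp only [← this]; ring

theorem evalSum_eq_zero_of_zeroSum (f : List ℕ → ℤ) (m : ℕ) (l : ShapeSum)
    (h : zeroSum m l = true) : evalSum f l = 0 := by
  induction m generalizing l with
  | zero => cases l with
    | nil => rfl
    | cons p l => simp [zeroSum] at h
  | succ m ih => cases l with
    | nil => rfl
    | cons p l =>
      simp only [zeroSum, Bool.and_eq_true] at h
      have h0 : p.2 + coeffOf p.1 l = 0 := by
        revert h
        generalize p.2 + coeffOf p.1 l = z
        intro h
        cases z with
        | ofNat k => have := Nat.eq_of_beq_eq_true h.1; simp [this]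
        | negSucc k => simp [isZero] at h
      rw [evalSum_cons, evalSum_eq_of_coeffOf f p.1 l, ih _ h.2, add_zero, ← add_mul, h0, zero_mul]

/-! ### Words of permutations and their rank matrices -/

section Word

variable {n : ℕ}

/-- The label in position `p`, with value `0` when `p` is out of range. -/
def labelAt (η : Equiv.Perm (Fin n)) (p : ℕ) : ℕ := if h : p < n then (η ⟨p, h⟩ : ℕ) else 0

/-- One-line notation. -/
def word (η : Equiv.Perm (Fin n)) : List ℕ := List.ofFn fun p => (η p : ℕ)

theorem length_word (η : Equiv.Perm (Fin n)) : (word η).length = n := by simp [word]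

theorem getD_word (η : Equiv.Perm (Fin n)) (p : ℕ) : (word η).getD p 0 = labelAt η p := by
  by_cases h : p < n <;> simp [word, labelAt, List.getD, h]

theorem word_injective : Function.Injective (word (n := n)) := by
  intro η ξ h
  ext p
  have : (word η).getD p 0 = (word ξ).getD p 0 := by rw [h]
  rw [getD_word, getD_word] at this
  simpa [labelAt] using this

theorem exists_word_eq {w : List ℕ} (h : w.Perm (List.range n)) :
    ∃ η : Equiv.Perm (Fin n), word η = w := by
  have hl : w.length = n := by simpa using h.length_eq
  have hnd : w.Nodup := h.nodup_iff.2 List.nodup_range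
  have hlt : ∀ p (hp : p < n), w[p] < n := fun p hp => by
    have : w[p] ∈ List.range n := h.mem_iff.1 (List.getElem_mem _)
    simpa using this
  let f : Fin n → Fin n := fun p => ⟨w[(p : ℕ)], hlt p p.2⟩
  have hf : Function.Injective f := by
    intro p q hpq
    have : w[(p : ℕ)] = w[(q : ℕ)] := by simpa [f] using hpq
    exact Fin.ext ((List.Nodup.getElem_inj_iff hnd).1 this)
  refine ⟨Equiv.ofBijective f (Finite.injective_iff_bijective.1 hf), ?_⟩
  apply List.ext_getElem
  · simp [word, hl]
  · intro i h1 h2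
    simp [word, f]

theorem word_perm (η : Equiv.Perm (Fin n)) : (word η).Perm (List.range n) := by
  have hnd : (word η).Nodup := by
    rw [word, List.nodup_ofFn]
    exact fun p q h => η.injective (Fin.ext h)
  refine (List.subperm_of_subset hnd ?_).perm_of_length_le (by simp [word])
  intro a ha
  simp only [word, List.mem_ofFn] at ha
  obtain ⟨p, rfl⟩ := ha
  simp

theorem perm_of_isWord {w : List ℕ} (h : isWord n w = true) : w.Perm (List.range n) := by
  simp only [isWord, Bool.and_eq_true, List.all_eq_true, List.any_eq_true] at h
  have hl := Nat.eq_of_beq_eq_true h.1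
  refine ((List.subperm_of_subset List.nodup_range ?_).perm_of_length_le (by simp [hl])).symm
  intro a ha
  obtain ⟨b, hb, hab⟩ := h.2 a ha
  rwa [Nat.eq_of_beq_eq_true hab]

theorem labelAt_lt (η : Equiv.Perm (Fin n)) {p : ℕ} (hp : p < n) : labelAt η p < n := by
  simp [labelAt, hp]

theorem labelAt_inj (η : Equiv.Perm (Fin n)) {p q : ℕ} (hp : p < n) (hq : q < n)
    (h : labelAt η p = labelAt η q) : p = q := by
  simp only [labelAt, hp, hq, dite_true] at h
  simpa using η.injective (Fin.ext h)

theorem labelAt_mul_swap (η : Equiv.Perm (Fin n)) (i : Fin (n - 1)) (p : ℕ) :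
    labelAt (η * Equiv.swap (leftPos i) (rightPos i)) p =
      if p = i then labelAt η (i + 1) else if p = i + 1 then labelAt η i else labelAt η p := by
  have hi := i.2
  by_cases h : p < n
  · by_cases h1 : p = i
    · subst h1
      have e : (⟨(i : ℕ), h⟩ : Fin n) = leftPos i := rfl
      have h2 : (i : ℕ) + 1 < n := by omega
      simp only [labelAt, h, h2, dite_true, if_true, Equiv.Perm.mul_apply, e, Equiv.swap_apply_left]
      rfl
    · by_cases h2 : p = i + 1
      · subst h2
        have e : (⟨(i : ℕ) + 1, h⟩ : Fin n) = rightPos i := rfl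
        have h3 : (i : ℕ) < n := by omega
        simp only [labelAt, h, h3, dite_true, if_true, Equiv.Perm.mul_apply, e,
          Equiv.swap_apply_right]
        simp only [h1, if_false]
        rfl
      · simp only [labelAt, h, dite_true, h1, h2, if_false, Equiv.Perm.mul_apply]
        rw [Equiv.swap_apply_of_ne_of_ne]
        · exact fun e => h1 (congrArg Fin.val e)
        · exact fun e => h2 (congrArg Fin.val e)
  · have h1 : p ≠ i := by omega
    have h2 : p ≠ i + 1 := by omega
    simp [labelAt, h, h1, h2]

theorem word_mul_swap (η : Equiv.Perm (Fin n)) (i : Fin (n - 1)) :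
    word (η * Equiv.swap (leftPos i) (rightPos i)) = swapAt i (word η) := by
  have hi := i.2
  apply List.ext_getElem
  · simp [word, length_swapAt]
  · intro p h1 h2
    have h := labelAt_mul_swap η i p
    rw [← getD_word, ← getD_word, ← getD_word, ← getD_word,
      ← getD_swapAt i (word η) (by rw [length_word]; omega) p] at h
    rwa [List.getD_eq_getElem _ _ h1, List.getD_eq_getElem _ _ h2] at h

theorem canSwap_iff (η : Equiv.Perm (Fin n)) (i : Fin (n - 1)) :
    CanSwap η i ↔ labelAt η i < labelAt η (i + 1) := by
  have hi := i.2
  have h1 : (i : ℕ) < n := by omega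
  have h2 : (i : ℕ) + 1 < n := by omega
  simp only [CanSwap, labelAt, h1, h2, dite_true]
  rfl

theorem ascentAt_word (η : Equiv.Perm (Fin n)) (i : Fin (n - 1)) :
    ascentAt i (word η) = true ↔ CanSwap η i := by
  have hi := i.2
  rw [ascentAt_eq _ _ (by rw [length_word]; omega), getD_word, getD_word, canSwap_iff,
    decide_eq_true_iff]

/-- The number of labels that are at least `t` among the first `i` letters of a sequence. -/
def rankFun (f : ℕ → ℕ) (i t : ℕ) : ℕ := ∑ p ∈ Finset.range i, if t ≤ f p then 1 else 0

theorem rankFun_succ (f : ℕ → ℕ) (i t : ℕ) :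
    rankFun f (i + 1) t = rankFun f i t + if t ≤ f i then 1 else 0 :=
  Finset.sum_range_succ _ _

theorem rankFun_mono (f : ℕ → ℕ) (t : ℕ) {i j : ℕ} (h : i ≤ j) : rankFun f i t ≤ rankFun f j t :=
  Finset.sum_le_sum_of_subset (Finset.range_mono h)

theorem rankFun_anti (f : ℕ → ℕ) (i : ℕ) {s t : ℕ} (h : s ≤ t) : rankFun f i t ≤ rankFun f i s := by
  refine Finset.sum_le_sum fun p _ => ?_
  split_ifs <;> omega

theorem rankFun_le_add (η : Equiv.Perm (Fin n)) {i s t : ℕ} (hi : i ≤ n) :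
    rankFun (labelAt η) i s ≤ rankFun (labelAt η) i t + (t - s) := by
  have h1 : rankFun (labelAt η) i s ≤ rankFun (labelAt η) i t +
      ((Finset.range i).filter fun p => s ≤ labelAt η p ∧ labelAt η p < t).card := by
    rw [Finset.card_filter, rankFun, rankFun, ← Finset.sum_add_distrib]
    refine Finset.sum_le_sum fun p _ => ?_
    split_ifs <;> omega
  have h2 : ((Finset.range i).filter fun p => s ≤ labelAt η p ∧ labelAt η p < t).card ≤ t - s := by
    rw [← Nat.card_Ico]
    refine Finset.card_le_card_of_injOn (labelAt η) ?_ ?_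
    · intro p hp
      simp only [Finset.coe_filter, Set.mem_ofPred_eq] at hp
      simp [hp.2.1, hp.2.2]
    · intro p hp q hq
      simp only [Finset.coe_filter, Set.mem_ofPred_eq, Finset.mem_range] at hp hq
      exact labelAt_inj η (by omega) (by omega)
  omega

/-- The Bruhat order on permutations, by comparison of rank matrices. -/
def BruhatLE (v η : Equiv.Perm (Fin n)) : Prop :=
  ∀ i ≤ n, ∀ t < n, rankFun (labelAt v) i t ≤ rankFun (labelAt η) i t

theorem BruhatLE.antisymm {v η : Equiv.Perm (Fin n)} (h : BruhatLE v η) (h' : BruhatLE η v) :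
    v = η := by
  apply word_injective
  have key : ∀ p < n, ∀ t < n, (t ≤ labelAt v p ↔ t ≤ labelAt η p) := by
    intro p hp t ht
    have h1 := le_antisymm (h p hp.le t ht) (h' p hp.le t ht)
    have h2 := le_antisymm (h (p + 1) hp t ht) (h' (p + 1) hp t ht)
    rw [rankFun_succ, rankFun_succ, h1] at h2
    split_ifs at h2 <;> omega
  apply List.ext_getElem
  · simp [word]
  · intro p h1 h2
    rw [length_word] at h1
    have e1 := getD_word v p
    have e2 := getD_word η p
    rw [List.getD_eq_getElem _ _ (by rwa [length_word])] at e1 e2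
    rw [e1, e2]
    exact le_antisymm ((key p h1 _ (labelAt_lt v h1)).1 le_rfl)
      ((key p h1 _ (labelAt_lt η h1)).2 le_rfl)

theorem BruhatLE.refl (v : Equiv.Perm (Fin n)) : BruhatLE v v := fun _ _ _ _ => le_rfl

theorem BruhatLE.trans {v w η : Equiv.Perm (Fin n)} (h : BruhatLE v w) (h' : BruhatLE w η) :
    BruhatLE v η := fun i hi t ht => (h i hi t ht).trans (h' i hi t ht)

theorem one_bruhatLE (v : Equiv.Perm (Fin n)) : BruhatLE 1 v := by
  intro i hi t ht
  have h1 : rankFun (labelAt (1 : Equiv.Perm (Fin n))) i t ≤ i - t := by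
    have : ∀ p ∈ Finset.range i, (if t ≤ labelAt (1 : Equiv.Perm (Fin n)) p then 1 else 0) =
        if t ≤ p then 1 else 0 := by
      intro p hp
      have : p < n := by have := Finset.mem_range.1 hp; omega
      simp [labelAt, this]
    rw [rankFun, Finset.sum_congr rfl this, ← Finset.card_filter, ← Nat.card_Ico]
    refine Finset.card_le_card fun p hp => ?_
    simp only [Finset.mem_filter, Finset.mem_range] at hp
    simp [hp.1, hp.2]
  have h2 := rankFun_le_add v (s := 0) (t := t) hi
  have h3 : rankFun (labelAt v) i 0 = i := by simp [rankFun]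
  omega

/-- The smaller of `v` and its image under the exchange of positions `i` and `i + 1`. -/
noncomputable def lower (v : Equiv.Perm (Fin n)) (i : Fin (n - 1)) : Equiv.Perm (Fin n) :=
  open Classical in if CanSwap v i then v else v * Equiv.swap (leftPos i) (rightPos i)

theorem rankFun_mul_swap_of_ne (η : Equiv.Perm (Fin n)) (i : Fin (n - 1)) {p : ℕ} (t : ℕ)
    (hp : p ≠ i + 1) :
    rankFun (labelAt (η * Equiv.swap (leftPos i) (rightPos i))) p t =
      rankFun (labelAt η) p t := by
  have aux : ∀ q, q ≤ (i : ℕ) →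
      rankFun (labelAt (η * Equiv.swap (leftPos i) (rightPos i))) q t =
        rankFun (labelAt η) q t := by
    intro q hq
    refine Finset.sum_congr rfl fun r hr => ?_
    have := Finset.mem_range.1 hr
    rw [labelAt_mul_swap, if_neg (show ¬ r = (i : ℕ) by omega),
      if_neg (show ¬ r = (i : ℕ) + 1 by omega)]
  have aux2 : ∀ d, rankFun (labelAt (η * Equiv.swap (leftPos i) (rightPos i))) (i + 2 + d) t =
        rankFun (labelAt η) (i + 2 + d) t := by
    intro d
    induction d with
    | zero =>
      simp only [add_zero]
      rw [rankFun_succ, rankFun_succ, rankFun_succ, rankFun_succ, aux i le_rfl,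
        labelAt_mul_swap, labelAt_mul_swap]
      simp
      omega
    | succ d ih =>
      rw [← add_assoc, rankFun_succ, ih, rankFun_succ, labelAt_mul_swap,
        if_neg (show ¬ (i : ℕ) + 2 + d = i by omega),
        if_neg (show ¬ (i : ℕ) + 2 + d = i + 1 by omega)]
  rcases Nat.lt_or_gt_of_ne hp with h | h
  · exact aux p (by omega)
  · obtain ⟨d, rfl⟩ := Nat.exists_eq_add_of_le (show (i : ℕ) + 2 ≤ p by omega)
    exact aux2 d

theorem rankFun_mul_swap_self (η : Equiv.Perm (Fin n)) (i : Fin (n - 1)) (t : ℕ) :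
    rankFun (labelAt (η * Equiv.swap (leftPos i) (rightPos i))) (i + 1) t =
      rankFun (labelAt η) i t + if t ≤ labelAt η (i + 1) then 1 else 0 := by
  rw [rankFun_succ, rankFun_mul_swap_of_ne _ _ _ (by omega), labelAt_mul_swap, if_pos rfl]

/-- The lifting property of the Bruhat order: an attempted exchange leads above `v` exactly from
the configurations above the smaller of `v` and its image under the exchange. -/
theorem bruhatLE_attempt (v η : Equiv.Perm (Fin n)) (i : Fin (n - 1)) :
    BruhatLE v (attempt η i) ↔ BruhatLE (lower v i) η := by
  have hi := i.2
  have hv0 := fun t => rankFun_succ (labelAt v) i t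
  have hv1 := fun t => rankFun_succ (labelAt v) (i + 1) t
  have he0 := fun t => rankFun_succ (labelAt η) i t
  have he1 := fun t => rankFun_succ (labelAt η) (i + 1) t
  have hvs := rankFun_mul_swap_self v i
  have hes := rankFun_mul_swap_self η i
  have split : ∀ {P : ℕ → Prop}, (∀ p ≤ n, P p) ↔ ((∀ p ≤ n, p ≠ i + 1 → P p) ∧ P (i + 1)) := by
    intro P
    refine ⟨fun h => ⟨fun p hp _ => h p hp, h _ (by omega)⟩, fun h p hp => ?_⟩
    by_cases e : p = i + 1
    · exact e ▸ h.2
    · exact h.1 p hp e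
  have key : ∀ v' η' : Equiv.Perm (Fin n),
      (∀ p : ℕ, p ≠ i + 1 → ∀ t, rankFun (labelAt v) p t = rankFun (labelAt v') p t) →
      (∀ p : ℕ, p ≠ i + 1 → ∀ t, rankFun (labelAt η) p t = rankFun (labelAt η') p t) →
      ((∀ t, rankFun (labelAt v) i t ≤ rankFun (labelAt η) i t →
        rankFun (labelAt v) (i + 1 + 1) t ≤ rankFun (labelAt η) (i + 1 + 1) t →
        (rankFun (labelAt v) (i + 1) t ≤ rankFun (labelAt η') (i + 1) t ↔
          rankFun (labelAt v') (i + 1) t ≤ rankFun (labelAt η) (i + 1) t))) →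
      (BruhatLE v η' ↔ BruhatLE v' η) := by
    intro v' η' h1 h2 h3
    simp only [BruhatLE]
    rw [split, split (P := fun p => ∀ t < n, rankFun (labelAt v') p t ≤ _)]
    have e : (∀ p ≤ n, p ≠ (i : ℕ) + 1 →
        ∀ t < n, rankFun (labelAt v) p t ≤ rankFun (labelAt η') p t) ↔
        ∀ p ≤ n, p ≠ (i : ℕ) + 1 → ∀ t < n, rankFun (labelAt v') p t ≤ rankFun (labelAt η) p t := by
      refine forall₃_congr fun p _ hp => ?_
      simp only [h1 p hp, h2 p hp]
    rw [e]
    refine and_congr_right fun H => forall₂_congr fun t ht => h3 t ?_ ?_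
    · rw [h1 _ (by omega)]
      exact H i (by omega) (by omega) t ht
    · rw [h1 _ (by omega)]
      exact H (i + 1 + 1) (by omega) (by omega) t ht
  by_cases cv : CanSwap v i <;> by_cases ce : CanSwap η i <;>
    simp only [attempt, lower, cv, ce, if_true, if_false] <;> rw [canSwap_iff] at cv ce
  · refine key v _ (fun _ _ _ => rfl) (fun p hp t => (rankFun_mul_swap_of_ne η i t hp).symm) ?_
    intro t
    rw [hes, he1, hv1, he0, hv0]
    split_ifs <;> omega
  · refine key _ _ (fun p hp t => (rankFun_mul_swap_of_ne v i t hp).symm)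
      (fun p hp t => (rankFun_mul_swap_of_ne η i t hp).symm) ?_
    intro t
    rw [hes, he1, hv1, he0, hv0, hvs]
    split_ifs <;> omega
  · refine key _ _ (fun p hp t => (rankFun_mul_swap_of_ne v i t hp).symm) (fun _ _ _ => rfl) ?_
    intro t
    rw [he1, hv1, he0, hv0, hvs]
    split_ifs <;> omega

end Word

/-! ### Settled configurations -/

section Settled

variable {n : ℕ}

/-- The first `k` positions are occupied by the `k` largest labels, so that no swap will occur any
more between positions `k - 1` and `k`. -/
def Settled (k : ℕ) (η : Equiv.Perm (Fin n)) : Prop := ∀ p < k, n - k ≤ labelAt η p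

theorem settled_iff (k : ℕ) (η : Equiv.Perm (Fin n)) :
    Settled k η ↔ k ≤ rankFun (labelAt η) k (n - k) := by
  constructor
  · intro h
    refine le_of_eq ?_
    rw [rankFun, Finset.sum_congr rfl fun p hp => if_pos (h p (Finset.mem_range.1 hp))]
    simp
  · intro h p hp
    by_contra hlt
    have : rankFun (labelAt η) k (n - k) < ∑ _p ∈ Finset.range k, 1 :=
      Finset.sum_lt_sum (fun p _ => by split_ifs <;> omega)
        ⟨p, Finset.mem_range.2 hp, by rw [if_neg hlt]; exact one_pos⟩
    simp at this
    omega

theorem le_rankFun_of_settled {k : ℕ} {η : Equiv.Perm (Fin n)} (hk : k ≤ n) (h : Settled k η)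
    (i t : ℕ) : min i k + min (n - t) k - k ≤ rankFun (labelAt η) i t := by
  rw [settled_iff] at h
  have h1 : rankFun (labelAt η) k (n - k) ≤ rankFun (labelAt η) (min i k) (n - k) + (k - min i k) := by
    have : ∀ d, rankFun (labelAt η) (min i k + d) (n - k) ≤
        rankFun (labelAt η) (min i k) (n - k) + d := by
      intro d
      induction d with
      | zero => simp
      | succ d ih =>
        rw [← add_assoc, rankFun_succ]
        split_ifs <;> omega
    have h2 := this (k - min i k)
    rwa [Nat.add_sub_cancel' (min_le_right i k)] at h2
  have h2 := rankFun_le_add η (i := min i k) (s := n - k) (t := max t (n - k)) (by omega)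
  have h3 := rankFun_anti (labelAt η) (min i k) (le_max_left t (n - k))
  have h4 := rankFun_mono (labelAt η) t (min_le_left i k)
  omega

/-- If the rank matrix of `j` is the join of that of `v` and of the least rank matrix of a
configuration that is settled at `k`, then `j` is the join of `v` and this configuration. -/
theorem bruhatLE_join {k : ℕ} {v j : Equiv.Perm (Fin n)} (hk0 : 0 < k) (hk : k ≤ n)
    (hj : ∀ i ≤ n, ∀ t < n, rankFun (labelAt j) i t =
      max (rankFun (labelAt v) i t) (min i k + min (n - t) k - k)) (η : Equiv.Perm (Fin n)) :
    BruhatLE j η ↔ BruhatLE v η ∧ Settled k η := by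
  constructor
  · intro h
    refine ⟨fun i hi t ht => ?_, ?_⟩
    · have := h i hi t ht
      rw [hj i hi t ht] at this
      omega
    · rw [settled_iff]
      have := h k hk (n - k) (by omega)
      rw [hj k hk (n - k) (by omega)] at this
      omega
  · rintro ⟨h1, h2⟩ i hi t ht
    rw [hj i hi t ht]
    exact max_le (h1 i hi t ht) (le_rankFun_of_settled hk h2 i t)

end Settled

/-! ### Rank tables -/

section Tables

theorem length_bump (m : ℕ) (l : List ℕ) : (bump m l).length = l.length := by
  induction m generalizing l with
  | zero => rfl
  | succ m ih => cases l with
    | nil => rfl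
    | cons x l => exact congrArg Nat.succ (ih l)

theorem getD_bump (m : ℕ) (l : List ℕ) (t : ℕ) (ht : t < l.length) :
    (bump m l).getD t 0 = l.getD t 0 + if t < m then 1 else 0 := by
  induction m generalizing l t with
  | zero => simp [bump]
  | succ m ih => cases l with
    | nil => simp at ht
    | cons x l =>
      have e : bump (m + 1) (x :: l) = (x + 1) :: bump m l := rfl
      rw [e]
      cases t with
      | zero => simp
      | succ t => simpa using ih l t (by simpa using ht)

theorem rankRows_cons (a : ℕ) (w acc : List ℕ) :
    rankRows (a :: w) acc = bump (a + 1) acc :: rankRows w (bump (a + 1) acc) := rfl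

theorem length_rankRows (w acc : List ℕ) : (rankRows w acc).length = w.length := by
  induction w generalizing acc with
  | nil => rfl
  | cons a w ih => simp [rankRows_cons, ih]

theorem length_getD_rankRows (w acc : List ℕ) (i : ℕ) (hi : i < w.length) :
    ((rankRows w acc).getD i []).length = acc.length := by
  induction w generalizing acc i with
  | nil => simp at hi
  | cons a w ih =>
    rw [rankRows_cons]
    cases i with
    | zero => simp [length_bump]
    | succ i =>
      rw [List.getD_cons_succ, ih _ i (by simpa using hi), length_bump]

theorem getD_rankRows (w acc : List ℕ) (i t : ℕ) (hi : i < w.length) (ht : t < acc.length) :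
    ((rankRows w acc).getD i []).getD t 0 =
      acc.getD t 0 + rankFun (fun p => w.getD p 0) (i + 1) t := by
  induction w generalizing acc i with
  | nil => simp at hi
  | cons a w ih =>
    rw [rankRows_cons, rankFun, Finset.sum_range_succ']
    have e : (if t < a + 1 then 1 else 0) = if t ≤ a then 1 else 0 := by
      simp only [Nat.lt_succ_iff]
    cases i with
    | zero =>
      rw [List.getD_cons_zero, getD_bump _ _ _ ht, e]
      simp
    | succ i =>
      rw [List.getD_cons_succ, ih _ i (by simpa using hi) (by rwa [length_bump]),
        getD_bump _ _ _ ht, e]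
      simp only [List.getD_cons_succ, List.getD_cons_zero, rankFun]
      ring

theorem bmax_eq (a b : ℕ) : bmax a b = max a b := by
  have : bmax a b = Bool.rec a b (Nat.ble a b) := rfl
  rw [this]
  cases h : Nat.ble a b
  · have : ¬ a ≤ b := fun h' => by simp [Nat.ble_eq_true_of_le h'] at h
    simp only
    omega
  · have := Nat.le_of_ble_eq_true h
    simp only
    omega

theorem bmin_eq (a b : ℕ) : bmin a b = min a b := by
  have : bmin a b = Bool.rec b a (Nat.ble a b) := rfl
  rw [this]
  cases h : Nat.ble a b
  · have : ¬ a ≤ b := fun h' => by simp [Nat.ble_eq_true_of_le h'] at h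
    simp only
    omega
  · have := Nat.le_of_ble_eq_true h
    simp only
    omega

theorem getD_zipMax (l m : List ℕ) (t : ℕ) (hl : t < l.length) (hm : t < m.length) :
    (zipMax l m).getD t 0 = max (l.getD t 0) (m.getD t 0) := by
  induction l generalizing m t with
  | nil => simp at hl
  | cons a l ih => cases m with
    | nil => simp at hm
    | cons b m =>
      have e : zipMax (a :: l) (b :: m) = bmax a b :: zipMax l m := rfl
      rw [e]
      cases t with
      | zero => simp [bmax_eq]
      | succ t =>
        rw [List.getD_cons_succ, ih m t (by simpa using hl) (by simpa using hm)]
        simp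

theorem getD_joinTable (n k : ℕ) (R : List (List ℕ)) (s i : ℕ) (hi : i < R.length) :
    (joinTable n k R s).getD i [] = zipMax (R.getD i []) (rectRow n k (s + i + 1)) := by
  induction R generalizing s i with
  | nil => simp at hi
  | cons r R ih =>
    have e : joinTable n k (r :: R) s = zipMax r (rectRow n k (s + 1)) :: joinTable n k R (s + 1) :=
      rfl
    rw [e]
    cases i with
    | zero => simp
    | succ i =>
      rw [List.getD_cons_succ, ih _ i (by simpa using hi), List.getD_cons_succ]
      congr 2
      ring

theorem getD_map_range (m : ℕ) (f : ℕ → ℕ) (t : ℕ) :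
    ((List.range m).map f).getD t 0 = if t < m then f t else 0 := by
  by_cases h : t < m <;> simp [List.getD, h]

theorem rankFun_eq_of_table {n k : ℕ} {w j : List ℕ} (hw : w.length = n) (hj : j.length = n)
    (h : rankTable n j = joinTable n k (rankTable n w) 0) {i t : ℕ} (hi : i ≤ n) (ht : t < n) :
    rankFun (fun p => j.getD p 0) i t =
      max (rankFun (fun p => w.getD p 0) i t) (min i k + min (n - t) k - k) := by
  cases i with
  | zero => simp [rankFun]
  | succ i =>
    have h' := congrArg (fun R => (List.getD R i []).getD t 0) h
    simp only [rankTable] at h'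
    rw [getD_joinTable _ _ _ _ _ (by rw [length_rankRows, hw]; omega),
      getD_zipMax _ _ _ (by rw [length_getD_rankRows _ _ _ (by omega)]; simpa using ht)
        (by simpa [rectRow] using ht),
      getD_rankRows _ _ _ _ (by omega) (by simpa using ht),
      getD_rankRows _ _ _ _ (by omega) (by simpa using ht), rectRow, getD_map_range, if_pos ht,
      bmin_eq, bmin_eq] at h'
    simpa [ht] using h'

end Tables

/-! ### Shapes -/

section Shapes

/-- The row lengths of a partition whose diagram lies in the staircase `n - 1, n - 2, …, 1`. -/
structure IsShape (n : ℕ) (r : ℕ → ℕ) : Prop where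
  antitone : Antitone r
  le : ∀ i, r i ≤ n - 1 - i

/-- The diagram of the list of row lengths `s` is contained in the diagram `r`. -/
def Fits (s : List ℕ) (r : ℕ → ℕ) : Prop := ∀ i, part s i ≤ r i

/-- A box can be added to row `i` of the diagram `r`, within the staircase. -/
def Addable (n : ℕ) (r : ℕ → ℕ) (i : ℕ) : Prop := r i < n - 1 - i ∧ ∀ j < i, r i < r j

/-- The diagram with one more box in row `i`. -/
def addBox (r : ℕ → ℕ) (i : ℕ) : ℕ → ℕ := Function.update r i (r i + 1)

theorem IsShape.addBox {n : ℕ} {r : ℕ → ℕ} (h : IsShape n r) {i : ℕ} (hi : Addable n r i) :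
    IsShape n (addBox r i) := by
  refine ⟨antitone_nat_of_succ_le fun j => ?_, fun j => ?_⟩
  · have h1 := h.antitone (show j ≤ j + 1 by omega)
    simp only [OrientedSwap.addBox, Function.update_apply]
    split_ifs with h2 h3 h3
    · omega
    · have := hi.2 j (by omega)
      rw [← h2] at this ⊢
      omega
    · rw [← h3]; omega
    · exact h1
  · have h1 := h.le j
    have h2 := hi.1
    simp only [OrientedSwap.addBox, Function.update_apply]
    split_ifs with h3
    · rw [h3]; omega
    · exact h1

theorem part_eq (s : List ℕ) (i : ℕ) : part s i = s.getD i 0 := entryAt_eq 0 s i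

theorem part_removeBox (n : ℕ) (s : List ℕ) (i j : ℕ) :
    part (removeBox n s i) j = if j < n - 1 then if j = i then part s j - 1 else part s j else 0 := by
  rw [part_eq, removeBox, getD_map_range]
  refine if_congr Iff.rfl ?_ rfl
  cases h : Nat.beq j i
  · rw [if_neg fun e => by simp [e] at h]
  · rw [if_pos (Nat.eq_of_beq_eq_true h)]

theorem part_addRect (n k : ℕ) (s : List ℕ) (j : ℕ) :
    part (addRect n k s) j =
      if j < n - 1 then if j < n - k then max (part s j) k else part s j else 0 := by
  rw [part_eq, addRect, getD_map_range]
  refine if_congr Iff.rfl ?_ rfl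
  cases h : Nat.blt j (n - k)
  · rw [if_neg (show ¬ j < n - k by rw [← Nat.blt_eq, h]; exact Bool.false_ne_true)]
  · rw [if_pos (show j < n - k by simpa using h), bmax_eq]

theorem isCorner_iff (s : List ℕ) (i : ℕ) : isCorner s i = true ↔ part s (i + 1) < part s i := by
  simp [isCorner]

structure ValidShape (n : ℕ) (s : List ℕ) : Prop where
  anti : ∀ i, part s (i + 1) ≤ part s i
  le : ∀ i, part s i ≤ n - 1 - i

theorem validShape_of (n : ℕ) (s : List ℕ) (h : validShape n s = true) :
    ValidShape n s := by
  simp only [validShape, List.all_eq_true, Bool.and_eq_true, List.mem_range] at h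
  obtain ⟨hl, h⟩ := h
  have hl := Nat.eq_of_beq_eq_true hl
  have h0 : ∀ i, n - 1 ≤ i → part s i = 0 := fun i hi => by
    rw [part_eq, List.getD_eq_default]; omega
  refine ⟨fun i => ?_, fun i => ?_⟩ <;> by_cases hi : i < n - 1
  · exact Nat.le_of_ble_eq_true (h i hi).1
  · rw [h0 (i + 1) (by omega)]; omega
  · have := Nat.le_of_ble_eq_true (h i hi).2
    omega
  · rw [h0 i (by omega)]; omega

open Classical in
/-- Adding a box to the outer diagram and removing a box from the inner one change the containment
of two diagrams in the same way. -/
theorem fits_addBox_sub {n : ℕ} {s : List ℕ} (hs : ValidShape n s) {r : ℕ → ℕ} (hr : IsShape n r)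
    {i : ℕ} (hi : i < n - 1) :
    (if Addable n r i then (if Fits s (addBox r i) then 1 else 0) - (if Fits s r then 1 else 0)
      else 0 : ℤ) =
    if isCorner s i = true then
      (if Fits (removeBox n s i) r then 1 else 0) - (if Fits s r then 1 else 0) else 0 := by
  have hanti : Antitone (part s) := antitone_nat_of_succ_le hs.anti
  have hz : ∀ j, ¬ j < n - 1 → part s j = 0 := fun j hj => by have := hs.le j; omega
  by_cases hfit : Fits s r
  · have h1 : Fits s (addBox r i) := fun j => by
      have := hfit j
      simp only [addBox, Function.update_apply]
      split_ifs with h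
      · rw [← h]; omega
      · exact this
    have h2 : Fits (removeBox n s i) r := fun j => by
      have := hfit j
      rw [part_removeBox]
      split_ifs <;> omega
    simp [hfit, h1, h2]
  · have hfit' : Fits s (addBox r i) ↔ (∀ j ≠ i, part s j ≤ r j) ∧ part s i ≤ r i + 1 := by
      constructor
      · intro h
        refine ⟨fun j hj => ?_, ?_⟩
        · have := h j; simpa [addBox, hj] using this
        · have := h i; simpa [addBox] using this
      · rintro ⟨h1, h2⟩ j
        by_cases h : j = i
        · subst h; simpa [addBox] using h2
        · simpa [addBox, h] using h1 j h
    have hfit2 : Fits (removeBox n s i) r ↔ (∀ j ≠ i, part s j ≤ r j) ∧ part s i ≤ r i + 1 := by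
      constructor
      · intro h
        refine ⟨fun j hj => ?_, ?_⟩
        · have := h j
          rw [part_removeBox, if_neg hj] at this
          split_ifs at this with h1
          · exact this
          · rw [hz j h1]; omega
        · have := h i
          rw [part_removeBox, if_pos hi, if_pos rfl] at this
          omega
      · rintro ⟨h1, h2⟩ j
        rw [part_removeBox]
        split_ifs with h3 h4
        · subst h4; omega
        · exact h1 j h4
        · omega
    by_cases hc : (∀ j ≠ i, part s j ≤ r j) ∧ part s i ≤ r i + 1
    · have heq : part s i = r i + 1 := by
        by_contra hne
        refine hfit fun j => ?_
        by_cases h : j = i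
        · subst h; omega
        · exact hc.1 j h
      have h1 : Addable n r i := by
        refine ⟨by have := hs.le i; omega, fun j hj => ?_⟩
        have := hc.1 j (by omega)
        have := hanti hj.le
        omega
      have h2 : isCorner s i = true := by
        rw [isCorner_iff]
        have := hc.1 (i + 1) (by omega)
        have := hr.antitone (show i ≤ i + 1 by omega)
        omega
      simp [h1, h2, hfit, hfit'.2 hc, hfit2.2 hc]
    · simp [hfit, hfit', hfit2, hc]

/-- Containment of the union of `s` with the rectangle with `n - k` rows and `k` columns. -/
theorem fits_addRect {n k : ℕ} {s : List ℕ} (hs : ValidShape n s) {r : ℕ → ℕ} (hr : IsShape n r)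
    (hk0 : 0 < k) (hk : k < n) :
    Fits (addRect n k s) r ↔ Fits s r ∧ k ≤ r (n - k - 1) := by
  constructor
  · intro h
    refine ⟨fun j => ?_, ?_⟩
    · have h1 := h j
      have h2 := hs.le j
      rw [part_addRect] at h1
      split_ifs at h1 <;> omega
    · have h1 := h (n - k - 1)
      rw [part_addRect, if_pos (by omega), if_pos (by omega)] at h1
      omega
  · rintro ⟨h1, h2⟩ j
    rw [part_addRect]
    have h3 := h1 j
    split_ifs with h4 h5
    · have := hr.antitone (show j ≤ n - k - 1 by omega)
      omega
    · exact h3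
    · omega

end Shapes

/-! ### The pairing of permutations and diagrams -/

section Pairing

variable {n : ℕ} {c : List ℕ → ShapeSum}

open Classical in
/-- The number of tableaux of the permutation `v`, counted with sign, whose shape is contained in
the diagram `r`. -/
noncomputable def pairing (c : List ℕ → ShapeSum) (v : Equiv.Perm (Fin n)) (r : ℕ → ℕ) : ℤ :=
  evalSum (fun s => if Fits s r then 1 else 0) (c (word v))

theorem word_one : word (1 : Equiv.Perm (Fin n)) = List.range n := by
  apply List.ext_getElem
  · simp [word]
  · intro i h1 h2
    simp [word]

theorem evalSum_congr {f g : List ℕ → ℤ} {l : ShapeSum} (h : ∀ p ∈ l, f p.1 = g p.1) :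
    evalSum f l = evalSum g l := by
  rw [evalSum, evalSum, List.map_congr_left fun p hp => by rw [h p hp]]

theorem sum_map_range (m : ℕ) (f : ℕ → ℤ) :
    ((List.range m).map f).sum = ∑ i ∈ Finset.range m, f i := by
  induction m with
  | zero => rfl
  | succ m ih => simp [List.range_succ, Finset.sum_range_succ, ih]

theorem evalSum_sub (f g : List ℕ → ℤ) (l : ShapeSum) :
    evalSum (fun s => f s - g s) l = evalSum f l - evalSum g l := by
  induction l with
  | nil => rfl
  | cons p l ih => simp only [evalSum_cons, ih]; ring

theorem evalSum_sum {ι : Type*} (S : Finset ι) (f : ι → List ℕ → ℤ) (l : ShapeSum) :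
    evalSum (fun s => ∑ i ∈ S, f i s) l = ∑ i ∈ S, evalSum (f i) l := by
  induction l with
  | nil => simp [evalSum]
  | cons p l ih => simp only [evalSum_cons, ih, Finset.mul_sum, Finset.sum_add_distrib]

theorem checkWord_iff {w : List ℕ} : checkWord n c w = true ↔
    (∀ p ∈ c w, validShape n p.1 = true) ∧ checkInit n c w = true ∧ checkGen n c w = true ∧
      ∀ k < n - 1, checkProj n c w (k + 1) = true := by
  simp only [checkWord, Bool.and_eq_true, List.all_eq_true, List.mem_range, and_assoc]

open Classical in
theorem pairing_zero (h : ∀ v : Equiv.Perm (Fin n), checkWord n c (word v) = true)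
    (v : Equiv.Perm (Fin n)) : pairing c v (fun _ => 0) = if v = 1 then 1 else 0 := by
  have h1 := (checkWord_iff.1 (h v)).2.1
  simp only [checkInit] at h1
  cases e : eqList (word v) (List.range n)
  · rw [e] at h1
    have hv : v ≠ 1 := fun hv => by
      rw [hv, word_one, (eqList_iff _ _).2 rfl] at e
      exact Bool.noConfusion e
    rw [if_neg hv, pairing, evalSum_congr (g := fun _ => 0)]
    · simp [evalSum]
    · intro p hp
      have h2 := List.all_eq_true.1 h1 p hp
      rw [if_neg]
      intro h3
      have h4 : part p.1 0 ≤ 0 := h3 0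
      simp only [Nat.blt_eq] at h2
      omega
  · rw [e] at h1
    have hv : v = 1 := word_injective (by rw [word_one]; exact (eqList_iff _ _).1 e)
    have h2 := evalSum_eq_zero_of_zeroSum
      (fun s => if Fits s (fun _ => 0) then 1 else 0) _ _ h1
    rw [evalSum_cons] at h2
    have h3 : Fits (List.replicate (n - 1) 0) (fun _ => 0) := fun i => by
      rw [part_eq, List.getD_eq_getElem?_getD, List.getElem?_replicate]
      split_ifs <;> simp
    simp only [h3, if_true] at h2
    rw [if_pos hv, pairing]
    linarith

theorem pairing_one (h : ∀ v : Equiv.Perm (Fin n), checkWord n c (word v) = true) (r : ℕ → ℕ) :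
    pairing c (1 : Equiv.Perm (Fin n)) r = 1 := by
  classical
  have h1 := (checkWord_iff.1 (h 1)).2.1
  simp only [checkInit, word_one, (eqList_iff _ _).2 rfl] at h1
  have h2 := evalSum_eq_zero_of_zeroSum (fun s => if Fits s r then 1 else 0) _ _ h1
  rw [evalSum_cons] at h2
  have h3 : Fits (List.replicate (n - 1) 0) r := fun i => by
    rw [part_eq, List.getD_eq_getElem?_getD, List.getElem?_replicate]
    split_ifs <;> simp
  simp only [h3, if_true] at h2
  rw [pairing, word_one]
  linarith

theorem evalSum_corners (f : List ℕ → ℤ) (l : ShapeSum) :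
    evalSum f (l.flatMap fun p => (List.range (n - 1)).flatMap fun i =>
      Bool.rec [] [(removeBox n p.1 i, -p.2), p] (isCorner p.1 i)) =
    -evalSum (fun s => ∑ i ∈ Finset.range (n - 1),
      if isCorner s i = true then f (removeBox n s i) - f s else 0) l := by
  induction l with
  | nil => rfl
  | cons p l ih =>
    rw [List.flatMap_cons, evalSum_append, ih, evalSum_cons, evalSum_flatMap, sum_map_range,
      neg_add, Finset.mul_sum, ← Finset.sum_neg_distrib]
    congr 1
    refine Finset.sum_congr rfl fun i _ => ?_
    cases isCorner p.1 i
    · simp [evalSum]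
    · simp [evalSum]; ring

open Classical in
/-- The pairing intertwines the two generators. -/
theorem pairing_generator (h : ∀ v : Equiv.Perm (Fin n), checkWord n c (word v) = true)
    (v : Equiv.Perm (Fin n)) {r : ℕ → ℕ} (hr : IsShape n r) :
    ∑ i : Fin (n - 1), (pairing c (lower v i) r - pairing c v r) =
      ∑ i : Fin (n - 1),
        if Addable n r i then pairing c v (addBox r i) - pairing c v r else 0 := by
  obtain ⟨hv, -, hg, -⟩ := checkWord_iff.1 (h v)
  set f : List ℕ → ℤ := fun s => if Fits s r then 1 else 0 with hf
  have h0 := evalSum_eq_zero_of_zeroSum f _ _ hg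
  rw [evalSum_append, evalSum_corners, evalSum_flatMap, sum_map_range, Finset.sum_range,
    add_neg_eq_zero] at h0
  have h1 : ∑ i : Fin (n - 1), (pairing c (lower v i) r - pairing c v r) =
      evalSum (fun s => ∑ i ∈ Finset.range (n - 1),
        if isCorner s i = true then f (removeBox n s i) - f s else 0) (c (word v)) := by
    rw [← h0]
    refine Finset.sum_congr rfl fun i _ => ?_
    by_cases hc : CanSwap v i
    · rw [(ascentAt_word v i).2 hc]
      simp [lower, hc, evalSum]
    · have : ascentAt i (word v) = false := by
        rw [← Bool.not_eq_true, ascentAt_word]; exact hc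
      rw [this]
      simp only [lower, hc, if_false]
      rw [evalSum_append, evalSum_negSum, ← word_mul_swap, pairing, pairing, sub_eq_add_neg]
  rw [h1, evalSum_sum, Finset.sum_range]
  refine Finset.sum_congr rfl fun i _ => ?_
  have h2 : evalSum (fun s => if isCorner s i = true then f (removeBox n s i) - f s else 0)
      (c (word v)) = evalSum (fun s => if Addable n r i then
        (if Fits s (addBox r i) then 1 else 0) - (if Fits s r then 1 else 0) else 0)
        (c (word v)) := by
    refine evalSum_congr fun p hp => ?_
    rw [fits_addBox_sub (validShape_of n p.1 (hv p hp)) hr i.2]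
  rw [h2]
  by_cases ha : Addable n r i
  · simp only [ha, if_true]
    rw [evalSum_sub]
    rfl
  · simp [ha, evalSum]

open Classical in
/-- The pairing intertwines the two restrictions to the configurations that are settled at `k`. -/
theorem pairing_settled (h : ∀ v : Equiv.Perm (Fin n), checkWord n c (word v) = true)
    (v : Equiv.Perm (Fin n)) (k : Fin (n - 1)) :
    ∃ j : Equiv.Perm (Fin n), (∀ η, BruhatLE j η ↔ BruhatLE v η ∧ Settled (k + 1) η) ∧
      ∀ r, IsShape n r → pairing c j r = if (k : ℕ) + 1 ≤ r (n - (k + 1) - 1)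
        then pairing c v r else 0 := by
  have hk := k.2
  obtain ⟨hv, -, -, hp⟩ := checkWord_iff.1 (h v)
  have h1 := hp k k.2
  simp only [checkProj, Bool.and_eq_true] at h1
  obtain ⟨⟨h1, h2⟩, h3⟩ := h1
  obtain ⟨j, hj⟩ := exists_word_eq (perm_of_isWord h1)
  rw [← hj] at h2 h3
  refine ⟨j, bruhatLE_join (by omega) (by omega) ?_, fun r hr => ?_⟩
  · intro i hi t ht
    have := rankFun_eq_of_table (length_word v) (length_word j) ((eqTable_iff _ _).1 h2) hi ht
    simpa only [getD_word] using this
  · set f : List ℕ → ℤ := fun s => if Fits s r then 1 else 0 with hf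
    have h4 := evalSum_eq_zero_of_zeroSum f _ _ h3
    have h5 : ∀ l : ShapeSum, evalSum f (l.map fun p => (addRect n (k + 1) p.1, -p.2)) =
        -evalSum (fun s => f (addRect n (k + 1) s)) l := by
      intro l
      induction l with
      | nil => rfl
      | cons p l ih => rw [List.map_cons, evalSum_cons, ih, evalSum_cons]; ring
    rw [evalSum_append, h5, add_neg_eq_zero] at h4
    have h6 : pairing c j r = evalSum f (c (word j)) := rfl
    rw [h6, h4]
    have h7 : evalSum (fun s => f (addRect n (k + 1) s)) (c (word v)) = evalSum (fun s =>
        if Fits s r ∧ (k : ℕ) + 1 ≤ r (n - (k + 1) - 1) then 1 else 0) (c (word v)) := by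
      refine evalSum_congr fun p hp => ?_
      simp only [hf, fits_addRect (validShape_of n p.1 (hv p hp)) hr
        (show 0 < (k : ℕ) + 1 by omega) (show (k : ℕ) + 1 < n by omega)]
    rw [h7]
    by_cases hkr : (k : ℕ) + 1 ≤ r (n - (k + 1) - 1)
    · simp only [hkr, and_true, if_true]
      rfl
    · simp [hkr, evalSum]

end Pairing

/-! ### The linear functionals -/

section Functional

variable {n : ℕ}

open Classical in
/-- The indicator function of the configurations above `v` in the Bruhat order. -/
noncomputable def above (v η : Equiv.Perm (Fin n)) : ℂ := if BruhatLE v η then 1 else 0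

open Classical in
/-- By triangularity, the indicator functions `above v` form a basis. -/
theorem exists_above_coords : ∃ e : (Equiv.Perm (Fin n) → ℂ) ≃ₗ[ℂ] (Equiv.Perm (Fin n) → ℂ),
    ∀ v, e (Pi.single v 1) = above v := by
  let T : (Equiv.Perm (Fin n) → ℂ) →ₗ[ℂ] (Equiv.Perm (Fin n) → ℂ) :=
    { toFun := fun g η => ∑ v, g v * above v η
      map_add' := fun g g' => by ext η; simp [add_mul, Finset.sum_add_distrib]
      map_smul' := fun a g => by ext η; simp [Finset.mul_sum, mul_assoc] }
  have hT : Function.Injective T := by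
    rw [← LinearMap.ker_eq_bot, LinearMap.ker_eq_bot']
    intro g hg
    by_contra hne
    obtain ⟨v0, hv0⟩ : ∃ v, g v ≠ 0 := by
      by_contra! hall
      exact hne (funext hall)
    -- evaluate at a minimal element of the support
    obtain ⟨v, hv, hmin⟩ := Finset.exists_min_image
      (Finset.univ.filter fun v => g v ≠ 0)
      (fun v => (Finset.univ.filter fun u => BruhatLE u v).card) ⟨v0, by simp [hv0]⟩
    simp only [Finset.mem_filter, Finset.mem_univ, true_and] at hv hmin
    have h1 : T g v = g v := by
      change ∑ u, g u * above u v = g v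
      rw [Finset.sum_eq_single v]
      · simp [above, BruhatLE.refl]
      · intro u _ huv
        by_cases hle : BruhatLE u v
        · by_cases hu : g u = 0
          · simp [hu]
          · exfalso
            have h2 := hmin u hu
            refine absurd h2 (not_le.2 (Finset.card_lt_card ?_))
            refine Finset.ssubset_iff_subset_ne.2 ⟨fun x hx => ?_, fun he => ?_⟩
            · simp only [Finset.mem_filter, Finset.mem_univ, true_and] at hx ⊢
              exact hx.trans hle
            · have : v ∈ Finset.univ.filter fun x => BruhatLE x u := by
                rw [he]; simp [BruhatLE.refl]
              simp only [Finset.mem_filter, Finset.mem_univ, true_and] at this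
              exact huv (hle.antisymm this)
        · simp [above, hle]
      · simp
    exact hv (by rw [← h1, hg]; rfl)
  refine ⟨LinearEquiv.ofInjectiveEndo T hT, fun v => ?_⟩
  ext η
  rw [LinearEquiv.coe_ofInjectiveEndo]
  change ∑ u, (Pi.single v (1 : ℂ) : _ → ℂ) u * above u η = above v η
  rw [Finset.sum_eq_single v]
  · simp
  · intro u _ hu; simp [Pi.single_eq_of_ne hu]
  · simp

theorem linearMap_ext_above {f g : (Equiv.Perm (Fin n) → ℂ) →ₗ[ℂ] ℂ}
    (h : ∀ v, f (above v) = g (above v)) : f = g := by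
  classical
  obtain ⟨e, he⟩ := exists_above_coords (n := n)
  have : f ∘ₗ e.toLinearMap = g ∘ₗ e.toLinearMap := by
    refine LinearMap.pi_ext' fun v => LinearMap.ext_ring ?_
    simpa [he] using h v
  refine LinearMap.ext fun x => ?_
  have := LinearMap.congr_fun this (e.symm x)
  simpa using this

/-- There is a linear functional with prescribed values at the indicator functions. -/
theorem exists_functional (m : Equiv.Perm (Fin n) → ℂ) :
    ∃ Λ : (Equiv.Perm (Fin n) → ℂ) →ₗ[ℂ] ℂ, ∀ v, Λ (above v) = m v := by
  classical
  obtain ⟨e, he⟩ := exists_above_coords (n := n)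
  refine ⟨(Fintype.linearCombination ℂ m) ∘ₗ e.symm.toLinearMap, fun v => ?_⟩
  rw [← he v]
  simp only [LinearMap.comp_apply, LinearEquiv.coe_coe, LinearEquiv.symm_apply_apply,
    Fintype.linearCombination_apply, smul_eq_mul]
  rw [Finset.sum_eq_single v]
  · simp
  · intro u _ hu; simp [Pi.single_eq_of_ne hu]
  · simp

open Classical in
/-- Multiplication by the indicator function of the configurations settled at `k`. -/
noncomputable def restrictSettled (k : ℕ) :
    (Equiv.Perm (Fin n) → ℂ) →ₗ[ℂ] (Equiv.Perm (Fin n) → ℂ) where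
  toFun g η := if Settled k η then g η else 0
  map_add' g g' := by ext η; by_cases h : Settled k η <;> simp [h]
  map_smul' a g := by ext η; by_cases h : Settled k η <;> simp [h]

/-- The generator of the oriented swap process. -/
noncomputable def swapGenerator : (Equiv.Perm (Fin n) → ℂ) →ₗ[ℂ] (Equiv.Perm (Fin n) → ℂ) where
  toFun g η := ∑ i, (g (attempt η i) - g η)
  map_add' g g' := by ext η; simp only [Pi.add_apply, ← Finset.sum_add_distrib]; congr 1; ext; ring
  map_smul' a g := by
    ext η; simp only [Pi.smul_apply, smul_eq_mul, RingHom.id_apply, Finset.mul_sum]; congr 1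
    ext; ring

theorem swapGenerator_above (v : Equiv.Perm (Fin n)) :
    swapGenerator (above v) = ∑ i, (above (lower v i) - above v) := by
  ext η
  simp only [swapGenerator, LinearMap.coe_mk, AddHom.coe_mk, Finset.sum_apply, Pi.sub_apply, above]
  refine Finset.sum_congr rfl fun i _ => ?_
  congr 1
  by_cases h : BruhatLE v (attempt η i)
  · rw [if_pos h, if_pos ((bruhatLE_attempt v η i).1 h)]
  · rw [if_neg h, if_neg fun h' => h ((bruhatLE_attempt v η i).2 h')]

variable {c : List ℕ → ShapeSum}

/-- The functional `Λ r` dual to the diagram `r`, with its intertwining properties. -/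
theorem exists_dual_functionals (h : ∀ v : Equiv.Perm (Fin n), checkWord n c (word v) = true) :
    ∃ Λ : (ℕ → ℕ) → (Equiv.Perm (Fin n) → ℂ) →ₗ[ℂ] ℂ,
      (∀ g, Λ (fun _ => 0) g = g 1) ∧ (∀ r, Λ r (fun _ => 1) = 1) ∧
      (∀ r, IsShape n r → ∀ g, Λ r (swapGenerator g) =
        open Classical in ∑ i : Fin (n - 1),
          if Addable n r i then Λ (addBox r i) g - Λ r g else 0) ∧
      ∀ r, IsShape n r → ∀ (k : Fin (n - 1)) (g), Λ r (restrictSettled (k + 1) g) =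
        if (k : ℕ) + 1 ≤ r (n - (k + 1) - 1) then Λ r g else 0 := by
  classical
  choose Λ hΛ using fun r : ℕ → ℕ =>
    exists_functional (n := n) (fun v => ((pairing c v r : ℤ) : ℂ))
  refine ⟨Λ, ?_, ?_, ?_, ?_⟩
  · have : Λ (fun _ => 0) = LinearMap.proj 1 := by
      refine linearMap_ext_above fun v => ?_
      rw [hΛ, pairing_zero h]
      simp only [LinearMap.proj_apply, above]
      by_cases hv : v = 1
      · simp [hv, BruhatLE.refl]
      · have : ¬ BruhatLE v 1 := fun h' => hv (h'.antisymm (one_bruhatLE v))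
        simp [hv, this]
    intro g
    rw [this]; rfl
  · intro r
    have : (fun _ => 1 : Equiv.Perm (Fin n) → ℂ) = above 1 := by
      ext η; simp [above, one_bruhatLE]
    rw [this, hΛ, pairing_one h]; simp
  · intro r hr
    have : Λ r ∘ₗ swapGenerator = ∑ i : Fin (n - 1),
        if Addable n r i then Λ (addBox r i) - Λ r else 0 := by
      refine linearMap_ext_above fun v => ?_
      rw [LinearMap.comp_apply, swapGenerator_above, map_sum, LinearMap.sum_apply]
      have h1 := congrArg (Int.cast (R := ℂ)) (pairing_generator h v hr)
      rw [Int.cast_sum, Int.cast_sum] at h1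
      calc _ = ∑ i : Fin (n - 1), (((pairing c (lower v i) r - pairing c v r : ℤ)) : ℂ) := by
            refine Finset.sum_congr rfl fun i _ => ?_
            rw [map_sub, hΛ, hΛ]; simp
        _ = _ := h1
        _ = _ := by
            refine Finset.sum_congr rfl fun i _ => ?_
            split_ifs
            · rw [LinearMap.sub_apply, hΛ, hΛ]; simp
            · simp
    intro g
    have h2 := LinearMap.congr_fun this g
    rw [LinearMap.comp_apply, LinearMap.sum_apply] at h2
    rw [h2]
    refine Finset.sum_congr rfl fun i _ => ?_
    split_ifs <;> simp
  · intro r hr k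
    have : Λ r ∘ₗ restrictSettled (k + 1) =
        if (k : ℕ) + 1 ≤ r (n - (k + 1) - 1) then Λ r else 0 := by
      refine linearMap_ext_above fun v => ?_
      obtain ⟨j, hj, hj'⟩ := pairing_settled h v k
      have h1 : restrictSettled (k + 1) (above v) = above j := by
        ext η
        by_cases h1 : Settled (k + 1) η <;> by_cases h2 : BruhatLE v η <;>
          simp [restrictSettled, above, hj, h1, h2]
      rw [LinearMap.comp_apply, h1, hΛ, hj' r hr]
      split_ifs
      · rw [hΛ]
      · simp
    intro g
    rw [← LinearMap.comp_apply, this]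
    split_ifs <;> simp

/-- The difference between a staircase and a diagram, as the number of missing boxes. -/
def missing (n : ℕ) (r : ℕ → ℕ) : ℕ := ∑ i ∈ Finset.range (n - 1), (n - 1 - i - r i)

theorem missing_addBox {r : ℕ → ℕ} {i : ℕ} (hi : Addable n r i) :
    missing n (addBox r i) < missing n r := by
  have h1 := hi.1
  refine Finset.sum_lt_sum (fun j _ => ?_) ⟨i, Finset.mem_range.2 (by omega), ?_⟩
  · simp only [addBox, Function.update_apply]
    split_ifs with h
    · subst h; omega
    · exact le_rfl
  · simp only [addBox, Function.update_self]
    omega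

/-- A row can be lengthened as long as the diagram is not the whole staircase. -/
theorem exists_addable {r : ℕ → ℕ} {k : Fin (n - 1)}
    (hk : ¬ (k : ℕ) + 1 ≤ r (n - (k + 1) - 1)) : ∃ i : Fin (n - 1), Addable n r i := by
  have hk' := k.2
  have hex : ∃ i, r i < n - 1 - i := ⟨n - (k + 1) - 1, by omega⟩
  classical
  refine ⟨⟨Nat.find hex, ?_⟩, Nat.find_spec hex, fun j hj => ?_⟩
  · have := Nat.find_spec hex; omega
  · have h1 := Nat.find_min hex hj
    have h2 := Nat.find_spec hex
    have h3 : (Nat.find hex) > j := hj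
    simp only at hj ⊢
    omega

open Classical in
/-- The first-step equations for a function `G` of the configurations of the swap process and a
function `H` of the diagrams determine both, and force `G 1 = H ∅`. -/
theorem eq_of_firstStep (h : ∀ v : Equiv.Perm (Fin n), checkWord n c (word v) = true)
    (z : Fin (n - 1) → ℂ) (hz : ∀ k, (z k).re = 0) (G : Equiv.Perm (Fin n) → ℂ)
    (H : (ℕ → ℕ) → ℂ)
    (hG : ∀ η, ∑ i, (G (attempt η i) - G η) =
      (∑ k : Fin (n - 1), if Settled (k + 1) η then 0 else z k) * G η)
    (hG1 : ∀ η, (∀ k : Fin (n - 1), Settled (k + 1) η) → G η = 1)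
    (hH : ∀ r, IsShape n r → (∑ i : Fin (n - 1), if Addable n r i then H (addBox r i) - H r else 0) =
      (∑ k : Fin (n - 1), if (k : ℕ) + 1 ≤ r (n - (k + 1) - 1) then 0 else z k) * H r)
    (hH1 : ∀ r, IsShape n r → (∀ k : Fin (n - 1), (k : ℕ) + 1 ≤ r (n - (k + 1) - 1)) → H r = 1) :
    G 1 = H fun _ => 0 := by
  obtain ⟨Λ, h0, h1, hgen, hset⟩ := exists_dual_functionals h
  have hK : ∀ r, IsShape n r →
      (∑ i : Fin (n - 1), if Addable n r i then Λ (addBox r i) G - Λ r G else 0) =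
      (∑ k : Fin (n - 1), if (k : ℕ) + 1 ≤ r (n - (k + 1) - 1) then 0 else z k) * Λ r G := by
    intro r hr
    rw [← hgen r hr]
    have : swapGenerator G = ∑ k : Fin (n - 1), z k • (G - restrictSettled (k + 1) G) := by
      ext η
      change ∑ i, (G (attempt η i) - G η) = _
      rw [hG, Finset.sum_apply, Finset.sum_mul]
      refine Finset.sum_congr rfl fun k _ => ?_
      by_cases hs : Settled (k + 1) η <;> simp [restrictSettled, hs]
    rw [this, map_sum, Finset.sum_mul]
    refine Finset.sum_congr rfl fun k _ => ?_
    rw [map_smul, map_sub, hset r hr]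
    split_ifs <;> simp
  have hK1 : ∀ r, IsShape n r → (∀ k : Fin (n - 1), (k : ℕ) + 1 ≤ r (n - (k + 1) - 1)) →
      Λ r G = 1 := by
    intro r hr hfull
    -- for such `r`, the value of `Λ r` only depends on the values at the configurations where everything is settled
    have key : ∀ (S : Finset (Fin (n - 1))) (g : Equiv.Perm (Fin n) → ℂ),
        Λ r (fun η => if ∀ k ∈ S, Settled (k + 1) η then g η else 0) = Λ r g := by
      intro S g
      induction S using Finset.induction_on with
      | empty => simp
      | insert a S _ ih =>
        rw [← ih]
        have := hset r hr a (fun η => if ∀ k ∈ S, Settled (k + 1) η then g η else 0)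
        rw [if_pos (hfull a)] at this
        rw [← this]
        congr 1
        ext η
        by_cases h1 : Settled (a + 1) η <;> simp [restrictSettled, h1]
    rw [← h1 r, ← key Finset.univ G, ← key Finset.univ (fun _ => 1)]
    congr 1
    ext η
    by_cases hs : ∀ k ∈ Finset.univ, Settled ((k : Fin (n - 1)) + 1) η
    · rw [if_pos hs, if_pos hs, hG1 η fun k => hs k (Finset.mem_univ k)]
    · rw [if_neg hs, if_neg hs]
  have main : ∀ d r, missing n r = d → IsShape n r → Λ r G = H r := by
    intro d
    induction d using Nat.strong_induction_on with
    | _ d ih =>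
      intro r hd hr
      by_cases hfull : ∀ k : Fin (n - 1), (k : ℕ) + 1 ≤ r (n - (k + 1) - 1)
      · rw [hK1 r hr hfull, hH1 r hr hfull]
      · push Not at hfull
        obtain ⟨k, hk⟩ := hfull
        obtain ⟨i0, hi0⟩ := exists_addable (not_le.2 hk)
        set X : ℂ := ∑ k : Fin (n - 1), if (k : ℕ) + 1 ≤ r (n - (k + 1) - 1) then 0 else z k with hX
        have hXre : X.re = 0 := by
          rw [hX, Complex.re_sum]
          refine Finset.sum_eq_zero fun k _ => ?_
          split_ifs
          · rfl
          · exact hz k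
        have e : (((Finset.univ.filter fun i : Fin (n - 1) => Addable n r i).card : ℂ) + X) *
            (Λ r G - H r) = 0 := by
          have e1 := hK r hr
          have e2 := hH r hr
          have e3 : ∀ i : Fin (n - 1), Addable n r i → Λ (addBox r i) G = H (addBox r i) :=
            fun i hi => ih _ (hd ▸ missing_addBox hi) _ rfl (hr.addBox hi)
          have e4 : (∑ i : Fin (n - 1), if Addable n r i then Λ (addBox r i) G - Λ r G else 0) -
              (∑ i : Fin (n - 1), if Addable n r i then H (addBox r i) - H r else 0) =
              ∑ i : Fin (n - 1), if Addable n r i then -(Λ r G - H r) else 0 := by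
            rw [← Finset.sum_sub_distrib]
            refine Finset.sum_congr rfl fun i _ => ?_
            split_ifs with hi
            · rw [e3 i hi]; ring
            · ring
          rw [e1, e2, ← Finset.sum_filter, Finset.sum_const, nsmul_eq_mul] at e4
          linear_combination e4
        rcases mul_eq_zero.1 e with h' | h'
        -- the real part of the other factor is the number of corners, which is positive
        · exfalso
          have := congrArg Complex.re h'
          simp only [Complex.add_re, Complex.natCast_re, Complex.zero_re, hXre, add_zero,
            Nat.cast_eq_zero, Finset.card_eq_zero] at this
          have hmem : i0 ∈ Finset.univ.filter fun i : Fin (n - 1) => Addable n r i := by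
            simpa using hi0
          rw [this] at hmem
          simp at hmem
        · exact sub_eq_zero.1 h'
  rw [← h0 G]
  exact main _ _ rfl ⟨fun _ _ _ => le_rfl, fun _ => Nat.zero_le _⟩

end Functional

/-! ### Families of independent exponential random variables -/

section Exponential

instance isProbabilityMeasure_exp : IsProbabilityMeasure (expMeasure 1) :=
  isProbabilityMeasure_expMeasure one_pos

/-- The law of a family of independent exponential random variables of rate `1`. -/
noncomputable def expLaw (ι : Type*) : Measure (ι → ℝ) := Measure.infinitePi fun _ => expMeasure 1

instance {ι : Type*} : IsProbabilityMeasure (expLaw ι) := by unfold expLaw; infer_instance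

theorem expMeasure_eq : expMeasure 1 = volume.withDensity (exponentialPDF 1) := rfl

theorem measurable_exponentialPDF' : Measurable (exponentialPDF 1) :=
  (measurable_exponentialPDFReal 1).ennreal_ofReal

/-- The lack of memory of the exponential distribution. -/
theorem expMeasure_shift {s : ℝ} (hs : 0 ≤ s) {A : Set ℝ} (hA : MeasurableSet A) :
    expMeasure 1 {x | s < x ∧ x - s ∈ A} = ENNReal.ofReal (Real.exp (-s)) * expMeasure 1 A := by
  have hA' : MeasurableSet {x : ℝ | s < x ∧ x - s ∈ A} :=
    measurableSet_Ioi.inter (hA.preimage (measurable_id.sub_const s))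
  rw [expMeasure_eq, withDensity_apply _ hA', withDensity_apply _ hA,
    ← lintegral_indicator hA', ← lintegral_indicator hA,
    ← lintegral_add_right_eq_self _ s, ← lintegral_const_mul _
      (measurable_exponentialPDF'.indicator hA)]
  refine lintegral_congr_ae ?_
  have h0 : ∀ᵐ y : ℝ, y ≠ 0 := by simp [ae_iff]
  filter_upwards [h0] with y hy
  have hmem : y + s ∈ {x : ℝ | s < x ∧ x - s ∈ A} ↔ 0 < y ∧ y ∈ A := by
    rw [Set.mem_ofPred_eq, lt_add_iff_pos_left, add_sub_cancel_right]
  simp only [Set.indicator]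
  by_cases hyA : y ∈ A
  · rcases lt_or_gt_of_ne hy with h | h
    · rw [if_neg fun h' => absurd (hmem.1 h').1 (not_lt.2 h.le), if_pos hyA, exponentialPDF_of_neg h, mul_zero]
    · rw [if_pos (hmem.2 ⟨h, hyA⟩), if_pos hyA, exponentialPDF_of_nonneg (by linarith),
        exponentialPDF_of_nonneg h.le, ← ENNReal.ofReal_mul (Real.exp_pos _).le]
      congr 1
      rw [one_mul, one_mul, one_mul, one_mul, ← Real.exp_add]
      congr 1
      ring
  · rw [if_neg fun h' => hyA (hmem.1 h').2, if_neg hyA, mul_zero]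

theorem ae_pos_expMeasure : ∀ᵐ s ∂expMeasure 1, 0 < s := by
  have h := expMeasure_shift le_rfl MeasurableSet.univ
  simp only [Set.mem_univ, and_true, neg_zero, Real.exp_zero, ENNReal.ofReal_one, measure_univ,
    mul_one] at h
  exact (prob_compl_eq_zero_iff (measurableSet_Ioi)).2 h

theorem expMeasure_singleton (a : ℝ) : expMeasure 1 {a} = 0 := by
  rw [expMeasure_eq]
  exact withDensity_absolutelyContinuous _ _ (by simp)

theorem ae_pos_expLaw {ι : Type*} [Countable ι] : ∀ᵐ x ∂expLaw ι, ∀ i, 0 < x i := by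
  rw [ae_all_iff]
  intro i
  have := (measurePreserving_eval_infinitePi (fun _ : ι => expMeasure 1) i).quasiMeasurePreserving
  exact this.ae ae_pos_expMeasure

/-- Coordinate `c` is smaller than all the coordinates in `D`. -/
def IsFirst {ι : Type*} (D : Finset ι) (c : ι) (x : ι → ℝ) : Prop := ∀ i ∈ D, x c < x i

theorem measurableSet_isFirst {ι : Type*} (D : Finset ι) (c : ι) : MeasurableSet {x | IsFirst D c x} := by
  have : {x : ι → ℝ | IsFirst D c x} = ⋂ i ∈ D, {x | x c < x i} := by
    ext x; simp [IsFirst]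
  rw [this]
  exact Finset.measurableSet_biInter D fun i _ =>
    measurableSet_lt (measurable_pi_apply c) (measurable_pi_apply i)

variable {ι : Type*} [DecidableEq ι]

theorem measurable_update_pair (c : ι) :
    Measurable fun p : ℝ × (ι → ℝ) => Function.update p.2 c p.1 := by
  refine measurable_pi_iff.2 fun i => ?_
  by_cases h : i = c
  · subst h; simpa using measurable_fst
  · simp only [Function.update_of_ne h]
    exact (measurable_pi_apply i).comp measurable_snd

/-- Redrawing one coordinate independently does not change the law. -/
theorem map_update_expLaw (c : ι) :
    ((expMeasure 1).prod (expLaw ι)).map (fun p => Function.update p.2 c p.1) = expLaw ι := by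
  have hm := measurable_update_pair (ι := ι) c
  refine Measure.eq_infinitePi _ fun S t ht => ?_
  rw [Measure.map_apply hm (MeasurableSet.pi S.countable_toSet fun i _ => ht i)]
  have : (fun p : ℝ × (ι → ℝ) => Function.update p.2 c p.1) ⁻¹' (Set.pi S t) =
      (if c ∈ S then t c else Set.univ) ×ˢ Set.pi (S.erase c : Finset ι) t := by
    ext ⟨s, x⟩
    simp only [Set.mem_preimage, Set.mem_pi, Set.mem_prod, Finset.mem_coe, Finset.mem_erase]
    constructor
    · intro h
      refine ⟨?_, fun i hi => by simpa [hi.1] using h i hi.2⟩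
      split_ifs with hc
      · simpa using h c hc
      · trivial
    · rintro ⟨h1, h2⟩ i hi
      by_cases hic : i = c
      · subst hic; simpa [hi] using h1
      · simpa [hic] using h2 i ⟨hic, hi⟩
  rw [this, Measure.prod_prod, expLaw, Measure.infinitePi_pi _ fun i _ => ht i]
  split_ifs with hc
  · exact Finset.mul_prod_erase S (fun i => expMeasure 1 (t i)) hc
  · rw [Finset.erase_eq_of_notMem hc, measure_univ, one_mul]

/-- Subtract `s` from the coordinates in `D`. -/
def shiftOn (D : Finset ι) (s : ℝ) (x : ι → ℝ) : ι → ℝ := fun i => if i ∈ D then x i - s else x i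

theorem measurable_shiftOn (D : Finset ι) (s : ℝ) : Measurable (shiftOn D s) := by
  refine measurable_pi_iff.2 fun i => ?_
  unfold shiftOn
  split_ifs
  · exact Measurable.sub_const (f := fun x : ι → ℝ => x i) (measurable_pi_apply i) s
  · exact measurable_pi_apply i

/-- The lack of memory of a finite subfamily. -/
theorem map_shiftOn_expLaw (D : Finset ι) {s : ℝ} (hs : 0 ≤ s) :
    ((expLaw ι).restrict {x | ∀ i ∈ D, s < x i}).map (shiftOn D s) =
      ENNReal.ofReal (Real.exp (-s)) ^ D.card • expLaw ι := by
  have hpos : ENNReal.ofReal (Real.exp (-s)) ≠ 0 := by simp [Real.exp_pos]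
  have hE : ENNReal.ofReal (Real.exp (-s)) ^ D.card ≠ 0 := pow_ne_zero _ hpos
  have hE' : ENNReal.ofReal (Real.exp (-s)) ^ D.card ≠ ⊤ := ENNReal.pow_ne_top ENNReal.ofReal_ne_top
  suffices h : (ENNReal.ofReal (Real.exp (-s)) ^ D.card)⁻¹ •
      ((expLaw ι).restrict {x | ∀ i ∈ D, s < x i}).map (shiftOn D s) = expLaw ι by
    rw [← h, smul_smul, ENNReal.mul_inv_cancel hE hE', one_smul, h]
  refine Measure.eq_infinitePi _ fun S t ht => ?_
  have hbox : MeasurableSet (Set.pi (S : Set ι) t) :=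
    MeasurableSet.pi S.countable_toSet fun i _ => ht i
  have hset : MeasurableSet {x : ι → ℝ | ∀ i ∈ D, s < x i} := by
    have : {x : ι → ℝ | ∀ i ∈ D, s < x i} = Set.pi (D : Set ι) fun _ => Set.Ioi s := by
      ext x; simp [Set.mem_pi]
    rw [this]
    exact MeasurableSet.pi D.countable_toSet fun i _ => measurableSet_Ioi
  set t' : ι → Set ℝ := fun i => if i ∈ S then t i else Set.univ with ht'
  have hmt' : ∀ i, MeasurableSet (t' i) := fun i => by
    simp only [ht']; split_ifs
    · exact ht i
    · exact MeasurableSet.univ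
  rw [Measure.smul_apply, Measure.map_apply (measurable_shiftOn D s) hbox,
    Measure.restrict_apply (hbox.preimage (measurable_shiftOn D s))]
  have : shiftOn D s ⁻¹' (Set.pi S t) ∩ {x | ∀ i ∈ D, s < x i} =
      Set.pi (S ∪ D : Finset ι) fun i => if i ∈ D then {x | s < x ∧ x - s ∈ t' i} else t' i := by
    ext x
    simp only [Set.mem_inter_iff, Set.mem_preimage, Set.mem_pi, Finset.mem_coe, Finset.mem_union,
      Set.mem_ofPred_eq, shiftOn, ht']
    constructor
    · rintro ⟨h1, h2⟩ i hi
      by_cases hD : i ∈ D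
      · rw [if_pos hD]
        refine ⟨h2 i hD, ?_⟩
        split_ifs with hS
        · simpa [hD] using h1 i hS
        · trivial
      · rw [if_neg hD]
        have hS : i ∈ S := by tauto
        rw [if_pos hS]
        simpa [hD] using h1 i hS
    · intro h
      refine ⟨fun i hi => ?_, fun i hi => ?_⟩
      · have := h i (Or.inl hi)
        by_cases hD : i ∈ D
        · rw [if_pos hD, if_pos hi] at this
          rw [if_pos hD]; exact this.2
        · rw [if_neg hD, if_pos hi] at this
          rw [if_neg hD]; exact this
      · have := h i (Or.inr hi)
        rw [if_pos hi] at this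
        exact this.1
  have hm : ∀ i, MeasurableSet (if i ∈ D then {x | s < x ∧ x - s ∈ t' i} else t' i) := fun i => by
    split_ifs
    · exact measurableSet_Ioi.inter ((hmt' i).preimage (measurable_id.sub_const s))
    · exact hmt' i
  rw [this, expLaw, Measure.infinitePi_pi _ fun i _ => hm i]
  have h1 : ∀ i ∈ S ∪ D, expMeasure 1 (if i ∈ D then {x | s < x ∧ x - s ∈ t' i} else t' i) =
      (if i ∈ D then ENNReal.ofReal (Real.exp (-s)) else 1) * expMeasure 1 (t' i) := by
    intro i _
    split_ifs
    · exact expMeasure_shift hs (hmt' i)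
    · rw [one_mul]
  rw [Finset.prod_congr rfl h1, Finset.prod_mul_distrib, Finset.prod_ite_mem,
    Finset.inter_eq_right.2 Finset.subset_union_right, Finset.prod_const, smul_eq_mul, ← mul_assoc,
    ENNReal.inv_mul_cancel hE hE', one_mul]
  rw [← Finset.prod_subset (Finset.subset_union_left (s₁ := S) (s₂ := D))]
  · exact Finset.prod_congr rfl fun i hi => by rw [ht']; simp [hi]
  · intro i _ hi
    simp [ht', hi]

/-- A coordinate almost surely differs from any given function of the other coordinates. -/
theorem ae_ne_of_update (c : ι) {f : (ι → ℝ) → ℝ} (hf : Measurable f)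
    (hfc : ∀ x s, f (Function.update x c s) = f x) : ∀ᵐ x ∂expLaw ι, x c ≠ f x := by
  have hset : MeasurableSet {x : ι → ℝ | x c ≠ f x} :=
    (measurableSet_eq_fun (measurable_pi_apply c) hf).compl
  rw [← map_update_expLaw c, ae_map_iff (measurable_update_pair c).aemeasurable hset]
  simp only [Function.update_self, hfc]
  have hset2 : MeasurableSet {p : (ι → ℝ) × ℝ | p.2 ≠ f p.1} :=
    (measurableSet_eq_fun measurable_snd (hf.comp measurable_fst)).compl
  rw [← Measure.prod_swap, ae_map_iff measurable_swap.aemeasurable]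
  · refine (Measure.ae_prod_iff_ae_ae hset2).2 (Filter.Eventually.of_forall fun x => ?_)
    rw [ae_iff]
    simp only [not_not]
    exact expMeasure_singleton _
  · exact (measurableSet_eq_fun measurable_fst (hf.comp measurable_snd)).compl

theorem integral_exp_expMeasure {a : ℂ} (ha : a.re < 1) :
    ∫ s, Complex.exp (a * s) ∂expMeasure 1 = 1 / (1 - a) := by
  have hne : 1 - a ≠ 0 := fun h => by
    have := congrArg Complex.re h
    simp at this
    linarith
  rw [expMeasure_eq, integral_withDensity_eq_integral_toReal_smul measurable_exponentialPDF'
    (Filter.Eventually.of_forall fun x => ENNReal.ofReal_lt_top)]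
  have h1 : ∀ x : ℝ, x ≠ 0 → (exponentialPDF 1 x).toReal • Complex.exp (a * x) =
      Set.indicator (Set.Ioi 0) (fun x : ℝ => Complex.exp ((a - 1) * x)) x := by
    intro x hx
    rcases lt_or_gt_of_ne hx with h | h
    · rw [exponentialPDF_of_neg h, Set.indicator_of_notMem (by simpa using h.le)]
      simp
    · rw [exponentialPDF_of_nonneg h.le, Set.indicator_of_mem (by simpa using h), one_mul, one_mul,
        ENNReal.toReal_ofReal (Real.exp_pos _).le, Complex.real_smul, Complex.ofReal_exp,
        ← Complex.exp_add]
      congr 1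
      push_cast
      ring
  rw [integral_congr_ae (g := Set.indicator (Set.Ioi 0)
    (fun x : ℝ => Complex.exp ((a - 1) * x)))]
  · rw [integral_indicator measurableSet_Ioi, integral_exp_mul_complex_Ioi (by simp; linarith)]
    simp
    rw [← neg_sub 1 a, neg_div_neg_eq, one_div]
  · have h0 : ∀ᵐ y : ℝ, y ≠ 0 := by simp [ae_iff]
    filter_upwards [h0] with x hx using h1 x hx

theorem measurable_shiftOn_self (D : Finset ι) (c : ι) :
    Measurable fun x : ι → ℝ => shiftOn D (x c) x := by
  refine measurable_pi_iff.2 fun i => ?_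
  unfold shiftOn
  split_ifs
  · exact Measurable.sub (f := fun x : ι → ℝ => x i) (measurable_pi_apply i) (measurable_pi_apply c)
  · exact measurable_pi_apply i

theorem shiftOn_update {D : Finset ι} {c : ι} (hc : c ∉ D) (s t : ℝ) (x : ι → ℝ) :
    shiftOn D s (Function.update x c t) = Function.update (shiftOn D s x) c t := by
  funext i
  by_cases h : i = c
  · subst h; simp [shiftOn, hc]
  · simp [shiftOn, h]

theorem isFirst_update {D : Finset ι} {c : ι} (hc : c ∉ D) (t : ℝ) (x : ι → ℝ) :
    IsFirst D c (Function.update x c t) ↔ ∀ i ∈ D, t < x i := by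
  refine forall₂_congr fun i hi => ?_
  rw [Function.update_self, Function.update_of_ne (ne_of_mem_of_not_mem hi hc)]

open Classical in
/-- The first of finitely many independent exponential times, the value of that time, and what
remains of the other ones are independent. -/
theorem integral_isFirst {D : Finset ι} {c : ι} (hc : c ∉ D) {z : ℂ} (hz : z.re = 0)
    {Ψ : (ι → ℝ) → ℂ} (hΨ : Measurable Ψ) {B : ℝ} (hB : ∀ x, ‖Ψ x‖ ≤ B)
    (hΨc : ∀ x s, Ψ (Function.update x c s) = Ψ x) :
    ∫ x, (if IsFirst D c x then Complex.exp (z * x c) * Ψ (shiftOn D (x c) x) else 0) ∂expLaw ι =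
      (1 / (D.card + 1 - z)) * ∫ x, Ψ x ∂expLaw ι := by
  set F : (ι → ℝ) → ℂ := fun x =>
    if IsFirst D c x then Complex.exp (z * x c) * Ψ (shiftOn D (x c) x) else 0 with hF
  have hFm : Measurable F := by
    refine Measurable.ite (measurableSet_isFirst D c) (Measurable.mul ?_ ?_) measurable_const
    · exact Complex.measurable_exp.comp
        (measurable_const.mul (Complex.measurable_ofReal.comp (measurable_pi_apply c)))
    · exact hΨ.comp (measurable_shiftOn_self D c)
  have hexp : ∀ s : ℝ, ‖Complex.exp (z * s)‖ = 1 := fun s => by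
    rw [Complex.norm_exp]; simp [hz]
  have hFB : ∀ x, ‖F x‖ ≤ B := fun x => by
    simp only [hF]
    split_ifs
    · rw [norm_mul, hexp, one_mul]; exact hB _
    · rw [norm_zero]; exact (norm_nonneg _).trans (hB x)
  have hFu : ∀ (s : ℝ) (x : ι → ℝ), F (Function.update x c s) =
      Complex.exp (z * s) * Set.indicator {x : ι → ℝ | ∀ i ∈ D, s < x i}
        (fun x => Ψ (shiftOn D s x)) x := by
    intro s x
    simp only [hF, isFirst_update hc, Function.update_self, shiftOn_update hc, hΨc,
      Set.indicator_apply, Set.mem_ofPred_eq]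
    split_ifs <;> simp
  have hset : ∀ s : ℝ, MeasurableSet {x : ι → ℝ | ∀ i ∈ D, s < x i} := fun s => by
    have : {x : ι → ℝ | ∀ i ∈ D, s < x i} = ⋂ i ∈ D, {x | s < x i} := by
      ext x; simp
    rw [this]
    exact Finset.measurableSet_biInter D fun i _ =>
      measurableSet_lt measurable_const (measurable_pi_apply i)
  have hint : Integrable (fun p : ℝ × (ι → ℝ) => F (Function.update p.2 c p.1))
      ((expMeasure 1).prod (expLaw ι)) :=
    Integrable.of_bound (hFm.comp (measurable_update_pair c)).aestronglyMeasurable B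
      (Filter.Eventually.of_forall fun p => hFB _)
  have hinner : ∀ s : ℝ, 0 < s → ∫ x, F (Function.update x c s) ∂expLaw ι =
      Complex.exp ((z - D.card) * s) * ∫ x, Ψ x ∂expLaw ι := by
    intro s hs
    simp only [hFu]
    rw [integral_const_mul, integral_indicator (hset s),
      ← integral_map (f := Ψ) (measurable_shiftOn D s).aemeasurable hΨ.aestronglyMeasurable,
      map_shiftOn_expLaw D hs.le, integral_smul_measure, ENNReal.toReal_pow,
      ENNReal.toReal_ofReal (Real.exp_pos _).le, ← Real.exp_nat_mul, Complex.real_smul,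
      ← mul_assoc, Complex.ofReal_exp, ← Complex.exp_add]
    congr 2
    push_cast
    ring
  calc ∫ x, F x ∂expLaw ι
      = ∫ p, F (Function.update p.2 c p.1) ∂((expMeasure 1).prod (expLaw ι)) := by
        conv_lhs => rw [← map_update_expLaw c]
        exact integral_map (measurable_update_pair c).aemeasurable
          hFm.aestronglyMeasurable
    _ = ∫ s, ∫ x, F (Function.update x c s) ∂expLaw ι ∂expMeasure 1 := integral_prod _ hint
    _ = ∫ s, Complex.exp ((z - D.card) * s) * ∫ x, Ψ x ∂expLaw ι ∂expMeasure 1 :=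
        integral_congr_ae (ae_pos_expMeasure.mono hinner)
    _ = _ := by
        rw [integral_mul_const, integral_exp_expMeasure (by
          rw [Complex.sub_re, hz, Complex.natCast_re, zero_sub]
          linarith [(Nat.cast_nonneg D.card : (0 : ℝ) ≤ D.card)])]
        congr 2
        ring

/-- Which of finitely many independent exponential times is the first one, and what remains of the
other ones, are independent. -/
theorem measureReal_isFirst {D : Finset ι} {c : ι} (hc : c ∉ D) {A : Set (ι → ℝ)}
    (hA : MeasurableSet A) (hAc : ∀ x s, Function.update x c s ∈ A ↔ x ∈ A) :
    (expLaw ι).real {x | IsFirst D c x ∧ shiftOn D (x c) x ∈ A} =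
      (expLaw ι).real A / (D.card + 1) := by
  classical
  have h := integral_isFirst hc (z := 0) rfl (Ψ := A.indicator fun _ => 1)
    (measurable_const.indicator hA)
    (B := 1) (fun x => (norm_indicator_le_norm_self _ _).trans (by simp))
    (fun x s => by simp only [Set.indicator_apply, hAc])
  have hS : MeasurableSet {x | IsFirst D c x ∧ shiftOn D (x c) x ∈ A} :=
    (measurableSet_isFirst D c).inter (measurable_shiftOn_self D c hA)
  have e : ∀ x : ι → ℝ, (if IsFirst D c x then Complex.exp (0 * x c) *
      (A.indicator (fun _ => 1) (shiftOn D (x c) x) : ℂ) else 0) =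
        Set.indicator {x | IsFirst D c x ∧ shiftOn D (x c) x ∈ A} (fun _ => (1 : ℂ)) x := by
    intro x
    simp only [Set.indicator_apply, Set.mem_ofPred_eq, zero_mul, Complex.exp_zero, one_mul]
    split_ifs <;> simp_all
  simp only [e] at h
  rw [integral_indicator_const _ hS, integral_indicator_const _ hA, sub_zero, Complex.real_smul,
    Complex.real_smul, mul_one, mul_one] at h
  have h' : (((expLaw ι).real {x | IsFirst D c x ∧ shiftOn D (x c) x ∈ A} : ℝ) : ℂ) =
      (((expLaw ι).real A / (D.card + 1) : ℝ) : ℂ) := by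
    rw [h]; push_cast; ring
  exact_mod_cast h'

theorem IsIIDExp.map_eq {κ Ω : Type*} [MeasurableSpace Ω] {X : κ → Ω → ℝ} {μ : Measure Ω}
    [IsProbabilityMeasure μ] (hX : IsIIDExp X μ) : μ.map (fun ω i => X i ω) = expLaw κ := by
  rw [hX.indep.map_fun_eq_infinitePi_map hX.measurable]
  simp only [hX.law, expLaw]

theorem measurePreserving_comp_expLaw {κ κ' : Type*} {f : κ → κ'} (hf : Function.Injective f) :
    MeasurePreserving (fun (x : κ' → ℝ) i => x (f i)) (expLaw κ') (expLaw κ) :=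
  ⟨measurable_pi_iff.2 fun i => measurable_pi_apply (f i),
    Measure.map_infinitePi_infinitePi_of_inj hf⟩

end Exponential

/-! ### Configurations: settled positions and the potential -/

section Potential

variable {n : ℕ}

open Classical in
theorem labelAt_attempt (η : Equiv.Perm (Fin n)) (κ : Fin (n - 1)) (p : ℕ) :
    labelAt (attempt η κ) p = if CanSwap η κ then
      (if p = κ then labelAt η (κ + 1) else if p = κ + 1 then labelAt η κ else labelAt η p)
      else labelAt η p := by
  unfold attempt
  split_ifs with h
  all_goals first | rfl | (rw [labelAt_mul_swap]; simp_all)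

/-- The first `k + 1` positions only exchange particles with the others at the pair `k, k + 1`. -/
theorem settled_attempt_of_ne {k κ : Fin (n - 1)} (h : κ ≠ k) (η : Equiv.Perm (Fin n)) :
    Settled (k + 1) (attempt η κ) ↔ Settled (k + 1) η := by
  have h' : (κ : ℕ) ≠ k := fun e => h (Fin.ext e)
  unfold Settled
  simp only [labelAt_attempt]
  by_cases hc : CanSwap η κ
  · simp only [if_pos hc]
    constructor <;> intro hs p hp
    · by_cases h1 : p = κ
      · have := hs (κ + 1) (by omega)
        rw [if_neg (by omega), if_pos rfl] at this
        rwa [h1]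
      · by_cases h2 : p = κ + 1
        · have := hs κ (by omega)
          rw [if_pos rfl] at this
          rwa [h2]
        · have := hs p hp
          rwa [if_neg h1, if_neg h2] at this
    · split_ifs
      · exact hs _ (by omega)
      · exact hs _ (by omega)
      · exact hs p hp
  · simp only [if_neg hc]

/-- All the top labels are on the left of the pair `k, k + 1` once they are settled there. -/
theorem not_canSwap_of_settled {k : Fin (n - 1)} {η : Equiv.Perm (Fin n)} (h : Settled (k + 1) η) :
    ¬ CanSwap η k := by
  rw [canSwap_iff]
  intro hlt
  have hk := k.2
  have hmap : Set.MapsTo (labelAt η) (Finset.range (k + 2) : Finset ℕ)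
      (Finset.Ico (n - (k + 1)) n : Finset ℕ) := by
    intro p hp
    simp only [Finset.coe_range, Set.mem_Iio] at hp
    simp only [Finset.coe_Ico, Set.mem_Ico]
    refine ⟨?_, labelAt_lt η (by omega)⟩
    by_cases hp' : p < k + 1
    · exact h p hp'
    · have h1 := h k (by omega)
      have : p = k + 1 := by omega
      rw [this]; omega
  have := Finset.card_le_card_of_injOn _ hmap fun p hp q hq e => by
    simp only [Finset.coe_range, Set.mem_Iio] at hp hq
    exact labelAt_inj η (by omega) (by omega) e
  simp at this
  omega

theorem attempt_of_not_canSwap {η : Equiv.Perm (Fin n)} {κ : Fin (n - 1)} (h : ¬ CanSwap η κ) :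
    attempt η κ = η := if_neg h

theorem Settled.attempt {k : Fin (n - 1)} {η : Equiv.Perm (Fin n)} (h : Settled (k + 1) η)
    (κ : Fin (n - 1)) : Settled (k + 1) (OrientedSwap.attempt η κ) := by
  by_cases e : κ = k
  · subst e
    rwa [attempt_of_not_canSwap (not_canSwap_of_settled h)]
  · rwa [settled_attempt_of_ne e]

theorem settled_of_forall_not_canSwap {η : Equiv.Perm (Fin n)} (h : ∀ κ, ¬ CanSwap η κ) (k : ℕ) :
    Settled k η := by
  have key : ∀ d p, p + d + 1 = n → d ≤ labelAt η p := by
    intro d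
    induction d with
    | zero => exact fun p _ => Nat.zero_le _
    | succ d ih =>
      intro p hp
      have h1 := ih (p + 1) (by omega)
      have h2 := h ⟨p, by omega⟩
      rw [canSwap_iff] at h2
      have h3 : labelAt η p ≠ labelAt η (p + 1) := fun e => by
        have := labelAt_inj η (by omega) (by omega) e
        omega
      simp only at h2
      omega
  intro p hp
  by_cases hpn : p < n
  · have := key (n - 1 - p) p (by omega)
    omega
  · omega

/-- A potential that every swap decreases. -/
def potential (η : Equiv.Perm (Fin n)) : ℕ := ∑ p ∈ Finset.range n, p * labelAt η p

theorem potential_attempt_lt {η : Equiv.Perm (Fin n)} {κ : Fin (n - 1)} (h : CanSwap η κ) :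
    potential (attempt η κ) < potential η := by
  have hκ := κ.2
  have hsub : ({(κ : ℕ), (κ : ℕ) + 1} : Finset ℕ) ⊆ Finset.range n := by
    intro p hp
    simp only [Finset.mem_insert, Finset.mem_singleton] at hp
    exact Finset.mem_range.2 (by omega)
  unfold potential
  simp only [labelAt_attempt, if_pos h]
  rw [← Finset.sum_sdiff hsub, ← Finset.sum_sdiff hsub (f := fun p => p * labelAt η p)]
  refine add_lt_add_of_le_of_lt (le_of_eq (Finset.sum_congr rfl fun p hp => ?_)) ?_
  · simp only [Finset.mem_sdiff, Finset.mem_insert, Finset.mem_singleton, not_or] at hp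
    rw [if_neg hp.2.1, if_neg hp.2.2]
  · rw [Finset.sum_pair (by omega), Finset.sum_pair (by omega), if_pos rfl,
      if_neg (by omega), if_pos rfl]
    rw [canSwap_iff] at h
    nlinarith

theorem potential_attempt_le (η : Equiv.Perm (Fin n)) (κ : Fin (n - 1)) :
    potential (attempt η κ) ≤ potential η := by
  by_cases h : CanSwap η κ
  · exact (potential_attempt_lt h).le
  · rw [attempt_of_not_canSwap h]

end Potential

/-! ### The first ring of a realization of the clocks -/

section Realization

variable {n : ℕ}

/-- Ring times that are positive, increasing along each clock, and distinct for distinct clocks. -/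
structure Regular (T : Fin (n - 1) → ℕ → ℝ) : Prop where
  pos : ∀ k, 0 < T k 0
  strictMono : ∀ k, StrictMono (T k)
  ne : ∀ k k' m m', k ≠ k' → T k m ≠ T k' m'

/-- Clock `κ` is the first one to ring. -/
def RingsFirst (T : Fin (n - 1) → ℕ → ℝ) (κ : Fin (n - 1)) : Prop := ∀ k, k ≠ κ → T κ 0 < T k 0

/-- The ring times after the first ring of clock `κ`, counted from that ring. -/
def advance (T : Fin (n - 1) → ℕ → ℝ) (κ : Fin (n - 1)) : Fin (n - 1) → ℕ → ℝ :=
  fun k m => (if k = κ then T k (m + 1) else T k m) - T κ 0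

theorem Regular.exists_ringsFirst {T : Fin (n - 1) → ℕ → ℝ} (hT : Regular T)
    [Nonempty (Fin (n - 1))] : ∃ κ, RingsFirst T κ := by
  obtain ⟨κ, hκ⟩ := Finite.exists_min fun k => T k 0
  exact ⟨κ, fun k hk => lt_of_le_of_ne (hκ k) (hT.ne _ _ _ _ hk.symm)⟩

theorem RingsFirst.unique {T : Fin (n - 1) → ℕ → ℝ} {κ κ' : Fin (n - 1)} (h : RingsFirst T κ)
    (h' : RingsFirst T κ') : κ = κ' := by
  by_contra e
  exact lt_asymm (h κ' (Ne.symm e)) (h' κ e)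

theorem Regular.advance {T : Fin (n - 1) → ℕ → ℝ} (hT : Regular T) {κ : Fin (n - 1)}
    (hκ : RingsFirst T κ) : Regular (advance T κ) where
  pos k := by
    unfold OrientedSwap.advance
    split_ifs with h
    · subst h; exact sub_pos.2 (hT.strictMono k (by omega))
    · exact sub_pos.2 (hκ k h)
  strictMono k := by
    intro a b hab
    unfold OrientedSwap.advance
    split_ifs
    · exact sub_lt_sub_right (hT.strictMono k (by omega)) _
    · exact sub_lt_sub_right (hT.strictMono k hab) _
  ne k k' m m' h := by
    unfold OrientedSwap.advance
    intro e
    have e := sub_left_injective e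
    split_ifs at e <;> exact hT.ne _ _ _ _ h e

variable {T : Fin (n - 1) → ℕ → ℝ} {κ : Fin (n - 1)}

theorem Regular.le_of_ringsAt (hT : Regular T) (hκ : RingsFirst T κ) {k : Fin (n - 1)} {t : ℝ}
    (h : RingsAt T k t) : T κ 0 ≤ t := by
  obtain ⟨m, rfl⟩ := h
  by_cases e : k = κ
  · subst e; exact (hT.strictMono k).monotone (Nat.zero_le m)
  · exact (hκ k e).le.trans ((hT.strictMono k).monotone (Nat.zero_le m))

theorem Regular.ringsAt_first (hT : Regular T) {k : Fin (n - 1)} :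
    RingsAt T k (T κ 0) ↔ k = κ := by
  constructor
  · rintro ⟨m, h⟩
    by_contra e
    exact hT.ne _ _ _ _ e h
  · rintro rfl
    exact ⟨0, rfl⟩

theorem ringsAt_add {k : Fin (n - 1)} {u : ℝ}
    (hu : 0 < u) : RingsAt T k (T κ 0 + u) ↔ RingsAt (OrientedSwap.advance T κ) k u := by
  unfold RingsAt OrientedSwap.advance
  by_cases e : k = κ
  · subst e
    simp only [if_true]
    constructor
    · rintro ⟨m, h⟩
      match m, h with
      | 0, h => linarith
      | m + 1, h => exact ⟨m, by linarith⟩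
    · rintro ⟨m, h⟩
      exact ⟨m + 1, by linarith⟩
  · simp only [if_neg e]
    refine exists_congr fun m => ⟨fun h => by linarith, fun h => by linarith⟩

theorem jumpTime_nonneg (T : Fin (n - 1) → ℕ → ℝ) (r : ℕ) : 0 ≤ jumpTime T r := by
  induction r with
  | zero => exact le_rfl
  | succ r ih => exact Real.sInf_nonneg fun s hs => ih.trans hs.1.le

theorem Regular.jumpTime_one (hT : Regular T) (hκ : RingsFirst T κ) : jumpTime T 1 = T κ 0 := by
  refine IsLeast.csInf_eq ⟨⟨hT.pos κ, κ, 0, rfl⟩, ?_⟩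
  rintro s ⟨-, k, h⟩
  exact hT.le_of_ringsAt hκ h

/-- The later rings are the rings of the clocks observed from the first ring on. The bound in the
first part says that there are still rings to come, so that the infimum that defines the next ring
is over a nonempty set. -/
theorem Regular.jumpTime_succ_aux (r : ℕ) : ∀ (T : Fin (n - 1) → ℕ → ℝ) (κ : Fin (n - 1)),
    Regular T → RingsFirst T κ → (∀ k, jumpTime T r < T k r) ∧
      jumpTime T (r + 1) = T κ 0 + jumpTime (OrientedSwap.advance T κ) r := by
  induction r with
  | zero =>
    intro T κ hT hκ
    exact ⟨hT.pos, by rw [hT.jumpTime_one hκ]; simp [jumpTime]⟩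
  | succ r ih =>
    intro T κ hT hκ
    have : Nonempty (Fin (n - 1)) := ⟨κ⟩
    have hT' := hT.advance hκ
    obtain ⟨κ', hκ'⟩ := hT'.exists_ringsFirst
    have h1 := (ih _ κ' hT' hκ').1
    have h2 := (ih T κ hT hκ).2
    refine ⟨fun k => ?_, ?_⟩
    · have := h1 k
      rw [h2]
      unfold OrientedSwap.advance at this ⊢
      split_ifs at this
      · linarith
      · have := hT.strictMono k (Nat.lt_succ_self r)
        linarith
    · have hset : {s | jumpTime T (r + 1) < s ∧ ∃ k, RingsAt T k s} =
          (fun u => T κ 0 + u) '' {u | jumpTime (OrientedSwap.advance T κ) r < u ∧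
            ∃ k, RingsAt (OrientedSwap.advance T κ) k u} := by
        ext s
        constructor
        · rintro ⟨h3, k, hk⟩
          rw [h2] at h3
          have h4 := jumpTime_nonneg (OrientedSwap.advance T κ) r
          refine ⟨s - T κ 0, ⟨by linarith, k, ?_⟩, by simp⟩
          rw [← ringsAt_add (by linarith)]
          simpa using hk
        · rintro ⟨u, ⟨h3, k, hk⟩, rfl⟩
          have h4 := jumpTime_nonneg (OrientedSwap.advance T κ) r
          refine ⟨by rw [h2]; simpa using h3, k, ?_⟩
          simpa only [ringsAt_add (h4.trans_lt h3)] using hk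
      have hne : {u | jumpTime (OrientedSwap.advance T κ) r < u ∧
            ∃ k, RingsAt (OrientedSwap.advance T κ) k u}.Nonempty :=
        ⟨_, h1 κ, κ, r, rfl⟩
      have hbdd : BddBelow {u | jumpTime (OrientedSwap.advance T κ) r < u ∧
            ∃ k, RingsAt (OrientedSwap.advance T κ) k u} := ⟨_, fun u hu => hu.1.le⟩
      show sInf {s | jumpTime T (r + 1) < s ∧ ∃ k, RingsAt T k s} = _
      rw [hset, show (fun u => T κ 0 + u) = OrderIso.addLeft (T κ 0) from rfl,
        ← OrderIso.map_csInf' _ hne hbdd]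
      rfl

theorem Regular.jumpTime_succ (hT : Regular T) (hκ : RingsFirst T κ) (r : ℕ) :
    jumpTime T (r + 1) = T κ 0 + jumpTime (OrientedSwap.advance T κ) r :=
  (Regular.jumpTime_succ_aux r T κ hT hκ).2

theorem Regular.jumpTime_pos (hT : Regular T) (hκ : RingsFirst T κ) (r : ℕ) :
    0 < jumpTime T (r + 1) := by
  rw [hT.jumpTime_succ hκ]
  exact add_pos_of_pos_of_nonneg (hT.pos κ) (jumpTime_nonneg _ r)

open Classical in
/-- The configuration after the first `r` rings, starting from `η`. -/
noncomputable def configFrom (T : Fin (n - 1) → ℕ → ℝ) (η : Equiv.Perm (Fin n)) :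
    ℕ → Equiv.Perm (Fin n)
  | 0 => η
  | r + 1 => ((List.finRange (n - 1)).filter
      (fun k => RingsAt T k (jumpTime T (r + 1)))).foldl attempt (configFrom T η r)

theorem config_eq (T : Fin (n - 1) → ℕ → ℝ) (r : ℕ) : config T r = configFrom T 1 r := by
  induction r with
  | zero => rfl
  | succ r ih => rw [config, configFrom, ih]

theorem Regular.configFrom_succ (hT : Regular T) (hκ : RingsFirst T κ) (η : Equiv.Perm (Fin n))
    (r : ℕ) : configFrom T η (r + 1) =
      configFrom (OrientedSwap.advance T κ) (attempt η κ) r := by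
  classical
  induction r with
  | zero =>
    have : (List.finRange (n - 1)).filter (fun k => RingsAt T k (T κ 0)) = [κ] := by
      rw [List.filter_congr (q := (· == κ)) fun k _ => by
          rw [Bool.eq_iff_iff, decide_eq_true_iff, hT.ringsAt_first, beq_iff_eq],
        List.filter_beq, List.count_eq_one_of_mem (List.nodup_finRange _) (List.mem_finRange κ)]
      rfl
    rw [← hT.jumpTime_one hκ] at this
    exact congrArg (fun l => List.foldl attempt η l) this
  | succ r ih =>
    rw [configFrom, ih, configFrom]
    have : Nonempty (Fin (n - 1)) := ⟨κ⟩
    have hT' := hT.advance hκ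
    obtain ⟨κ', hκ'⟩ := hT'.exists_ringsFirst
    congr 1
    refine List.filter_congr fun k _ => ?_
    rw [hT.jumpTime_succ hκ (r + 1), decide_eq_decide,
      ringsAt_add (hT'.jumpTime_pos hκ' r)]

/-- The times at which a swap occurs at the `k`-th pair of positions, starting from `η`. -/
def swapTimesFrom (T : Fin (n - 1) → ℕ → ℝ) (η : Equiv.Perm (Fin n)) (k : Fin (n - 1)) : Set ℝ :=
  {t | ∃ r, t = jumpTime T (r + 1) ∧ RingsAt T k t ∧ CanSwap (configFrom T η r) k}

theorem swapTimes_eq (T : Fin (n - 1) → ℕ → ℝ) (k : Fin (n - 1)) :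
    swapTimes T k = swapTimesFrom T 1 k := by
  simp only [swapTimes, swapTimesFrom, config_eq]

theorem Regular.pos_of_mem_swapTimesFrom (hT : Regular T) {η : Equiv.Perm (Fin n)}
    {k : Fin (n - 1)} {t : ℝ} (h : t ∈ swapTimesFrom T η k) : 0 < t := by
  have : Nonempty (Fin (n - 1)) := ⟨k⟩
  obtain ⟨κ, hκ⟩ := hT.exists_ringsFirst
  obtain ⟨r, rfl, -⟩ := h
  exact hT.jumpTime_pos hκ r

theorem Regular.mem_swapTimesFrom (hT : Regular T) (hκ : RingsFirst T κ)
    {η : Equiv.Perm (Fin n)} {k : Fin (n - 1)} {t : ℝ} :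
    t ∈ swapTimesFrom T η k ↔ (t = T κ 0 ∧ k = κ ∧ CanSwap η k) ∨
      ∃ u ∈ swapTimesFrom (OrientedSwap.advance T κ) (attempt η κ) k, t = T κ 0 + u := by
  have : Nonempty (Fin (n - 1)) := ⟨κ⟩
  have hT' := hT.advance hκ
  obtain ⟨κ', hκ'⟩ := hT'.exists_ringsFirst
  constructor
  · rintro ⟨r, h1, h2, h3⟩
    cases r with
    | zero =>
      rw [hT.jumpTime_one hκ] at h1
      subst h1
      exact Or.inl ⟨rfl, hT.ringsAt_first.1 h2, h3⟩
    | succ r =>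
      rw [hT.jumpTime_succ hκ] at h1
      rw [h1, ringsAt_add (hT'.jumpTime_pos hκ' r)] at h2
      rw [hT.configFrom_succ hκ] at h3
      exact Or.inr ⟨_, ⟨r, rfl, h2, h3⟩, h1⟩
  · rintro (⟨h1, h2, h3⟩ | ⟨u, ⟨r, h1, h2, h3⟩, h4⟩)
    · exact ⟨0, by rw [h1, hT.jumpTime_one hκ], by rw [h1, hT.ringsAt_first, h2], h3⟩
    · refine ⟨r + 1, by rw [hT.jumpTime_succ hκ, h4, h1], ?_, ?_⟩
      · rw [h4, ringsAt_add (h1 ▸ hT'.jumpTime_pos hκ' r)]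
        exact h2
      · rw [hT.configFrom_succ hκ]
        exact h3

theorem Settled.configFrom {k : Fin (n - 1)} {η : Equiv.Perm (Fin n)} (h : Settled (k + 1) η)
    (T : Fin (n - 1) → ℕ → ℝ) (r : ℕ) : Settled (k + 1) (OrientedSwap.configFrom T η r) := by
  have hfold : ∀ (l : List (Fin (n - 1))) (ξ : Equiv.Perm (Fin n)), Settled (k + 1) ξ →
      Settled (k + 1) (l.foldl OrientedSwap.attempt ξ) := by
    intro l
    induction l with
    | nil => exact fun ξ h => h
    | cons a l ih => exact fun ξ h => ih _ (h.attempt a)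
  induction r with
  | zero => exact h
  | succ r ih => exact hfold _ _ ih

theorem Settled.swapTimesFrom {k : Fin (n - 1)} {η : Equiv.Perm (Fin n)} (h : Settled (k + 1) η)
    (T : Fin (n - 1) → ℕ → ℝ) : swapTimesFrom T η k = ∅ := by
  refine Set.eq_empty_of_forall_notMem ?_
  rintro t ⟨r, -, -, h3⟩
  exact not_canSwap_of_settled (h.configFrom T r) h3

end Realization

/-! ### The first ring of the random clocks -/

section RandomClocks

variable {n : ℕ}

/-- The ring times with waiting times `x`. -/
noncomputable def ringTimes (x : Fin (n - 1) × ℕ → ℝ) (k : Fin (n - 1)) (m : ℕ) : ℝ :=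
  ∑ l ∈ Finset.range (m + 1), x (k, l)

/-- The indices of the first waiting times of the clocks other than `κ`. -/
def otherClocks (κ : Fin (n - 1)) : Finset (Fin (n - 1) × ℕ) := Finset.univ.erase κ ×ˢ {0}

theorem mem_otherClocks {κ : Fin (n - 1)} {p : Fin (n - 1) × ℕ} :
    p ∈ otherClocks κ ↔ p.1 ≠ κ ∧ p.2 = 0 := by
  rw [otherClocks, Finset.mem_product]
  simp

theorem notMem_otherClocks (κ : Fin (n - 1)) : (κ, 0) ∉ otherClocks κ := by
  simp [mem_otherClocks]

theorem card_otherClocks (κ : Fin (n - 1)) : (otherClocks κ).card + 1 = n - 1 := by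
  have := κ.2
  simp only [otherClocks, Finset.card_product, Finset.card_erase_of_mem (Finset.mem_univ κ),
    Finset.card_univ, Fintype.card_fin, Finset.card_singleton]
  omega

/-- Skip the first ring of clock `κ`. -/
def laterRing (κ : Fin (n - 1)) (p : Fin (n - 1) × ℕ) : Fin (n - 1) × ℕ :=
  if p.1 = κ then (p.1, p.2 + 1) else p

theorem laterRing_injective (κ : Fin (n - 1)) : Function.Injective (laterRing κ) := by
  rintro ⟨a, l⟩ ⟨b, m⟩ h
  unfold laterRing at h
  split_ifs at h with h1 h2 h2 <;> simp_all

theorem laterRing_ne (κ : Fin (n - 1)) (p : Fin (n - 1) × ℕ) : laterRing κ p ≠ (κ, 0) := by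
  unfold laterRing
  split_ifs with h
  · simp
  · exact fun e => h (by rw [e])

/-- The waiting times after the first ring, which is a ring of clock `κ`. -/
def nextWaiting (κ : Fin (n - 1)) (x : Fin (n - 1) × ℕ → ℝ) (p : Fin (n - 1) × ℕ) : ℝ :=
  shiftOn (otherClocks κ) (x (κ, 0)) x (laterRing κ p)

theorem measurable_nextWaiting (κ : Fin (n - 1)) : Measurable (nextWaiting κ) :=
  measurable_pi_iff.2 fun p =>
    (measurable_pi_apply (laterRing κ p)).comp (measurable_shiftOn_self (otherClocks κ) (κ, 0))

theorem ringTimes_nextWaiting (κ : Fin (n - 1)) (x : Fin (n - 1) × ℕ → ℝ) :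
    ringTimes (nextWaiting κ x) = advance (ringTimes x) κ := by
  funext k m
  simp only [ringTimes, advance]
  by_cases h : k = κ
  · subst h
    rw [if_pos rfl, Finset.sum_range_succ' (fun l => x (k, l)) (m + 1)]
    simp [nextWaiting, laterRing, shiftOn, mem_otherClocks]
  · rw [if_neg h, Finset.sum_range_succ', Finset.sum_range_succ' (fun l => x (k, l)) m]
    simp [nextWaiting, laterRing, shiftOn, mem_otherClocks, h, add_sub_assoc]

theorem isFirst_otherClocks {κ : Fin (n - 1)} {x : Fin (n - 1) × ℕ → ℝ} :
    IsFirst (otherClocks κ) (κ, 0) x ↔ RingsFirst (ringTimes x) κ := by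
  simp only [IsFirst, RingsFirst, mem_otherClocks, ringTimes, zero_add, Finset.sum_range_one]
  constructor
  · exact fun h k hk => h (k, 0) ⟨hk, rfl⟩
  · rintro h ⟨k, l⟩ ⟨hk, hl⟩
    simp only at hl
    subst hl
    exact h k hk

theorem measurable_ringTimes (k : Fin (n - 1)) (m : ℕ) :
    Measurable fun x : Fin (n - 1) × ℕ → ℝ => ringTimes x k m :=
  Finset.measurable_sum _ fun l _ => measurable_pi_apply (k, l)

theorem ae_regular : ∀ᵐ x ∂expLaw (Fin (n - 1) × ℕ), Regular (ringTimes x) := by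
  have h1 : ∀ᵐ x ∂expLaw (Fin (n - 1) × ℕ), ∀ q : (Fin (n - 1) × Fin (n - 1)) × ℕ × ℕ,
      q.1.1 ≠ q.1.2 → ringTimes x q.1.1 q.2.1 ≠ ringTimes x q.1.2 q.2.2 := by
    rw [ae_all_iff]
    rintro ⟨⟨k, k'⟩, m, m'⟩
    by_cases hk : k = k'
    · exact Filter.Eventually.of_forall fun x h => absurd hk h
    · have := ae_ne_of_update (ι := Fin (n - 1) × ℕ) (k, 0)
        (f := fun x => ringTimes x k' m' - ∑ l ∈ Finset.range m, x (k, l + 1))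
        ((measurable_ringTimes k' m').sub
          (Finset.measurable_sum _ fun l _ => measurable_pi_apply (k, l + 1)))
        (fun x s => by simp [ringTimes, Ne.symm hk])
      filter_upwards [this] with x hx _ e
      apply hx
      simp only [← e]
      rw [ringTimes, Finset.sum_range_succ']
      ring
  filter_upwards [ae_pos_expLaw (ι := Fin (n - 1) × ℕ), h1] with x hpos hne
  refine ⟨fun k => ?_, fun k => strictMono_nat_of_lt_succ fun m => ?_, fun k k' m m' h =>
    hne ((k, k'), m, m') h⟩
  · simpa [ringTimes] using hpos (k, 0)
  · unfold ringTimes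
    rw [Finset.sum_range_succ _ (m + 1)]
    exact lt_add_of_pos_right _ (hpos _)

theorem measurePreserving_laterRing (κ : Fin (n - 1)) :
    MeasurePreserving (fun (x : Fin (n - 1) × ℕ → ℝ) p => x (laterRing κ p)) (expLaw _)
      (expLaw _) :=
  measurePreserving_comp_expLaw (laterRing_injective κ)

theorem comp_laterRing_update (κ : Fin (n - 1)) (x : Fin (n - 1) × ℕ → ℝ) (s : ℝ) :
    (fun p => Function.update x (κ, 0) s (laterRing κ p)) = fun p => x (laterRing κ p) :=
  funext fun p => Function.update_of_ne (laterRing_ne κ p) _ _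

open Classical in
theorem integral_firstRing (κ : Fin (n - 1)) {z : ℂ} (hz : z.re = 0)
    {Ψ : (Fin (n - 1) × ℕ → ℝ) → ℂ} (hΨ : Measurable Ψ) {B : ℝ} (hB : ∀ x, ‖Ψ x‖ ≤ B) :
    ∫ x, (if IsFirst (otherClocks κ) (κ, 0) x then
        Complex.exp (z * x (κ, 0)) * Ψ (nextWaiting κ x) else 0) ∂expLaw (Fin (n - 1) × ℕ) =
      (1 / ((n - 1 : ℕ) - z)) * ∫ x, Ψ x ∂expLaw (Fin (n - 1) × ℕ) := by
  have hmp := measurePreserving_laterRing κ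
  have := integral_isFirst (notMem_otherClocks κ) hz
    (Ψ := fun x => Ψ fun p => x (laterRing κ p)) (hΨ.comp hmp.measurable) (fun x => hB _)
    (fun x s => by rw [comp_laterRing_update])
  have hcard : ((n - 1 : ℕ) : ℂ) = (otherClocks κ).card + 1 := by
    exact_mod_cast (card_otherClocks κ).symm
  have hint : ∫ x, Ψ (fun p => x (laterRing κ p)) ∂expLaw (Fin (n - 1) × ℕ) =
      ∫ x, Ψ x ∂expLaw (Fin (n - 1) × ℕ) := by
    conv_rhs => rw [← hmp.map_eq]
    exact (integral_map hmp.measurable.aemeasurable hΨ.aestronglyMeasurable).symm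
  rw [hcard, ← hint]
  exact this

theorem measureReal_firstRing (κ : Fin (n - 1)) {A : Set (Fin (n - 1) × ℕ → ℝ)}
    (hA : MeasurableSet A) :
    (expLaw (Fin (n - 1) × ℕ)).real {x | IsFirst (otherClocks κ) (κ, 0) x ∧ nextWaiting κ x ∈ A} =
      (expLaw (Fin (n - 1) × ℕ)).real A / (n - 1 : ℕ) := by
  have hmp := measurePreserving_laterRing κ
  have := measureReal_isFirst (notMem_otherClocks κ)
    (A := (fun (x : Fin (n - 1) × ℕ → ℝ) p => x (laterRing κ p)) ⁻¹' A) (hmp.measurable hA)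
    (fun x s => by rw [Set.mem_preimage, Set.mem_preimage, comp_laterRing_update])
  rw [hmp.measureReal_preimage hA.nullMeasurableSet] at this
  have hcard : ((n - 1 : ℕ) : ℝ) = (otherClocks κ).card + 1 := by
    exact_mod_cast (card_otherClocks κ).symm
  rw [hcard]
  exact this

/-- The realizations for which some swap is still to come after `N` rings, starting from `η`. -/
def unsettledAfter : ℕ → Equiv.Perm (Fin n) → Set (Fin (n - 1) × ℕ → ℝ)
  | 0, η => {_x | ∃ k : Fin (n - 1), ¬ Settled (k + 1) η}
  | N + 1, η => ⋃ κ, {x | IsFirst (otherClocks κ) (κ, 0) x ∧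
      nextWaiting κ x ∈ unsettledAfter N (attempt η κ)}

theorem measurableSet_unsettledAfter (N : ℕ) (η : Equiv.Perm (Fin n)) :
    MeasurableSet (unsettledAfter N η) := by
  induction N generalizing η with
  | zero => exact MeasurableSet.const _
  | succ N ih =>
    exact MeasurableSet.iUnion fun κ =>
      (measurableSet_isFirst _ _).inter (measurable_nextWaiting κ (ih _))

theorem unsettledAfter_of_settled {η : Equiv.Perm (Fin n)}
    (h : ∀ k : Fin (n - 1), Settled (k + 1) η) (N : ℕ) : unsettledAfter N η = ∅ := by
  induction N generalizing η with
  | zero => simp [unsettledAfter, h]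
  | succ N ih =>
    simp only [unsettledAfter, ih fun k => (h k).attempt _]
    simp

/-- Each ring swaps two particles with probability at least `1 / (n - 1)`, as long as some swap is
possible, and a swap halves the factor `2 ^ potential η`. -/
theorem measureReal_unsettledAfter_le (N : ℕ) (η : Equiv.Perm (Fin n)) :
    (expLaw (Fin (n - 1) × ℕ)).real (unsettledAfter N η) ≤
      (1 - 1 / (2 * (n - 1 : ℕ))) ^ N * 2 ^ potential η := by
  induction N generalizing η with
  | zero =>
    rw [pow_zero, one_mul]
    exact measureReal_le_one.trans (one_le_pow₀ one_le_two)
  | succ N ih =>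
    by_cases hη : ∀ κ, ¬ CanSwap η κ
    · rw [unsettledAfter_of_settled (fun k => settled_of_forall_not_canSwap hη _),
        measureReal_empty]
      refine mul_nonneg (pow_nonneg ?_ _) (by positivity)
      rw [sub_nonneg]
      rcases Nat.eq_zero_or_pos (n - 1) with h | h
      · simp [h]
      · rw [div_le_one (by positivity)]
        have : (1 : ℝ) ≤ (n - 1 : ℕ) := by exact_mod_cast h
        linarith
    · push Not at hη
      obtain ⟨κ₀, h₀⟩ := hη
      have hn : (0 : ℝ) < (n - 1 : ℕ) := by exact_mod_cast κ₀.pos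
      have hρ : (0 : ℝ) ≤ 1 - 1 / (2 * (n - 1 : ℕ)) := by
        rw [sub_nonneg, div_le_one (by positivity)]
        have : (1 : ℝ) ≤ (n - 1 : ℕ) := by exact_mod_cast κ₀.pos
        linarith
      have hsum : ∑ κ, (2 : ℝ) ^ potential (attempt η κ) ≤
          (n - 1 : ℕ) * 2 ^ potential η - 2 ^ potential η / 2 := by
        have hle : ∀ κ ∈ Finset.univ, (2 : ℝ) ^ potential (attempt η κ) ≤
            2 ^ potential η - if κ = κ₀ then 2 ^ potential η / 2 else 0 := by
          intro κ _
          split_ifs with h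
          · subst h
            have : (2 : ℝ) ^ (potential (attempt η κ) + 1) ≤ 2 ^ potential η :=
              pow_le_pow_right₀ one_le_two (potential_attempt_lt h₀)
            rw [pow_succ] at this
            linarith
          · rw [sub_zero]
            exact pow_le_pow_right₀ one_le_two (potential_attempt_le η κ)
        refine (Finset.sum_le_sum hle).trans (le_of_eq ?_)
        simp [Finset.sum_sub_distrib]
      calc (expLaw (Fin (n - 1) × ℕ)).real (unsettledAfter (N + 1) η)
          ≤ ∑ κ, (expLaw (Fin (n - 1) × ℕ)).real (unsettledAfter N (attempt η κ)) /
              (n - 1 : ℕ) := by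
            refine (measureReal_iUnion_fintype_le _).trans (le_of_eq ?_)
            exact Finset.sum_congr rfl fun κ _ =>
              measureReal_firstRing κ (measurableSet_unsettledAfter N _)
        _ ≤ ∑ κ, ((1 : ℝ) - 1 / (2 * (n - 1 : ℕ))) ^ N * 2 ^ potential (attempt η κ) /
              (n - 1 : ℕ) := by
            gcongr with κ
            exact ih _
        _ = ((1 : ℝ) - 1 / (2 * (n - 1 : ℕ))) ^ N * (∑ κ, (2 : ℝ) ^ potential (attempt η κ)) /
              (n - 1 : ℕ) := by
            rw [Finset.mul_sum, Finset.sum_div]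
        _ ≤ ((1 : ℝ) - 1 / (2 * (n - 1 : ℕ))) ^ N *
              ((n - 1 : ℕ) * 2 ^ potential η - 2 ^ potential η / 2) / (n - 1 : ℕ) := by
            gcongr
        _ = (1 - 1 / (2 * (n - 1 : ℕ))) ^ (N + 1) * 2 ^ potential η := by
            rw [pow_succ]
            field_simp

theorem ae_eventually_settled (η : Equiv.Perm (Fin n)) :
    ∀ᵐ x ∂expLaw (Fin (n - 1) × ℕ), ∀ᶠ N in Filter.atTop, x ∉ unsettledAfter N η := by
  rcases Nat.eq_zero_or_pos (n - 1) with h | h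
  · refine Filter.Eventually.of_forall fun x => Filter.Eventually.of_forall fun N => ?_
    have : IsEmpty (Fin (n - 1)) := by rw [h]; infer_instance
    rw [unsettledAfter_of_settled fun k => isEmptyElim k]
    exact Set.notMem_empty x
  refine ae_eventually_notMem ?_
  have h1 : (1 : ℝ) ≤ (n - 1 : ℕ) := by exact_mod_cast h
  have hs : Summable fun N : ℕ =>
      ((1 - 1 / (2 * (n - 1 : ℕ))) ^ N * 2 ^ potential η : ℝ) := by
    refine (summable_geometric_of_lt_one ?_ ?_).mul_right _
    · rw [sub_nonneg, div_le_one (by positivity)]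
      linarith
    · have : (0 : ℝ) < 1 / (2 * (n - 1 : ℕ)) := by positivity
      linarith
  refine ne_top_of_le_ne_top hs.tsum_ofReal_ne_top (ENNReal.tsum_le_tsum fun N => ?_)
  rw [← ofReal_measureReal]
  exact ENNReal.ofReal_le_ofReal (measureReal_unsettledAfter_le N η)

end RandomClocks

/-! ### The law of the last swap times -/

section LastSwap

variable {n : ℕ}

/-- The vector of last swap times, starting from `η`. -/
noncomputable def lastSwapFrom (T : Fin (n - 1) → ℕ → ℝ) (η : Equiv.Perm (Fin n))
    (k : Fin (n - 1)) : ℝ := sSup (swapTimesFrom T η k)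

theorem lastSwap_eq (T : Fin (n - 1) → ℕ → ℝ) : lastSwap T = lastSwapFrom T 1 := by
  funext k
  rw [lastSwap, lastSwapFrom, swapTimes_eq]

theorem Settled.lastSwapFrom {k : Fin (n - 1)} {η : Equiv.Perm (Fin n)} (h : Settled (k + 1) η)
    (T : Fin (n - 1) → ℕ → ℝ) : lastSwapFrom T η k = 0 := by
  rw [OrientedSwap.lastSwapFrom, h.swapTimesFrom, Real.sSup_empty]

open Classical in
/-- The vector of last swap times, starting from `η`, as a function of the waiting times, computed
from the first `N` rings. -/
noncomputable def lastSwapUpTo : ℕ → Equiv.Perm (Fin n) → (Fin (n - 1) × ℕ → ℝ) →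
    Fin (n - 1) → ℝ
  | 0, _, _, _ => 0
  | N + 1, η, x, k => ∑ κ, if IsFirst (otherClocks κ) (κ, 0) x then
      (if Settled (k + 1) η then 0
        else x (κ, 0) + lastSwapUpTo N (attempt η κ) (nextWaiting κ x) k) else 0

theorem measurable_lastSwapUpTo (N : ℕ) (η : Equiv.Perm (Fin n)) :
    Measurable (lastSwapUpTo N η) := by
  refine measurable_pi_iff.2 fun k => ?_
  induction N generalizing η with
  | zero => exact measurable_const
  | succ N ih =>
    refine Finset.measurable_sum _ fun κ _ =>
      Measurable.ite (measurableSet_isFirst _ _) ?_ measurable_const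
    split_ifs
    · exact measurable_const
    · exact (measurable_pi_apply (κ, 0)).add ((ih (attempt η κ)).comp (measurable_nextWaiting κ))

theorem eq_of_isFirst {κ κ' : Fin (n - 1)} {x : Fin (n - 1) × ℕ → ℝ}
    (h : IsFirst (otherClocks κ) (κ, 0) x) (h' : IsFirst (otherClocks κ') (κ', 0) x) : κ' = κ :=
  (isFirst_otherClocks.1 h').unique (isFirst_otherClocks.1 h)

open Classical in
theorem sum_isFirst {E : Type*} [AddCommMonoid E] {κ : Fin (n - 1)} {x : Fin (n - 1) × ℕ → ℝ}
    (h : IsFirst (otherClocks κ) (κ, 0) x) (f : Fin (n - 1) → E) :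
    ∑ κ', (if IsFirst (otherClocks κ') (κ', 0) x then f κ' else 0) = f κ := by
  rw [Finset.sum_eq_single κ, if_pos h]
  · exact fun κ' _ hne => if_neg fun h' => hne (eq_of_isFirst h h')
  · exact fun h' => absurd (Finset.mem_univ κ) h'

open Classical in
theorem lastSwapUpTo_succ {κ : Fin (n - 1)} {x : Fin (n - 1) × ℕ → ℝ}
    (h : IsFirst (otherClocks κ) (κ, 0) x) (N : ℕ) (η : Equiv.Perm (Fin n)) (k : Fin (n - 1)) :
    lastSwapUpTo (N + 1) η x k = if Settled (k + 1) η then 0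
        else x (κ, 0) + lastSwapUpTo N (attempt η κ) (nextWaiting κ x) k := by
  rw [lastSwapUpTo, sum_isFirst h]

theorem Settled.lastSwapUpTo {k : Fin (n - 1)} {η : Equiv.Perm (Fin n)} (h : Settled (k + 1) η)
    (N : ℕ) (x : Fin (n - 1) × ℕ → ℝ) : lastSwapUpTo N η x k = 0 := by
  cases N with
  | zero => rfl
  | succ N => simp [OrientedSwap.lastSwapUpTo, h]

/-- If all is settled after `N` rings, then the last swap times are computed from these rings. Without
the first part the supremum might have a default value. -/
theorem lastSwapFrom_eq_aux (N : ℕ) : ∀ (η : Equiv.Perm (Fin n)) (x : Fin (n - 1) × ℕ → ℝ),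
    Regular (ringTimes x) → x ∉ unsettledAfter N η → ∀ k : Fin (n - 1),
      (¬ Settled (k + 1) η → (swapTimesFrom (ringTimes x) η k).Nonempty ∧
        BddAbove (swapTimesFrom (ringTimes x) η k)) ∧
      lastSwapFrom (ringTimes x) η k = lastSwapUpTo N η x k := by
  induction N with
  | zero =>
    intro η x _ hx k
    have hs : Settled (k + 1) η := by
      by_contra h
      exact hx ⟨k, h⟩
    exact ⟨fun h => absurd hs h, hs.lastSwapFrom _⟩
  | succ N ih =>
    intro η x hT hx k
    have : Nonempty (Fin (n - 1)) := ⟨k⟩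
    obtain ⟨κ, hκ⟩ := hT.exists_ringsFirst
    have hF := isFirst_otherClocks.2 hκ
    have hx' : nextWaiting κ x ∉ unsettledAfter N (attempt η κ) := fun h =>
      hx (Set.mem_iUnion.2 ⟨κ, hF, h⟩)
    have hT' : Regular (ringTimes (nextWaiting κ x)) := by
      rw [ringTimes_nextWaiting]; exact hT.advance hκ
    obtain ⟨ih1, ih2⟩ := ih _ _ hT' hx' k
    have hτ : ringTimes x κ 0 = x (κ, 0) := by simp [ringTimes]
    rw [lastSwapUpTo_succ hF]
    by_cases hs : Settled (k + 1) η
    · exact ⟨fun h => absurd hs h, by rw [if_pos hs, hs.lastSwapFrom]⟩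
    rw [if_neg hs, ← ih2]
    -- the swap times are those after the first ring, and possibly the first ring itself
    have hmem : ∀ t, t ∈ swapTimesFrom (ringTimes x) η k ↔
        (t = x (κ, 0) ∧ k = κ ∧ CanSwap η k) ∨
          ∃ u ∈ swapTimesFrom (ringTimes (nextWaiting κ x)) (attempt η κ) k,
            t = x (κ, 0) + u := fun t => by
      rw [hT.mem_swapTimesFrom hκ, hτ, ringTimes_nextWaiting]
    by_cases hs' : Settled (k + 1) (attempt η κ)
    · have hk : κ = k := by
        by_contra e
        exact hs ((settled_attempt_of_ne e η).1 hs')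
      have hc : CanSwap η k := by
        by_contra e
        rw [hk, attempt_of_not_canSwap e] at hs'
        exact hs hs'
      have hset : swapTimesFrom (ringTimes x) η k = {x (κ, 0)} := by
        ext t
        rw [hmem, hs'.swapTimesFrom]
        simp [hk, hc]
      rw [lastSwapFrom, hset, hs'.lastSwapFrom, csSup_singleton, add_zero]
      exact ⟨fun _ => ⟨Set.singleton_nonempty _, bddAbove_singleton⟩, rfl⟩
    · obtain ⟨⟨u₀, hu₀⟩, hb⟩ := ih1 hs'
      have hlub := isLUB_csSup ⟨u₀, hu₀⟩ hb
      have hpos : ∀ u ∈ swapTimesFrom (ringTimes (nextWaiting κ x)) (attempt η κ) k, 0 < u :=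
        fun u hu => hT'.pos_of_mem_swapTimesFrom hu
      have hne : (swapTimesFrom (ringTimes x) η k).Nonempty :=
        ⟨_, (hmem _).2 (Or.inr ⟨u₀, hu₀, rfl⟩)⟩
      have hlub' : IsLUB (swapTimesFrom (ringTimes x) η k)
          (x (κ, 0) + lastSwapFrom (ringTimes (nextWaiting κ x)) (attempt η κ) k) := by
        constructor
        · intro t ht
          rcases (hmem t).1 ht with ⟨rfl, -, -⟩ | ⟨u, hu, rfl⟩
          · exact le_add_of_nonneg_right ((hpos _ hu₀).le.trans (hlub.1 hu₀))
          · exact add_le_add_right (hlub.1 hu) _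
        · intro b hb'
          have : lastSwapFrom (ringTimes (nextWaiting κ x)) (attempt η κ) k ≤ b - x (κ, 0) :=
            hlub.2 fun u hu => by
              have := hb' ((hmem _).2 (Or.inr ⟨u, hu, rfl⟩))
              linarith
          linarith
      exact ⟨fun _ => ⟨hne, ⟨_, hlub'.1⟩⟩, hlub'.csSup_eq hne⟩

theorem ae_eventually_lastSwapUpTo (η : Equiv.Perm (Fin n)) :
    ∀ᵐ x ∂expLaw (Fin (n - 1) × ℕ), ∀ᶠ N in Filter.atTop,
      lastSwapUpTo N η x = lastSwapFrom (ringTimes x) η := by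
  filter_upwards [ae_regular, ae_eventually_settled η] with x hT hx
  filter_upwards [hx] with N hN
  funext k
  exact (lastSwapFrom_eq_aux N η x hT hN k).2.symm

theorem aemeasurable_lastSwapFrom (η : Equiv.Perm (Fin n)) :
    AEMeasurable (fun x => lastSwapFrom (ringTimes x) η) (expLaw (Fin (n - 1) × ℕ)) :=
  aemeasurable_of_tendsto_metrizable_ae Filter.atTop
    (fun N => (measurable_lastSwapUpTo N η).aemeasurable)
    ((ae_eventually_lastSwapUpTo η).mono fun _ hx =>
      tendsto_const_nhds.congr' (hx.mono fun _ h => h.symm))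

/-- The character `v ↦ exp (i ⟨θ, v⟩)`. -/
noncomputable def character {m : ℕ} (θ : Fin m → ℝ) (v : Fin m → ℝ) : ℂ :=
  Complex.exp (∑ k, Complex.I * θ k * v k)

theorem norm_character {m : ℕ} (θ v : Fin m → ℝ) : ‖character θ v‖ = 1 := by
  rw [character, Complex.norm_exp, Complex.re_sum]
  simp

theorem continuous_character {m : ℕ} (θ : Fin m → ℝ) : Continuous (character θ) := by
  unfold character
  fun_prop

open Classical in
/-- The characteristic functions of the last swap times starting from the various configurations
satisfy a linear system, obtained by waiting for the first ring. -/
theorem integral_character_lastSwapUpTo (θ : Fin (n - 1) → ℝ) (N : ℕ) (η : Equiv.Perm (Fin n))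
    (hn : 0 < n - 1) :
    ∫ x, character θ (lastSwapUpTo (N + 1) η x) ∂expLaw (Fin (n - 1) × ℕ) =
      (1 / ((n - 1 : ℕ) - ∑ k : Fin (n - 1), if Settled (k + 1) η then 0 else Complex.I * θ k)) *
        ∑ κ, ∫ x, character θ (lastSwapUpTo N (attempt η κ) x) ∂expLaw (Fin (n - 1) × ℕ) := by
  set z : ℂ := ∑ k : Fin (n - 1), if Settled (k + 1) η then 0 else Complex.I * θ k with hz
  have hzre : z.re = 0 := by
    rw [hz, Complex.re_sum]
    refine Finset.sum_eq_zero fun k _ => ?_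
    split_ifs <;> simp
  have hm : ∀ κ, Measurable fun x : Fin (n - 1) × ℕ → ℝ =>
      character θ (lastSwapUpTo N (attempt η κ) x) := fun κ =>
    (continuous_character θ).measurable.comp (measurable_lastSwapUpTo N _)
  have hne : Nonempty (Fin (n - 1)) := ⟨⟨0, hn⟩⟩
  have hae : ∀ᵐ x ∂expLaw (Fin (n - 1) × ℕ), character θ (lastSwapUpTo (N + 1) η x) =
      ∑ κ, (if IsFirst (otherClocks κ) (κ, 0) x then Complex.exp (z * x (κ, 0)) *
        character θ (lastSwapUpTo N (attempt η κ) (nextWaiting κ x)) else 0) := by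
    filter_upwards [ae_regular] with x hT
    obtain ⟨κ, hκ⟩ := hT.exists_ringsFirst
    have hF := isFirst_otherClocks.2 hκ
    rw [sum_isFirst hF, character, character, ← Complex.exp_add, hz, Finset.sum_mul,
      ← Finset.sum_add_distrib]
    refine congrArg Complex.exp (Finset.sum_congr rfl fun k _ => ?_)
    rw [lastSwapUpTo_succ hF]
    split_ifs with hs
    · rw [(hs.attempt κ).lastSwapUpTo]
      simp
    · push_cast
      ring
  rw [integral_congr_ae hae, integral_finsetSum, Finset.mul_sum]
  · exact Finset.sum_congr rfl fun κ _ =>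
      integral_firstRing κ hzre (hm κ) (B := 1) fun x => (norm_character _ _).le
  · intro κ _
    refine Integrable.of_bound (Measurable.aestronglyMeasurable ?_) 1
      (Filter.Eventually.of_forall fun x => ?_)
    · refine Measurable.ite (measurableSet_isFirst _ _) (Measurable.mul ?_ ?_) measurable_const
      · exact Complex.measurable_exp.comp
          (measurable_const.mul (Complex.measurable_ofReal.comp (measurable_pi_apply (κ, 0))))
      · exact (hm κ).comp (measurable_nextWaiting κ)
    · split_ifs
      · rw [norm_mul, norm_character, Complex.norm_exp]
        simp [hzre]
      · simp

/-- The characteristic function of the last swap times, starting from `η`. -/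
noncomputable def charLastSwap (θ : Fin (n - 1) → ℝ) (η : Equiv.Perm (Fin n)) : ℂ :=
  ∫ x, character θ (lastSwapFrom (ringTimes x) η) ∂expLaw (Fin (n - 1) × ℕ)

theorem tendsto_charLastSwap (θ : Fin (n - 1) → ℝ) (η : Equiv.Perm (Fin n)) :
    Filter.Tendsto
      (fun N => ∫ x, character θ (lastSwapUpTo N η x) ∂expLaw (Fin (n - 1) × ℕ)) Filter.atTop
      (nhds (charLastSwap θ η)) := by
  refine tendsto_integral_of_dominated_convergence (fun _ => 1) (fun N => ?_)
    (integrable_const 1) (fun N => Filter.Eventually.of_forall fun x => (norm_character _ _).le) ?_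
  · exact ((continuous_character θ).measurable.comp
      (measurable_lastSwapUpTo N η)).aestronglyMeasurable
  · filter_upwards [ae_eventually_lastSwapUpTo η] with x hx
    exact tendsto_const_nhds.congr' (hx.mono fun N h => congrArg (character θ) h.symm)

open Classical in
/-- The first-step equations for the characteristic functions of the last swap times. -/
theorem charLastSwap_firstStep (θ : Fin (n - 1) → ℝ) (η : Equiv.Perm (Fin n)) :
    ∑ i, (charLastSwap θ (attempt η i) - charLastSwap θ η) =
      (∑ k : Fin (n - 1), if Settled (k + 1) η then 0 else -(Complex.I * θ k)) *
        charLastSwap θ η := by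
  rcases Nat.eq_zero_or_pos (n - 1) with hn | hn
  · have : IsEmpty (Fin (n - 1)) := by rw [hn]; infer_instance
    simp
  set z : ℂ := ∑ k : Fin (n - 1), if Settled (k + 1) η then 0 else Complex.I * θ k with hz
  have hzre : z.re = 0 := by
    rw [hz, Complex.re_sum]
    refine Finset.sum_eq_zero fun k _ => ?_
    split_ifs <;> simp
  have hne : ((n - 1 : ℕ) : ℂ) - z ≠ 0 := fun h => by
    have := congrArg Complex.re h
    rw [Complex.sub_re, hzre, Complex.natCast_re] at this
    simp at this
    omega
  have hneg : (∑ k : Fin (n - 1), if Settled (k + 1) η then 0 else -(Complex.I * θ k)) = -z := by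
    rw [hz, ← Finset.sum_neg_distrib]
    refine Finset.sum_congr rfl fun k _ => ?_
    split_ifs <;> simp
  have h1 := (tendsto_charLastSwap θ η).comp (Filter.tendsto_add_atTop_nat 1)
  have h2 := (tendsto_finsetSum Finset.univ fun κ _ =>
    tendsto_charLastSwap θ (attempt η κ)).const_mul (1 / (((n - 1 : ℕ) : ℂ) - z))
  have h3 := tendsto_nhds_unique h1
    (h2.congr fun N => (integral_character_lastSwapUpTo θ N η hn).symm)
  rw [Finset.sum_sub_distrib, hneg, Finset.sum_const, Finset.card_univ, Fintype.card_fin,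
    nsmul_eq_mul]
  have h4 : ∑ κ, charLastSwap θ (attempt η κ) = (((n - 1 : ℕ) : ℂ) - z) * charLastSwap θ η := by
    rw [h3]; field_simp
  rw [h4]
  ring

theorem charLastSwap_of_settled (θ : Fin (n - 1) → ℝ) {η : Equiv.Perm (Fin n)}
    (h : ∀ k : Fin (n - 1), Settled (k + 1) η) : charLastSwap θ η = 1 := by
  have : ∀ x : Fin (n - 1) × ℕ → ℝ, character θ (lastSwapFrom (ringTimes x) η) = 1 := fun x => by
    simp [character, (h _).lastSwapFrom]
  simp [charLastSwap, this]

end LastSwap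

/-! ### Last passage times after some boxes have been emptied -/

section LastPassage

/-- The last passage time from `(1, 1)` to `(i, j)`, where the environment is set to `0` in the
boxes of the diagram with row lengths `r` (whose box in row `i` and column `j`, counted from `0`, is
the point `(i + 1, j + 1)`), by recursion on the last step. It vanishes on the diagram and outside
of the quadrant. -/
noncomputable def passage (r : ℕ → ℕ) (x : ℕ × ℕ → ℝ) : ℕ → ℕ → ℝ
  | 0, _ => 0
  | _ + 1, 0 => 0
  | i + 1, j + 1 => if j < r i then 0 else
      x (i + 1, j + 1) + max (passage r x i (j + 1)) (passage r x (i + 1) j)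
termination_by i j => i + j

variable {r : ℕ → ℕ} {x : ℕ × ℕ → ℝ}

theorem passage_zero_left (j : ℕ) : passage r x 0 j = 0 := by rw [passage]

theorem passage_zero_right (i : ℕ) : passage r x i 0 = 0 := by cases i <;> rw [passage]

theorem passage_of_lt {i j : ℕ} (h : j < r i) : passage r x (i + 1) (j + 1) = 0 := by
  rw [passage, if_pos h]

theorem passage_of_le {i j : ℕ} (h : r i ≤ j) : passage r x (i + 1) (j + 1) =
    x (i + 1, j + 1) + max (passage r x i (j + 1)) (passage r x (i + 1) j) := by
  rw [passage, if_neg (not_lt.2 h)]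

/-- Induction on the distance of a point of the grid to the origin. -/
theorem grid_induction {P : ℕ → ℕ → Prop} (h0 : ∀ j, P 0 j) (h1 : ∀ i, P (i + 1) 0)
    (h : ∀ i j, P i (j + 1) → P (i + 1) j → P (i + 1) (j + 1)) (i j : ℕ) : P i j := by
  have : ∀ m i j, i + j ≤ m → P i j := by
    intro m
    induction m with
    | zero =>
      intro i j hij
      rw [show i = 0 by omega]
      exact h0 j
    | succ m ih =>
      intro i j hij
      match i, j with
      | 0, j => exact h0 j
      | i + 1, 0 => exact h1 i
      | i + 1, j + 1 => exact h i j (ih _ _ (by omega)) (ih _ _ (by omega))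
  exact this _ i j le_rfl

theorem passage_nonneg (hx : ∀ p, 0 ≤ x p) (i j : ℕ) : 0 ≤ passage r x i j := by
  induction i, j using grid_induction with
  | h0 j => rw [passage_zero_left]
  | h1 i => rw [passage_zero_right]
  | h i j h1 h2 =>
    rcases lt_or_ge j (r i) with h | h
    · rw [passage_of_lt h]
    · rw [passage_of_le h]
      exact add_nonneg (hx _) (h1.trans (le_max_left _ _))

theorem passage_update {a b : ℕ} (h : b < r a) (x : ℕ × ℕ → ℝ) (s : ℝ) (i j : ℕ) :
    passage r (Function.update x (a + 1, b + 1) s) i j = passage r x i j := by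
  induction i, j using grid_induction with
  | h0 j => rw [passage_zero_left, passage_zero_left]
  | h1 i => rw [passage_zero_right, passage_zero_right]
  | h i j h1 h2 =>
    rcases lt_or_ge j (r i) with h' | h'
    · rw [passage_of_lt h', passage_of_lt h']
    · rw [passage_of_le h', passage_of_le h', h1, h2, Function.update_of_ne]
      intro e
      simp only [Prod.mk.injEq, Nat.add_right_cancel_iff] at e
      rw [e.1, e.2] at h'
      omega

theorem measurable_passage (r : ℕ → ℕ) (i j : ℕ) : Measurable fun x => passage r x i j := by
  induction i, j using grid_induction with
  | h0 j => simp only [passage_zero_left]; exact measurable_const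
  | h1 i => simp only [passage_zero_right]; exact measurable_const
  | h i j h1 h2 =>
    rcases lt_or_ge j (r i) with h | h
    · simp only [passage_of_lt h]; exact measurable_const
    · simp only [passage_of_le h]
      exact (measurable_pi_apply (i + 1, j + 1)).add (h1.max h2)

/-! ### Directed lattice paths -/

theorem gridDist_one_one (i j : ℕ) : gridDist (1, 1) (i + 1, j + 1) = i + j := by
  simp [gridDist, Nat.dist]

theorem gridDist_eq_one_iff {p q : ℕ × ℕ} : gridDist p q = 1 ↔
    (p.1 = q.1 ∧ (p.2 + 1 = q.2 ∨ q.2 + 1 = p.2)) ∨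
      (p.2 = q.2 ∧ (p.1 + 1 = q.1 ∨ q.1 + 1 = p.1)) := by
  simp only [gridDist, Nat.dist]
  omega

/-- A path with `m` unit steps that ends at distance `m` from its origin only goes up and right, so
that its weight is bounded by the recursion on the last step. -/
theorem path_sum_le {γ : ℕ → ℕ × ℕ} (h0 : γ 0 = (1, 1)) (m : ℕ)
    (hstep : ∀ k < m, gridDist (γ k) (γ (k + 1)) = 1) :
    (γ m).1 + (γ m).2 ≤ m + 2 ∧ ((γ m).1 + (γ m).2 = m + 2 → 1 ≤ (γ m).1 ∧ 1 ≤ (γ m).2 ∧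
      ∑ k ∈ Finset.range (m + 1), x (γ k) ≤ passage (fun _ => 0) x (γ m).1 (γ m).2) := by
  induction m with
  | zero =>
    rw [h0]
    refine ⟨le_rfl, fun _ => ⟨le_rfl, le_rfl, ?_⟩⟩
    rw [zero_add, Finset.sum_range_one, h0]
    simp only
    rw [← zero_add 1, passage_of_le (Nat.zero_le _), passage_zero_left, zero_add]
    simp [passage_zero_right]
  | succ m ih =>
    obtain ⟨ih1, ih2⟩ := ih fun k hk => hstep k (by omega)
    have hs := gridDist_eq_one_iff.1 (hstep m (by omega))
    refine ⟨by omega, fun hm => ?_⟩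
    obtain ⟨h1, h2, h3⟩ := ih2 (by omega)
    obtain ⟨a, ha⟩ : ∃ a, (γ (m + 1)).1 = a + 1 := ⟨(γ (m + 1)).1 - 1, by omega⟩
    obtain ⟨b, hb⟩ : ∃ b, (γ (m + 1)).2 = b + 1 := ⟨(γ (m + 1)).2 - 1, by omega⟩
    refine ⟨by omega, by omega, ?_⟩
    have hp : γ (m + 1) = (a + 1, b + 1) := Prod.ext ha hb
    rw [Finset.sum_range_succ, hp]
    simp only
    rw [passage_of_le (Nat.zero_le _), add_comm]
    refine add_le_add_right (h3.trans ?_) _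
    rcases hs with ⟨e1, e2⟩ | ⟨e1, e2⟩
    · rw [e1, ha, show (γ m).2 = b by omega]
      exact le_max_right _ _
    · rw [e1, hb, show (γ m).1 = a by omega]
      exact le_max_left _ _

/-- The recursion on the last step is attained by a path. -/
theorem exists_path (hx : ∀ p, 0 ≤ x p) (i j : ℕ) : ∃ γ : ℕ → ℕ × ℕ, γ 0 = (1, 1) ∧
    γ (i + j) = (i + 1, j + 1) ∧ (∀ k < i + j, gridDist (γ k) (γ (k + 1)) = 1) ∧
    ∑ k ∈ Finset.range (i + j + 1), x (γ k) = passage (fun _ => 0) x (i + 1) (j + 1) := by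
  have hext : ∀ m (γ : ℕ → ℕ × ℕ) (p : ℕ × ℕ), γ 0 = (1, 1) →
      (∀ k < m, gridDist (γ k) (γ (k + 1)) = 1) → gridDist (γ m) p = 1 →
      ∃ γ' : ℕ → ℕ × ℕ, γ' 0 = (1, 1) ∧ γ' (m + 1) = p ∧
        (∀ k < m + 1, gridDist (γ' k) (γ' (k + 1)) = 1) ∧
        ∑ k ∈ Finset.range (m + 1 + 1), x (γ' k) = x p + ∑ k ∈ Finset.range (m + 1), x (γ k) := by
    intro m γ p h0 hs hp
    have hlt : ∀ k < m + 1, Function.update γ (m + 1) p k = γ k := fun k hk =>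
      Function.update_of_ne (by omega) _ _
    refine ⟨Function.update γ (m + 1) p, by rw [hlt 0 (by omega), h0], Function.update_self _ _ _,
      fun k hk => ?_, ?_⟩
    · rw [hlt k hk]
      rcases Nat.lt_or_ge k m with h | h
      · rw [hlt _ (by omega)]
        exact hs k h
      · rw [show k = m by omega, Function.update_self]
        exact hp
    · rw [Finset.sum_range_succ, Function.update_self, add_comm]
      congr 1
      exact Finset.sum_congr rfl fun k hk => by rw [hlt k (Finset.mem_range.1 hk)]
  have main : ∀ m i j, i + j = m → ∃ γ : ℕ → ℕ × ℕ, γ 0 = (1, 1) ∧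
    γ m = (i + 1, j + 1) ∧ (∀ k < m, gridDist (γ k) (γ (k + 1)) = 1) ∧
    ∑ k ∈ Finset.range (m + 1), x (γ k) = passage (fun _ => 0) x (i + 1) (j + 1) := by
    intro m
    induction m with
    | zero =>
      intro i j hij
      obtain ⟨rfl, rfl⟩ : i = 0 ∧ j = 0 := by omega
      refine ⟨fun _ => (1, 1), rfl, rfl, by simp, ?_⟩
      rw [passage_of_le (Nat.zero_le _), passage_zero_left, passage_zero_right]
      simp
    | succ m ih =>
      intro i j hij
      rw [passage_of_le (Nat.zero_le _)]
      have hup : ∀ i', i = i' + 1 → ∃ γ : ℕ → ℕ × ℕ, γ 0 = (1, 1) ∧ γ (m + 1) = (i + 1, j + 1) ∧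
          (∀ k < m + 1, gridDist (γ k) (γ (k + 1)) = 1) ∧
          ∑ k ∈ Finset.range (m + 1 + 1), x (γ k) =
            x (i + 1, j + 1) + passage (fun _ => 0) x i (j + 1) := by
        rintro i' rfl
        obtain ⟨γ, g0, g1, g2, g3⟩ := ih i' j (by omega)
        rw [← g3]
        exact hext m γ _ g0 g2 (by rw [g1]; exact gridDist_eq_one_iff.2 (by simp))
      have hleft : ∀ j', j = j' + 1 → ∃ γ : ℕ → ℕ × ℕ, γ 0 = (1, 1) ∧ γ (m + 1) = (i + 1, j + 1) ∧
          (∀ k < m + 1, gridDist (γ k) (γ (k + 1)) = 1) ∧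
          ∑ k ∈ Finset.range (m + 1 + 1), x (γ k) =
            x (i + 1, j + 1) + passage (fun _ => 0) x (i + 1) j := by
        rintro j' rfl
        obtain ⟨γ, g0, g1, g2, g3⟩ := ih i j' (by omega)
        rw [← g3]
        exact hext m γ _ g0 g2 (by rw [g1]; exact gridDist_eq_one_iff.2 (by simp))
      rcases le_total (passage (fun _ => 0) x i (j + 1)) (passage (fun _ => 0) x (i + 1) j) with
        h | h
      · rw [max_eq_right h]
        match j with
        | j' + 1 => exact hleft j' rfl
        | 0 =>
          rw [passage_zero_right] at h ⊢
          rw [← le_antisymm h (passage_nonneg hx _ _)]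
          exact hup (i - 1) (by omega)
      · rw [max_eq_left h]
        match i with
        | i' + 1 => exact hup i' rfl
        | 0 =>
          rw [passage_zero_left] at h ⊢
          rw [← le_antisymm h (passage_nonneg hx _ _)]
          exact hleft (j - 1) (by omega)
  exact main _ i j rfl

theorem lpp_eq_passage (hx : ∀ p, 0 ≤ x p) (i j : ℕ) :
    lpp x (1, 1) (i + 1, j + 1) = passage (fun _ => 0) x (i + 1) (j + 1) := by
  refine IsGreatest.csSup_eq ⟨?_, ?_⟩
  · obtain ⟨γ, h0, h1, h2, h3⟩ := exists_path hx i j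
    refine ⟨γ, ⟨h0, ?_, ?_⟩, ?_⟩
    · rw [gridDist_one_one]; exact h1
    · rw [gridDist_one_one]; exact h2
    · rw [gridDist_one_one]; exact h3.symm
  · rintro s ⟨γ, ⟨h0, h1, h2⟩, rfl⟩
    rw [gridDist_one_one] at h1 h2 ⊢
    have := (path_sum_le (x := x) h0 _ h2).2 (by rw [h1]; simp only; omega)
    rw [h1] at this
    exact this.2.2

end LastPassage

/-! ### The law of the last passage times -/

section LastPassageLaw

variable {n : ℕ} {r : ℕ → ℕ}

/-- The point of the quadrant at which a box is added to row `i` of the diagram. -/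
def cornerPoint (r : ℕ → ℕ) (i : ℕ) : ℕ × ℕ := (i + 1, r i + 1)

theorem cornerPoint_injective (r : ℕ → ℕ) : Function.Injective (cornerPoint r) := fun _ _ h =>
  Nat.succ_injective (congrArg Prod.fst h)

open Classical in
/-- The points at which a box may be added to a row of the diagram other than row `i`. -/
noncomputable def otherCorners (n : ℕ) (r : ℕ → ℕ) (i : ℕ) : Finset (ℕ × ℕ) :=
  (((Finset.univ : Finset (Fin (n - 1))).filter fun j : Fin (n - 1) => Addable n r j ∧ (j : ℕ) ≠ i).image
    fun j : Fin (n - 1) => cornerPoint r j)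

theorem mem_otherCorners {i : ℕ} {p : ℕ × ℕ} :
    p ∈ otherCorners n r i ↔ ∃ j, Addable n r j ∧ j ≠ i ∧ cornerPoint r j = p := by
  simp only [otherCorners, Finset.mem_image, Finset.mem_filter, Finset.mem_univ, true_and]
  constructor
  · rintro ⟨j, ⟨h1, h2⟩, h3⟩
    exact ⟨j, h1, h2, h3⟩
  · rintro ⟨j, h1, h2, h3⟩
    have := h1.1
    exact ⟨⟨j, by omega⟩, ⟨h1, h2⟩, h3⟩

theorem cornerPoint_notMem (n : ℕ) (r : ℕ → ℕ) (i : ℕ) : cornerPoint r i ∉ otherCorners n r i := by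
  rw [mem_otherCorners]
  rintro ⟨j, -, h2, h3⟩
  exact h2 (cornerPoint_injective r h3)

open Classical in
theorem card_otherCorners {i : Fin (n - 1)} (hi : Addable n r i) :
    (otherCorners n r i).card + 1 =
      ((Finset.univ : Finset (Fin (n - 1))).filter fun j : Fin (n - 1) => Addable n r j).card := by
  rw [otherCorners, Finset.card_image_of_injective _ fun a b h =>
    Fin.ext (cornerPoint_injective r h)]
  have : ((Finset.univ : Finset (Fin (n - 1))).filter fun j : Fin (n - 1) => Addable n r j ∧ (j : ℕ) ≠ i) =
      ((Finset.univ : Finset (Fin (n - 1))).filter fun j : Fin (n - 1) => Addable n r j).erase i := by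
    ext j
    simp only [Finset.mem_filter, Finset.mem_univ, true_and, Finset.mem_erase, ne_eq, Fin.ext_iff]
    tauto
  rw [this, Finset.card_erase_add_one]
  simpa using hi

/-- The first corner of the growing environment to be filled contributes its waiting time to all the
last passage times outside of the diagram. -/
theorem passage_addBox {x : ℕ × ℕ → ℝ} (hr : IsShape n r) (hx : ∀ p, 0 < x p) {i₀ : ℕ}
    (hi₀ : Addable n r i₀) (hF : IsFirst (otherCorners n r i₀) (cornerPoint r i₀) x) (i j : ℕ)
    (hj : r i ≤ j) (hij : j < n - 1 - i) :
    passage r x (i + 1) (j + 1) = x (cornerPoint r i₀) + passage (addBox r i₀)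
      (shiftOn (otherCorners n r i₀) (x (cornerPoint r i₀)) x) (i + 1) (j + 1) := by
  set s := x (cornerPoint r i₀) with hs
  set x' := shiftOn (otherCorners n r i₀) s x with hx'
  have hs0 : 0 < s := hx _
  have hx'0 : ∀ p, 0 ≤ x' p := fun p => by
    simp only [hx', shiftOn]
    split_ifs with h
    · exact sub_nonneg.2 (hF p h).le
    · exact (hx p).le
  have hle : ∀ a, r a ≤ addBox r i₀ a := fun a => by
    simp only [addBox, Function.update_apply]
    split_ifs with h
    · rw [h]; omega
    · exact le_rfl
  have hadd : ∀ a, a ≠ i₀ → addBox r i₀ a = r a := fun a h => Function.update_of_ne h _ _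
  have hadd' : addBox r i₀ i₀ = r i₀ + 1 := Function.update_self _ _ _
  -- on the diagram and on the boundary, both passage times vanish
  have hzero_up : ∀ a b, (∀ a', a = a' + 1 → b < r a') →
      passage r x a (b + 1) = 0 ∧ passage (addBox r i₀) x' a (b + 1) = 0 := by
    intro a b h
    match a with
    | 0 => exact ⟨passage_zero_left _, passage_zero_left _⟩
    | a' + 1 =>
      have := h a' rfl
      exact ⟨passage_of_lt this, passage_of_lt (this.trans_le (hle a'))⟩
  have hzero_left : ∀ a b, (∀ b', b = b' + 1 → b' < r a) →
      passage r x (a + 1) b = 0 ∧ passage (addBox r i₀) x' (a + 1) b = 0 := by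
    intro a b h
    match b with
    | 0 => exact ⟨passage_zero_right _, passage_zero_right _⟩
    | b' + 1 =>
      have := h b' rfl
      exact ⟨passage_of_lt this, passage_of_lt (this.trans_le (hle a))⟩
  have main : ∀ m i j, i + j = m → r i ≤ j → j < n - 1 - i →
      passage r x (i + 1) (j + 1) = s + passage (addBox r i₀) x' (i + 1) (j + 1) := by
    intro m
    induction m with
    | zero =>
      intro i j hm hj hij
      obtain ⟨rfl, rfl⟩ : i = 0 ∧ j = 0 := by omega
      have h0 : 0 = i₀ := by
        by_contra h
        have := hi₀.2 0 (by omega)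
        omega
      subst h0
      rw [passage_of_le hj, passage_zero_left, passage_zero_right, passage_of_lt (by rw [hadd']; omega),
        max_self, hs, cornerPoint, show r 0 = 0 by omega]
    | succ m ih =>
      intro i j hm hj hij
      by_cases hadd_ij : j = r i ∧ ∀ i' < i, r i < r i'
      · obtain ⟨rfl, hlt⟩ := hadd_ij
        have hup := hzero_up i (r i) fun a' ha => by rw [ha] at hlt ⊢; exact hlt a' (by omega)
        have hleft := hzero_left i (r i) fun b' hb => by omega
        rw [passage_of_le le_rfl, hup.1, hleft.1, max_self, add_zero]
        by_cases hi : i = i₀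
        · subst hi
          rw [passage_of_lt (by rw [hadd']; omega), add_zero]
          rfl
        · rw [passage_of_le (by rw [hadd i hi]), hup.2, hleft.2, max_self, add_zero]
          have : (i + 1, r i + 1) ∈ otherCorners n r i₀ := mem_otherCorners.2 ⟨i, ⟨hij, hlt⟩, hi, rfl⟩
          simp only [hx', shiftOn, if_pos this]
          ring
      · have hnotadd : ∀ a, Addable n r a → cornerPoint r a ≠ (i + 1, j + 1) := by
          intro a ha e
          simp only [cornerPoint, Prod.mk.injEq, Nat.add_right_cancel_iff] at e
          obtain ⟨rfl, rfl⟩ := e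
          exact hadd_ij ⟨rfl, ha.2⟩
        have hx'ij : x' (i + 1, j + 1) = x (i + 1, j + 1) := by
          simp only [hx', shiftOn]
          rw [if_neg]
          rw [mem_otherCorners]
          rintro ⟨a, ha, -, e⟩
          exact hnotadd a ha e
        have hle' : addBox r i₀ i ≤ j := by
          by_cases hi : i = i₀
          · subst hi
            rw [hadd']
            by_contra h
            exact hadd_ij ⟨by omega, hi₀.2⟩
          · rw [hadd i hi]; exact hj
        rw [passage_of_le hj, passage_of_le hle', hx'ij]
        have hU : ∀ a', i = a' + 1 → r a' ≤ j → passage r x i (j + 1) =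
            s + passage (addBox r i₀) x' i (j + 1) := by
          rintro a' rfl h
          exact ih a' j (by omega) h (by omega)
        have hL : ∀ b', j = b' + 1 → r i ≤ b' → passage r x (i + 1) j =
            s + passage (addBox r i₀) x' (i + 1) j := by
          rintro b' rfl h
          exact ih i b' (by omega) h (by omega)
        have hU0 := passage_nonneg (r := addBox r i₀) hx'0 i (j + 1)
        have hL0 := passage_nonneg (r := addBox r i₀) hx'0 (i + 1) j
        suffices h : max (passage r x i (j + 1)) (passage r x (i + 1) j) =
            s + max (passage (addBox r i₀) x' i (j + 1)) (passage (addBox r i₀) x' (i + 1) j) by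
          rw [h]; ring
        by_cases hu : ∃ a', i = a' + 1 ∧ r a' ≤ j
        · obtain ⟨a', ha, ha'⟩ := hu
          rw [hU a' ha ha']
          by_cases hl : ∃ b', j = b' + 1 ∧ r i ≤ b'
          · obtain ⟨b', hb, hb'⟩ := hl
            rw [hL b' hb hb', max_add_add_left]
          · push Not at hl
            have h0 := hzero_left i j hl
            rw [h0.1, h0.2, max_eq_left hU0, max_eq_left (by linarith)]
        · push Not at hu
          have h0 := hzero_up i j hu
          -- the box is not a corner, so that its left neighbour is not in the diagram
          have hri : r i < j := by
            refine lt_of_le_of_ne hj fun e => hadd_ij ⟨e.symm, fun i' hi' => ?_⟩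
            have h1 := hu (i - 1) (by omega)
            have h2 := hr.antitone (show i' ≤ i - 1 by omega)
            omega
          rw [hL (j - 1) (by omega) (by omega), h0.1, h0.2, max_eq_right hL0,
            max_eq_right (by linarith)]
  exact main _ i j rfl hj hij

/-- The last passage times to the points of the antidiagonal. -/
noncomputable def passageVector (n : ℕ) (r : ℕ → ℕ) (x : ℕ × ℕ → ℝ) (k : Fin (n - 1)) : ℝ :=
  passage r x (n - (k + 1)) (k + 1)

theorem measurable_passageVector (n : ℕ) (r : ℕ → ℕ) : Measurable (passageVector n r) :=
  measurable_pi_iff.2 fun k => measurable_passage r (n - (k + 1)) (k + 1)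

theorem passageVector_of_le {k : Fin (n - 1)} (h : (k : ℕ) + 1 ≤ r (n - (k + 1) - 1))
    (x : ℕ × ℕ → ℝ) : passageVector n r x k = 0 := by
  have hk := k.2
  obtain ⟨a, ha⟩ : ∃ a, n - ((k : ℕ) + 1) = a + 1 := ⟨n - (k + 1) - 1, by omega⟩
  rw [ha, Nat.add_sub_cancel] at h
  rw [passageVector, ha, passage_of_lt (by omega)]

theorem passageVector_addBox {x : ℕ × ℕ → ℝ} (hr : IsShape n r) (hx : ∀ p, 0 < x p) {i₀ : ℕ}
    (hi₀ : Addable n r i₀) (hF : IsFirst (otherCorners n r i₀) (cornerPoint r i₀) x)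
    {k : Fin (n - 1)} (h : ¬ (k : ℕ) + 1 ≤ r (n - (k + 1) - 1)) :
    passageVector n r x k = x (cornerPoint r i₀) + passageVector n (addBox r i₀)
      (shiftOn (otherCorners n r i₀) (x (cornerPoint r i₀)) x) k := by
  have hk := k.2
  obtain ⟨a, ha⟩ : ∃ a, n - ((k : ℕ) + 1) = a + 1 := ⟨n - (k + 1) - 1, by omega⟩
  rw [ha, Nat.add_sub_cancel] at h
  rw [passageVector, passageVector, ha]
  exact passage_addBox hr hx hi₀ hF a k (by omega) (by omega)

theorem ae_injective : ∀ᵐ x ∂expLaw (ℕ × ℕ), Function.Injective x := by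
  have : ∀ᵐ x ∂expLaw (ℕ × ℕ), ∀ q : (ℕ × ℕ) × (ℕ × ℕ), q.1 ≠ q.2 → x q.1 ≠ x q.2 := by
    rw [ae_all_iff]
    rintro ⟨p, q⟩
    by_cases h : p = q
    · exact Filter.Eventually.of_forall fun x h' => absurd h h'
    · exact (ae_ne_of_update p (measurable_pi_apply q) fun x s =>
        Function.update_of_ne (Ne.symm h) _ _).mono fun x hx _ => hx
  filter_upwards [this] with x hx p q e
  by_contra h
  exact hx (p, q) h e

/-- If there are no ties, then one of the corners is filled first. -/
theorem exists_isFirst_corner {x : ℕ × ℕ → ℝ} (hx : Function.Injective x) {i : Fin (n - 1)}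
    (hi : Addable n r i) : ∃ i₀ : Fin (n - 1), Addable n r i₀ ∧
      IsFirst (otherCorners n r i₀) (cornerPoint r i₀) x := by
  classical
  obtain ⟨i₀, h1, h2⟩ := Finset.exists_min_image
    ((Finset.univ : Finset (Fin (n - 1))).filter fun j : Fin (n - 1) => Addable n r j)
    (fun j => x (cornerPoint r j)) ⟨i, by simpa using hi⟩
  simp only [Finset.mem_filter, Finset.mem_univ, true_and] at h1 h2
  refine ⟨i₀, h1, fun p hp => ?_⟩
  obtain ⟨j, hj, hne, rfl⟩ := mem_otherCorners.1 hp
  have hlt := hj.1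
  exact lt_of_le_of_ne (h2 ⟨j, by omega⟩ hj) fun e => hne (cornerPoint_injective r (hx e)).symm

open Classical in
theorem sum_isFirst_corner {E : Type*} [AddCommMonoid E] {x : ℕ × ℕ → ℝ} {i₀ : Fin (n - 1)}
    (hi₀ : Addable n r i₀) (hF : IsFirst (otherCorners n r i₀) (cornerPoint r i₀) x)
    (f : Fin (n - 1) → E) : ∑ i : Fin (n - 1), (if Addable n r i then
      (if IsFirst (otherCorners n r i) (cornerPoint r i) x then f i else 0) else 0) = f i₀ := by
  rw [Finset.sum_eq_single i₀, if_pos hi₀, if_pos hF]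
  · intro i _ hne
    have hne' : (i : ℕ) ≠ i₀ := fun e => hne (Fin.ext e)
    split_ifs with h1 h2
    · exact absurd (hF _ (mem_otherCorners.2 ⟨i, h1, hne', rfl⟩))
        (lt_asymm (h2 _ (mem_otherCorners.2 ⟨i₀, hi₀, hne'.symm, rfl⟩)))
    · rfl
    · rfl
  · exact fun h => absurd (Finset.mem_univ _) h

/-- The characteristic function of the last passage times after the boxes of a diagram have been
emptied. -/
noncomputable def charPassage (θ : Fin (n - 1) → ℝ) (r : ℕ → ℕ) : ℂ :=
  ∫ x, character θ (passageVector n r x) ∂expLaw (ℕ × ℕ)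

open Classical in
/-- The characteristic functions of the last passage times satisfy a linear system, obtained by
waiting for the first corner to be filled. -/
theorem charPassage_firstStep (θ : Fin (n - 1) → ℝ) (hr : IsShape n r) :
    (∑ i : Fin (n - 1), if Addable n r i then charPassage θ (addBox r i) - charPassage θ r
      else 0) =
      (∑ k : Fin (n - 1), if (k : ℕ) + 1 ≤ r (n - (k + 1) - 1) then 0 else -(Complex.I * θ k)) *
        charPassage θ r := by
  set z : ℂ := ∑ k : Fin (n - 1), if (k : ℕ) + 1 ≤ r (n - (k + 1) - 1) then 0
    else Complex.I * θ k with hz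
  have hzre : z.re = 0 := by
    rw [hz, Complex.re_sum]
    refine Finset.sum_eq_zero fun k _ => ?_
    split_ifs <;> simp
  have hneg : (∑ k : Fin (n - 1), if (k : ℕ) + 1 ≤ r (n - (k + 1) - 1) then 0
      else -(Complex.I * θ k)) = -z := by
    rw [hz, ← Finset.sum_neg_distrib]
    refine Finset.sum_congr rfl fun k _ => ?_
    split_ifs <;> simp
  rw [hneg]
  by_cases hex : ∃ i : Fin (n - 1), Addable n r i
  swap
  · push Not at hex
    have hz0 : z = 0 := by
      rw [hz]
      refine Finset.sum_eq_zero fun k _ => if_pos ?_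
      by_contra h
      obtain ⟨i, hi⟩ := exists_addable h
      exact hex i hi
    rw [hz0, neg_zero, zero_mul]
    exact Finset.sum_eq_zero fun i _ => if_neg (hex i)
  obtain ⟨j, hj⟩ := hex
  set C := (Finset.univ : Finset (Fin (n - 1))).filter fun j : Fin (n - 1) => Addable n r j with hC
  have hCpos : 0 < C.card := Finset.card_pos.2 ⟨j, by simpa [hC] using hj⟩
  have hne : (C.card : ℂ) - z ≠ 0 := fun h => by
    have := congrArg Complex.re h
    rw [Complex.sub_re, hzre, Complex.natCast_re, sub_zero, Complex.zero_re,
      Nat.cast_eq_zero] at this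
    omega
  have hm : ∀ r', Measurable fun x : ℕ × ℕ → ℝ => character θ (passageVector n r' x) := fun r' =>
    (continuous_character θ).measurable.comp (measurable_passageVector n r')
  set F : Fin (n - 1) → (ℕ × ℕ → ℝ) → ℂ := fun i x =>
    if IsFirst (otherCorners n r i) (cornerPoint r i) x then
      Complex.exp (z * x (cornerPoint r i)) * character θ (passageVector n (addBox r i)
        (shiftOn (otherCorners n r i) (x (cornerPoint r i)) x)) else 0 with hFdef
  have hFint : ∀ i, Integrable (F i) (expLaw (ℕ × ℕ)) := by
    intro i
    refine Integrable.of_bound (Measurable.aestronglyMeasurable ?_) 1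
      (Filter.Eventually.of_forall fun x => ?_)
    · refine Measurable.ite (measurableSet_isFirst _ _) (Measurable.mul ?_ ?_) measurable_const
      · exact Complex.measurable_exp.comp
          (measurable_const.mul (Complex.measurable_ofReal.comp (measurable_pi_apply _)))
      · exact (hm _).comp (measurable_shiftOn_self _ _)
    · simp only [hFdef]
      split_ifs
      · rw [norm_mul, norm_character, Complex.norm_exp]
        simp [hzre]
      · simp
  have hae : ∀ᵐ x ∂expLaw (ℕ × ℕ), character θ (passageVector n r x) =
      ∑ i : Fin (n - 1), if Addable n r i then F i x else 0 := by
    filter_upwards [ae_injective, ae_pos_expLaw (ι := ℕ × ℕ)] with x hinj hpos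
    obtain ⟨i₀, hi₀, hF⟩ := exists_isFirst_corner hinj hj
    simp only [hFdef]
    rw [sum_isFirst_corner hi₀ hF, character, character, ← Complex.exp_add, hz, Finset.sum_mul,
      ← Finset.sum_add_distrib]
    refine congrArg Complex.exp (Finset.sum_congr rfl fun k _ => ?_)
    split_ifs with hs
    · have hs' : (k : ℕ) + 1 ≤ addBox r i₀ (n - (k + 1) - 1) := by
        refine hs.trans ?_
        simp only [addBox, Function.update_apply]
        split_ifs with h
        · rw [h]; omega
        · exact le_rfl
      rw [passageVector_of_le hs, passageVector_of_le hs']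
      simp
    · rw [passageVector_addBox hr hpos hi₀ hF hs]
      push_cast
      ring
  have hstep : charPassage θ r = ∑ i : Fin (n - 1),
      if Addable n r i then 1 / (C.card - z) * charPassage θ (addBox r i) else 0 := by
    rw [charPassage, integral_congr_ae hae, integral_finsetSum]
    · refine Finset.sum_congr rfl fun i _ => ?_
      split_ifs with hi
      · have hcard : (C.card : ℂ) = (otherCorners n r i).card + 1 := by
          exact_mod_cast (card_otherCorners hi).symm
        rw [hcard]
        refine integral_isFirst (cornerPoint_notMem n r i) hzre (hm (addBox r i)) (B := 1)
          (fun x => (norm_character _ _).le) fun x s => ?_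
        congr 1
        funext k
        exact passage_update (by simp [addBox]) x s _ _
      · simp
    · intro i _
      split_ifs
      · exact hFint i
      · exact integrable_zero _ _ _
  have hsum : ∑ i : Fin (n - 1), (if Addable n r i then charPassage θ (addBox r i) else 0) =
      (C.card - z) * charPassage θ r := by
    rw [hstep, Finset.mul_sum]
    refine Finset.sum_congr rfl fun i _ => ?_
    split_ifs
    · field_simp
    · simp
  have hcount : ∑ i : Fin (n - 1), (if Addable n r i then charPassage θ r else 0) =
      C.card * charPassage θ r := by
    rw [← Finset.sum_filter, Finset.sum_const, nsmul_eq_mul]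
  have hsplit : (∑ i : Fin (n - 1), if Addable n r i then charPassage θ (addBox r i) -
      charPassage θ r else 0) = ∑ i : Fin (n - 1), (if Addable n r i then
        charPassage θ (addBox r i) else 0) -
      ∑ i : Fin (n - 1), (if Addable n r i then charPassage θ r else 0) := by
    rw [← Finset.sum_sub_distrib]
    refine Finset.sum_congr rfl fun i _ => ?_
    split_ifs <;> simp
  rw [hsplit, hsum, hcount]
  ring

theorem charPassage_of_full (θ : Fin (n - 1) → ℝ)
    (h : ∀ k : Fin (n - 1), (k : ℕ) + 1 ≤ r (n - (k + 1) - 1)) : charPassage θ r = 1 := by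
  have : ∀ x : ℕ × ℕ → ℝ, character θ (passageVector n r x) = 1 := fun x => by
    simp [character, passageVector_of_le (h _)]
  simp [charPassage, this]

end LastPassageLaw

/-! ### Equality of the laws -/

section Main

variable {n : ℕ}

set_option maxRecDepth 100000 in
theorem checkAll_two : checkAll 2 = true := by decide +kernel

set_option maxRecDepth 100000 in
theorem checkAll_three : checkAll 3 = true := by decide +kernel

set_option maxRecDepth 100000 in
theorem checkAll_four : checkAll 4 = true := by decide +kernel

set_option maxRecDepth 100000 in
theorem checkAll_five : checkAll 5 = true := by decide +kernel

set_option maxRecDepth 100000 in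
theorem checkAll_six : checkAll 6 = true := by decide +kernel

/-- The finite check holds in the sizes at hand, by evaluation in the kernel. -/
theorem checkAll_of_le (hn : 2 ≤ n) (hn' : n ≤ 6) : checkAll n = true := by
  interval_cases n
  exacts [checkAll_two, checkAll_three, checkAll_four, checkAll_five, checkAll_six]

theorem checkWord_of_checkAll (h : checkAll n = true) (v : Equiv.Perm (Fin n)) :
    checkWord n (Trie.lookup n (tableauTrie n)) (word v) = true :=
  List.all_eq_true.1 h _ (List.mem_permutations'.2 (word_perm v))

/-- The two characteristic functions agree, since they are determined by the first-step equations. -/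
theorem charLastSwap_eq_charPassage (h : checkAll n = true) (θ : Fin (n - 1) → ℝ) :
    charLastSwap θ 1 = charPassage θ fun _ => 0 :=
  eq_of_firstStep (checkWord_of_checkAll h) (fun k => -(Complex.I * θ k)) (fun k => by simp)
    (charLastSwap θ) (charPassage θ) (charLastSwap_firstStep θ)
    (fun _ hη => charLastSwap_of_settled θ hη) (fun _ hr => charPassage_firstStep θ hr)
    (fun _ _ hr => charPassage_of_full θ hr)

theorem ringTimes_waiting (T : Fin (n - 1) → ℕ → ℝ) :
    ringTimes (fun p => waiting (T p.1) p.2) = T := by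
  funext k m
  induction m with
  | zero => simp [ringTimes, waiting]
  | succ m ih =>
    rw [ringTimes, Finset.sum_range_succ]
    rw [ringTimes] at ih
    rw [ih, waiting]
    ring

theorem ae_lppVector_eq : ∀ᵐ x ∂expLaw (ℕ × ℕ), lppVector n x = passageVector n (fun _ => 0) x := by
  filter_upwards [ae_pos_expLaw (ι := ℕ × ℕ)] with x hx
  funext k
  have hk := k.2
  obtain ⟨a, ha⟩ : ∃ a, n - ((k : ℕ) + 1) = a + 1 := ⟨n - (k + 1) - 1, by omega⟩
  rw [lppVector, passageVector, ha, lpp_eq_passage fun p => (hx p).le]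

/-- Characteristic functions determine laws on `ℝ ^ m`. -/
theorem identDistrib_of_character {m : ℕ} {Ω Ω' : Type*} [MeasurableSpace Ω] [MeasurableSpace Ω']
    {μ : Measure Ω} [IsProbabilityMeasure μ] {ν : Measure Ω'} [IsProbabilityMeasure ν]
    {f : Ω → Fin m → ℝ} {g : Ω' → Fin m → ℝ} (hf : AEMeasurable f μ) (hg : AEMeasurable g ν)
    (h : ∀ θ : Fin m → ℝ, ∫ ω, character θ (f ω) ∂μ = ∫ ω, character θ (g ω) ∂ν) :
    IdentDistrib f g μ ν := by
  refine ⟨hf, hg, ?_⟩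
  have := Measure.isProbabilityMeasure_map hf
  have := Measure.isProbabilityMeasure_map hg
  refine Measure.ext_of_charFunDual (funext fun L => ?_)
  have hL : ∀ v : Fin m → ℝ, Complex.exp (L v * Complex.I) =
      character (fun k => L (Pi.single k 1)) v := fun v => by
    rw [character]
    congr 1
    have hv : L v = ∑ k, v k * L (Pi.single k 1) := by
      conv_lhs => rw [← Finset.univ_sum_single v]
      rw [map_sum]
      refine Finset.sum_congr rfl fun k _ => ?_
      rw [← smul_eq_mul, ← map_smul, ← Pi.single_smul, smul_eq_mul, mul_one]
    rw [hv]
    push_cast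
    rw [Finset.sum_mul]
    exact Finset.sum_congr rfl fun k _ => by ring
  rw [charFunDual_apply, charFunDual_apply]
  simp only [hL]
  rw [integral_map hf (continuous_character _).aestronglyMeasurable,
    integral_map hg (continuous_character _).aestronglyMeasurable]
  exact h _

end Main
end OrientedSwap

theorem mainTheorem3 {Ω Ω' : Type*} [MeasurableSpace Ω] [MeasurableSpace Ω']
    (μ : Measure Ω) [IsProbabilityMeasure μ] (ν : Measure Ω') [IsProbabilityMeasure ν]
    (n : ℕ) (hn : 2 ≤ n) (hn' : n ≤ 6)
    (T : Fin (n - 1) → ℕ → Ω → ℝ) (hT : OrientedSwap.IsPoissonClocks T μ)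
    (X : ℕ × ℕ → Ω' → ℝ) (hX : OrientedSwap.IsIIDExp X ν) :
    IdentDistrib (fun ω => OrientedSwap.lastSwap (fun k m => T k m ω))
      (fun ω => OrientedSwap.lppVector n (fun p => X p ω)) μ ν := by
  open OrientedSwap in
  set W : Ω → Fin (n - 1) × ℕ → ℝ := fun ω p => waiting (fun m => T p.1 m ω) p.2 with hW
  set Y : Ω' → ℕ × ℕ → ℝ := fun ω p => X p ω with hY
  have hWm : Measurable W := measurable_pi_iff.2 fun p => hT.measurable p
  have hYm : Measurable Y := measurable_pi_iff.2 fun p => hX.measurable p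
  have hWlaw : μ.map W = expLaw _ := hT.map_eq
  have hYlaw : ν.map Y = expLaw _ := hX.map_eq
  have hswap : (fun ω => lastSwap fun k m => T k m ω) =
      (fun x => lastSwapFrom (ringTimes x) 1) ∘ W := by
    funext ω
    rw [Function.comp_apply, lastSwap_eq, ← ringTimes_waiting fun k m => T k m ω]
  have hlpp : (fun ω => lppVector n fun p => X p ω) =ᵐ[ν] passageVector n (fun _ => 0) ∘ Y := by
    have := ae_lppVector_eq (n := n)
    rw [← hYlaw] at this
    exact ae_of_ae_map hYm.aemeasurable this
  have hf : AEMeasurable (fun x => lastSwapFrom (ringTimes x) (1 : Equiv.Perm (Fin n)))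
      (μ.map W) := by
    rw [hWlaw]; exact aemeasurable_lastSwapFrom 1
  have hg : Measurable (passageVector n fun _ => 0) := measurable_passageVector n _
  have hfW := hf.comp_measurable hWm
  have hgY := (hg.comp hYm).aemeasurable (μ := ν)
  rw [hswap]
  refine IdentDistrib.trans ?_ (IdentDistrib.of_ae_eq hgY hlpp.symm)
  refine identDistrib_of_character hfW hgY fun θ => ?_
  have h1 : ∫ ω, character θ (((fun x => lastSwapFrom (ringTimes x) 1) ∘ W) ω) ∂μ =
      charLastSwap θ 1 := by
    rw [charLastSwap, ← hWlaw]
    exact (integral_map hWm.aemeasurable ((continuous_character θ).measurable.comp_aemeasurable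
      hf).aestronglyMeasurable).symm
  have h2 : ∫ ω, character θ ((passageVector n (fun _ => 0) ∘ Y) ω) ∂ν =
      charPassage θ fun _ => 0 := by
    rw [charPassage, ← hYlaw]
    exact (integral_map hYm.aemeasurable ((continuous_character θ).measurable.comp
      hg).aestronglyMeasurable).symm
  rw [h1, h2, charLastSwap_eq_charPassage (checkAll_of_le hn hn')]
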